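/- **Conventions.** A vertex algebra is a $\mathbb Z$-graded complex vector space $V$ (parity $=$ degree mod $2$) with a vacuum $|0\rangle\in V_0$ and a degree-zero linear state-field map $a\mapsto Y(a,z)=\sum_n a_{(n)}z^{-n-1}$ into fields, satisfying the vacuum axioms, translation covariance $[\mathcal T,Y(a,z)]=\partial_zY(a,z)$ with $\mathcal T a=a_{(-2)}|0\rangle$, and mutual (super)locality. A conformal vector of central charge $c$ is $\nu\in V_0$ such that the modes of $Y(\nu,z)=\sum L_nz^{-n-2}$ satisfy the Virasoro relations of central charge $c$, $L_{-1}=\mathcal T$, and $L_0$ is diagonalizable. For odd $\tau^\pm$ and even $j$ write $Y(\tau^\pm,z)=\sum_{r\in\frac12+\mathbb Z}G^\pm_rz^{-r-3/2}$ and $Y(j,z)=\sum_n J_nz^{-n-1}$. Then $(\nu,\tau^\pm,j)$ defines an $N=2$ superconformal vertex algebra (SCVA) of central charge $c$, with normalization $\kappa$, if $\nu$ is a conformal vector of central charge $c$ and $$[G^-_r,G^+_s]=\kappa\Big(2L_{r+s}-(r-s)J_{r+s}+\tfrac c3\big(r^2-\tfrac14\big)\delta_{r+s,0}\Big),\qquad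 [G^\pm_r,G^\pm_s]=0,$$ $$[L_n,G^\pm_r]=\big(\tfrac n2-r\big)G^\pm_{n+r},\quad [L_n,J_m]=-mJ_{m+n},\quad [J_m,J_n]=\tfrac c3m\,\delta_{m+n,0},\quad [J_n,G^\pm_r]=\pm G^\pm_{n+r}.$$ **Setting.** Let $T$ be a finite-dimensional complex vector space with a nondegenerate symmetric bilinear form $g$ and a polarization $T=T'\oplus T''$, i.e. $g$ vanishes on $T'\times T'$ and on $T''\times T''$. Let $\{e^i\}$, $\{f^i\}$ be bases of $T'$, $T''$ with $g(e^i,f^j)=\delta_{ij}$. Write them $b^i,c^i$ in the bosonic and $\varphi^i,\psi^i$ in the fermionic sector. Write $a_n=t^na$. * $B(T,g)=S(\bigoplus_{n>0}t^{-n}T)$. For $a\in T$ let $a(z)=\sum_n a_{(n)}z^{-n-1}$, where $a_{(n)}$ is multiplication by $a_n$ for $n<0$ and $n$ times the contraction by $a_{-n}$ for $n\ge0$. It carries the vertex algebra structure in degree $0$ with vacuum $1$ and $Y(a^1_{-k_1-1}\cdots a^m_{-k_m-1},z)={:}\partial^{(k_1)}a^1(z)\cdots\partial^{(k_m)}a^m(z){:}$,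 where $\partial^{(k)}=\partial_z^k/k!$. * $F(T,g)_{NS}=\Lambda(\bigoplus_{n>0}t^{-n+\frac12}T)$, and for $\phi\in T$, $\phi(z)=\sum_{r\in\frac12+\mathbb Z}\phi_{(r)}z^{-r-\frac12}$, where $\phi_{(r)}$ is exterior multiplication by $\phi_r$ for $r<0$ and the contraction by $\phi_{-r}$ for $r>0$. * $F(T,g)_R=\Lambda(\bigoplus_{n\ge0}t^{-n}T')\otimes\Lambda(\bigoplus_{n>0}t^{-n}T'')$. Let $\varphi(z)=\sum_n\varphi_{(n)}z^{-n}$ for $\varphi\in T'$, where $\varphi_{(n)}$ is exterior multiplication by $\varphi_n$ for $n\le0$ and the contraction by $\varphi_{-n}$ for $n>0$. Let $\psi(z)=\sum_n\psi_{(n)}z^{-n-1}$ for $\psi\in T''$, where $\psi_{(n)}$ is exterior multiplication by $\psi_n$ for $n<0$ and the contraction by $\psi_{-n}$ for $n\ge0$. All contractions are taken with respect to $g$. The fermionic spaces are graded by charge: the generators from $T'$ have degree $-1$, those from $T''$ degree $+1$. **Proposition 5.1.** (a) There is a vertex algebra structure on $F(T,g)_{NS}$ with vacuum $1$ and $$Y(\varphi^{i_1}_{-k_1-\frac12}\cdots\varphi^{i_m}_{-k_m-\frac12}\psi^{j_1}_{-l_1-\frac12}\cdots\psi^{j_n}_{-l_n-\frac12},z)={:}\partial^{(k_1)}\varphi^{i_1}(z)\cdots\partial^{(k_m)}\varphi^{i_m}(z)\,\partial^{(l_1)}\psi^{j_1}(z)\cdots\partial^{(l_n)}\psi^{j_n}(z){:}$$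 (more generally the same formula holds for generators from any elements of $T$, in any order), and for every $\lambda\in\mathbb C$, $$\nu_\lambda=(1-\lambda)\sum_i\varphi^i_{-\frac32}\psi^i_{-\frac12}+\lambda\sum_i\psi^i_{-\frac32}\varphi^i_{-\frac12}$$ is a conformal vector of central charge $-(6\lambda^2-6\lambda+1)\dim T$. The same holds for $F(T,g)_R$ with $\varphi^i_{-k-\frac12}$ replaced by $\varphi^i_{-k}$ and $\psi^i_{-k-\frac12}$ replaced by $\psi^i_{-k-1}$ for all $k\ge 0$. (b) The tensor product vertex algebra $V(T,g)_{NS}=F(T,g)_{NS}\otimes B(T,g)$ is an $N=2$ SCVA of central charge $\frac32\dim T$, with normalization $\kappa=\frac12$, given by $$\tau^+=\sum_i b^i_{-1}\psi^i_{-\frac12},\quad \tau^-=\sum_i c^i_{-1}\varphi^i_{-\frac12},\quad j=\sum_i\psi^i_{-\frac12}\varphi^i_{-\frac12},$$ $$\nu=\sum_i\Big(b^i_{-1}c^i_{-1}+\tfrac12\varphi^i_{-\frac32}\psi^i_{-\frac12}+\tfrac12\psi^i_{-\frac32}\varphi^i_{-\frac12}\Big);$$ equivalently, $(\nu,\sqrt2\,\tau^\pm,j)$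 is an $N=2$ SCVA structure with normalization $\kappa=1$. The same holds for $V(T,g)_R=F(T,g)_R\otimes B(T,g)$ after replacing $\varphi^i_{-\frac12},\varphi^i_{-\frac32},\psi^i_{-\frac12},\psi^i_{-\frac32}$ by $\varphi^i_0,\varphi^i_{-1},\psi^i_{-1},\psi^i_{-2}$ respectively. -/

import Mathlib

open scoped TensorProduct

noncomputable section

/-! ### Vertex algebras -/

/-- A `ℤ`-graded (super) vertex algebra structure on a complex vector space `V`. The parity of a
homogeneous vector is its degree mod 2. A field is a Mathlib `VertexOperator`, and
`VertexOperator.ncoeff (Y a) n` is the mode `a_(n)` in `Y(a,z) = ∑ a_(n) z^(-n-1)`; the condition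
`a_(n) v = 0` for `n ≫ 0` is part of the type `VertexOperator`. -/
structure VertexAlgebra (V : Type*) [AddCommGroup V] [Module ℂ V] where
  /-- homogeneous components -/
  grading : ℤ → Submodule ℂ V
  isInternal : DirectSum.IsInternal grading
  /-- the vacuum vector -/
  vacuum : V
  vacuum_mem : vacuum ∈ grading 0
  /-- the state-field correspondence -/
  Y : V →ₗ[ℂ] VertexOperator ℂ V
  /-- `Y` has degree zero -/
  mode_mem : ∀ {p q : ℤ} {a b : V}, a ∈ grading p → b ∈ grading q → ∀ n : ℤ,
    VertexOperator.ncoeff (Y a) n b ∈ grading (p + q)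
  /-- `[T, Y(a,z)] = ∂_z Y(a,z)` with `T b = b_(-2)|0⟩` -/
  translation : ∀ (a v : V) (n : ℤ),
    VertexOperator.ncoeff (Y (VertexOperator.ncoeff (Y a) n v)) (-2) vacuum
      - VertexOperator.ncoeff (Y a) n (VertexOperator.ncoeff (Y v) (-2) vacuum)
      = (-(n : ℂ)) • VertexOperator.ncoeff (Y a) (n - 1) v
  /-- `Y(|0⟩, z) = id` -/
  vacuum_mode : ∀ (n : ℤ) (v : V),
    VertexOperator.ncoeff (Y vacuum) n v = if n = -1 then v else 0
  /-- `Y(a,z)|0⟩` has no negative powers of `z` -/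
  mode_vacuum : ∀ (a : V) (n : ℤ), 0 ≤ n → VertexOperator.ncoeff (Y a) n vacuum = 0
  /-- `Y(a,z)|0⟩` takes the value `a` at `z = 0` -/
  creation : ∀ a : V, VertexOperator.ncoeff (Y a) (-1) vacuum = a
  /-- `(z - w)^N [Y(a,z), Y(b,w)] = 0` for some `N`, with the supercommutator: this is the
  coefficient of `z^(-m-1) w^(-n-1)`. -/
  locality : ∀ {p q : ℤ} {a b : V}, a ∈ grading p → b ∈ grading q → ∃ N : ℕ,
    ∀ (m n : ℤ) (v : V), ∑ i ∈ Finset.range (N + 1), ((-1 : ℂ) ^ i * (N.choose i : ℂ)) •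
      (VertexOperator.ncoeff (Y a) (m + N - i) (VertexOperator.ncoeff (Y b) (n + i) v)
        - (-1 : ℂ) ^ (p * q) •
          VertexOperator.ncoeff (Y b) (n + i) (VertexOperator.ncoeff (Y a) (m + N - i) v)) = 0

namespace VertexAlgebra

/-- The mode `a_(n)`, the coefficient of `z^(-n-1)` in `Y(a,z)`. -/
def mode {V : Type*} [AddCommGroup V] [Module ℂ V] (A : VertexAlgebra V) (a : V) (n : ℤ) :
    Module.End ℂ V :=
  VertexOperator.ncoeff (A.Y a) n

/-- The even vectors. -/
def evenPart {V : Type*} [AddCommGroup V] [Module ℂ V] (A : VertexAlgebra V) : Submodule ℂ V :=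
  ⨆ (p : ℤ) (_ : Even p), A.grading p

/-- The odd vectors. -/
def oddPart {V : Type*} [AddCommGroup V] [Module ℂ V] (A : VertexAlgebra V) : Submodule ℂ V :=
  ⨆ (p : ℤ) (_ : Odd p), A.grading p

/-- `ν` is a conformal vector of central charge (rank) `c`:
with `Y(ν,z) = ∑ L_n z^(-n-2)`, i.e. `L_n = ν_(n+1)`. -/
structure IsConformal {V : Type*} [AddCommGroup V] [Module ℂ V] (A : VertexAlgebra V)
    (ν : V) (c : ℂ) : Prop where
  mem : ν ∈ A.grading 0
  /-- `[L_m, L_n] = (m - n) L_(m+n) + (m^3 - m)/12 δ_(m+n,0) c` -/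
  virasoro : ∀ m n : ℤ,
    A.mode ν (m + 1) * A.mode ν (n + 1) - A.mode ν (n + 1) * A.mode ν (m + 1)
      = ((m : ℂ) - n) • A.mode ν (m + n + 1)
        + (if m + n = 0 then ((m : ℂ) ^ 3 - m) * c / 12 else 0) • (1 : Module.End ℂ V)
  /-- `L_(-1) = T` -/
  translation : ∀ a : V, A.mode ν 0 a = A.mode a (-2) A.vacuum
  /-- `L_0` is diagonalizable -/
  diagonalizable : ⨆ μ : ℂ, Module.End.eigenspace (A.mode ν 1) μ = ⊤

/-- `(ν, τ⁺, τ⁻, j)` makes `A` an `N = 2` superconformal vertex algebra of central charge `c`.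
The fields are `L_n = ν_(n+1)`, `J_n = j_(n)` and `G^±_r = (τ^±)_(r+1/2)` for `r ∈ 1/2 + ℤ`; below
half-integers are written `r = m + 1/2`, `s = n + 1/2`, so that `G^±_r = (τ^±)_(m+1)`.
The constant `κ` is the normalization of the supercurrents,
`[G⁻_r, G⁺_s] = κ (2 L_(r+s) - (r-s) J_(r+s) + c/3 (r^2 - 1/4) δ_(r+s,0))`;
the usual choices are `κ = 1` and `κ = 1/2`. -/
structure IsN2Superconformal {V : Type*} [AddCommGroup V] [Module ℂ V] (A : VertexAlgebra V)
    (κ c : ℂ) (ν τp τm j : V) : Prop where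
  conformal : A.IsConformal ν c
  τp_odd : τp ∈ A.oddPart
  τm_odd : τm ∈ A.oddPart
  j_even : j ∈ A.evenPart
  /-- `[G⁻_r, G⁺_s]` with `r = m + 1/2`, `s = n + 1/2` -/
  gm_gp : ∀ m n : ℤ,
    A.mode τm (m + 1) * A.mode τp (n + 1) + A.mode τp (n + 1) * A.mode τm (m + 1)
      = κ • ((2 : ℂ) • A.mode ν ((m + n + 1) + 1)
          - (((m : ℂ) + 1 / 2) - ((n : ℂ) + 1 / 2)) • A.mode j (m + n + 1)
          + (if m + n + 1 = 0 then c / 3 * (((m : ℂ) + 1 / 2) ^ 2 - 1 / 4) else 0) •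
              (1 : Module.End ℂ V))
  gp_gp : ∀ m n : ℤ,
    A.mode τp (m + 1) * A.mode τp (n + 1) + A.mode τp (n + 1) * A.mode τp (m + 1) = 0
  gm_gm : ∀ m n : ℤ,
    A.mode τm (m + 1) * A.mode τm (n + 1) + A.mode τm (n + 1) * A.mode τm (m + 1) = 0
  /-- `[L_m, G⁺_s] = (m/2 - s) G⁺_(m+s)` with `s = n + 1/2` -/
  l_gp : ∀ m n : ℤ,
    A.mode ν (m + 1) * A.mode τp (n + 1) - A.mode τp (n + 1) * A.mode ν (m + 1)
      = ((m : ℂ) / 2 - ((n : ℂ) + 1 / 2)) • A.mode τp (m + n + 1)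
  /-- `[L_m, G⁻_s] = (m/2 - s) G⁻_(m+s)` with `s = n + 1/2` -/
  l_gm : ∀ m n : ℤ,
    A.mode ν (m + 1) * A.mode τm (n + 1) - A.mode τm (n + 1) * A.mode ν (m + 1)
      = ((m : ℂ) / 2 - ((n : ℂ) + 1 / 2)) • A.mode τm (m + n + 1)
  /-- `[L_m, J_n] = -n J_(m+n)` -/
  l_j : ∀ m n : ℤ,
    A.mode ν (m + 1) * A.mode j n - A.mode j n * A.mode ν (m + 1)
      = (-(n : ℂ)) • A.mode j (m + n)
  /-- `[J_m, J_n] = c/3 m δ_(m+n,0)` -/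
  j_j : ∀ m n : ℤ,
    A.mode j m * A.mode j n - A.mode j n * A.mode j m
      = (if m + n = 0 then c / 3 * (m : ℂ) else 0) • (1 : Module.End ℂ V)
  /-- `[J_m, G⁺_s] = G⁺_(m+s)` -/
  j_gp : ∀ m n : ℤ,
    A.mode j m * A.mode τp (n + 1) - A.mode τp (n + 1) * A.mode j m = A.mode τp (m + n + 1)
  /-- `[J_m, G⁻_s] = -G⁻_(m+s)` -/
  j_gm : ∀ m n : ℤ,
    A.mode j m * A.mode τm (n + 1) - A.mode τm (n + 1) * A.mode j m = -A.mode τm (m + n + 1)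

/-- `C` is the tensor product of the vertex algebras `A` and `B`:
`Y(u ⊗ v, z) = Y(u,z) ⊗ Y(v,z)`, that is
`(u ⊗ v)_(k) = ∑_{m+n=k-1} u_(m) ⊗ v_(n)` with the Koszul sign rule. -/
structure IsTensorProduct {U W : Type*} [AddCommGroup U] [Module ℂ U] [AddCommGroup W] [Module ℂ W]
    (A : VertexAlgebra U) (B : VertexAlgebra W) (C : VertexAlgebra (U ⊗[ℂ] W)) : Prop where
  vacuum_eq : C.vacuum = A.vacuum ⊗ₜ[ℂ] B.vacuum
  grading_mem : ∀ {p q : ℤ} {u : U} {v : W}, u ∈ A.grading p → v ∈ B.grading q →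
    u ⊗ₜ[ℂ] v ∈ C.grading (p + q)
  mode_tmul : ∀ {p q : ℤ} {x : U} {v : W}, x ∈ A.grading p → v ∈ B.grading q →
    ∀ (u : U) (y : W) (k : ℤ), C.mode (u ⊗ₜ[ℂ] v) k (x ⊗ₜ[ℂ] y)
      = (-1 : ℂ) ^ (p * q) • ∑ᶠ m : ℤ, (A.mode u m x) ⊗ₜ[ℂ] (B.mode v (k - 1 - m) y)

end VertexAlgebra

/-! ### Formal distributions and normally ordered products

A formal distribution `a(z) = ∑ a_(n) z^(-n-1)` on `V` is given by its modes `ℤ → V → V`. -/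

/-- The derivative `∂_z a(z)`, `(∂a)_(n) = -n a_(n-1)`. -/
def distDeriv {V : Type*} [AddCommGroup V] [Module ℂ V] (a : ℤ → V → V) : ℤ → V → V :=
  fun n v => (-(n : ℂ)) • a (n - 1) v

/-- The divided derivative `∂_z^(k) a(z) = (1/k!) ∂_z^k a(z)`. -/
def distDividedDeriv {V : Type*} [AddCommGroup V] [Module ℂ V] (k : ℕ) (a : ℤ → V → V) :
    ℤ → V → V :=
  fun n v => ((k.factorial : ℂ)⁻¹) • (distDeriv^[k] a) n v

/-- The normally ordered product `:a(z)b(z):` of two fields, `ε = ±1` being the sign of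
interchanging `a` and `b`:
`(:ab:)_(n) = ∑_{j<0} a_(j) b_(n-j-1) + ε ∑_{j≥0} b_(n-j-1) a_(j)`.
On fields both sums are finite on every vector. -/
def normalProduct {V : Type*} [AddCommGroup V] [Module ℂ V] (ε : ℂ) (a b : ℤ → V → V) :
    ℤ → V → V :=
  fun n v => (∑ᶠ j : ℕ, a (-(j : ℤ) - 1) (b (n + j) v))
    + ε • ∑ᶠ j : ℕ, b (n - j - 1) (a j v)

/-- The normally ordered product `:a¹(z) a²(z) ⋯ aᵐ(z): = :a¹(z)(:a²(z) ⋯ aᵐ(z):):` of a list of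
fields that are all even (`ε = 1`) or all odd (`ε = -1`); the empty product is the identity. -/
def normalProductList {V : Type*} [AddCommGroup V] [Module ℂ V] (ε : ℂ) :
    List (ℤ → V → V) → (ℤ → V → V)
  | [] => fun n v => if n = -1 then v else 0
  | a :: l => normalProduct (ε ^ l.length) a (normalProductList ε l)

/-! ### The bosonic Fock space -/

/-- `B(T,g) = S(⨁_{n<0} t^n T)`; the coefficient at `k : ℕ` is the one of `t^(-k-1)`. -/
abbrev BosonFock (T : Type*) [AddCommGroup T] [Module ℂ T] : Type _ :=
  SymmetricAlgebra ℂ (ℕ →₀ T)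

/-- Contraction of the symmetric algebra by a linear form `d`: the derivation that extends `d`
(read off from the algebra map `S(M) → S(M)[ε]`, `m ↦ m + d(m) ε`). -/
def symContract {M : Type*} [AddCommGroup M] [Module ℂ M] (d : Module.Dual ℂ M) :
    Module.End ℂ (SymmetricAlgebra ℂ M) :=
  (TrivSqZeroExt.sndHom (SymmetricAlgebra ℂ M) (SymmetricAlgebra ℂ M)).restrictScalars ℂ ∘ₗ
    (SymmetricAlgebra.lift (A := DualNumber (SymmetricAlgebra ℂ M))
      ((TrivSqZeroExt.inlAlgHom ℂ (SymmetricAlgebra ℂ M) (SymmetricAlgebra ℂ M)).toLinearMap ∘ₗ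
          SymmetricAlgebra.ι ℂ M
        + (TrivSqZeroExt.inrHom (SymmetricAlgebra ℂ M) (SymmetricAlgebra ℂ M)).restrictScalars ℂ ∘ₗ
          (Algebra.linearMap ℂ (SymmetricAlgebra ℂ M) ∘ₗ d))).toLinearMap

/-- The element `a_{-k-1} = t^(-k-1) a` of `B(T,g)`. -/
def bosonGen {T : Type*} [AddCommGroup T] [Module ℂ T] (k : ℕ) (a : T) : BosonFock T :=
  SymmetricAlgebra.ι ℂ (ℕ →₀ T) (Finsupp.single k a)

/-- The modes of `a(z) = ∑ a_(n) z^(-n-1)` on `B(T,g)`: multiplication by `a_n` for `n < 0`, and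
`n` times the contraction by `a_{-n}` for `n ≥ 0`. -/
def bosonMode {T : Type*} [AddCommGroup T] [Module ℂ T] (g : LinearMap.BilinForm ℂ T) (a : T) :
    ℤ → Module.End ℂ (BosonFock T)
  | Int.negSucc k => LinearMap.mulLeft ℂ (bosonGen k a)
  | Int.ofNat 0 => 0
  | Int.ofNat (k + 1) => ((k : ℂ) + 1) • symContract (g a ∘ₗ Finsupp.lapply k)

/-- `B` is the vertex algebra structure on `B(T,g)`, with vacuum `1`, all generators even of
degree `0`, and `Y(a¹_{-k₁-1} ⋯ aᵐ_{-kₘ-1}, z) = :∂^(k₁)a¹(z) ⋯ ∂^(kₘ)aᵐ(z):`. -/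
structure IsBosonVertexAlgebra {T : Type*} [AddCommGroup T] [Module ℂ T]
    (g : LinearMap.BilinForm ℂ T) (B : VertexAlgebra (BosonFock T)) : Prop where
  vacuum_eq : B.vacuum = 1
  gen_mem : ∀ (k : ℕ) (a : T), bosonGen k a ∈ B.grading 0
  mode_eq : ∀ (l : List (ℕ × T)) (n : ℤ) (v : BosonFock T),
    B.mode (l.map fun x => bosonGen x.1 x.2).prod n v
      = normalProductList 1
          (l.map fun x => distDividedDeriv x.1 fun m w => bosonMode g x.2 m w) n v

/-! ### The fermionic Fock space, NS sector -/

/-- `F(T,g)_NS = Λ(⨁_{n>0} t^(-n+1/2) T)`; the coefficient at `k : ℕ` is the one of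
`t^(-k-1/2)`. -/
abbrev FermionFockNS (T : Type*) [AddCommGroup T] [Module ℂ T] : Type _ :=
  ExteriorAlgebra ℂ (ℕ →₀ T)

/-- The element `t_{-k-1/2}` of `F(T,g)_NS`. -/
def fermionGenNS {T : Type*} [AddCommGroup T] [Module ℂ T] (k : ℕ) (t : T) : FermionFockNS T :=
  ExteriorAlgebra.ι ℂ (Finsupp.single k t)

/-- The modes of `t(z) = ∑_{r ∈ 1/2+ℤ} t_(r) z^(-r-1/2)` on `F(T,g)_NS`, as coefficients of
`z^(-n-1)`, so `r = n + 1/2`: exterior product by `t_r` for `r < 0`, and contraction by `t_{-r}`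
for `r > 0`. -/
def fermionModeNS {T : Type*} [AddCommGroup T] [Module ℂ T] (g : LinearMap.BilinForm ℂ T) (t : T) :
    ℤ → Module.End ℂ (FermionFockNS T)
  | Int.negSucc k => LinearMap.mulLeft ℂ (fermionGenNS k t)
  | Int.ofNat k => CliffordAlgebra.contractLeft (g t ∘ₗ Finsupp.lapply k)

/-- `F` is the vertex algebra structure on `F(T' ⊕ T'',g)_NS`, with vacuum `1`, generators from
`T'` (resp. `T''`) of degree `-1` (resp. `1`), and
`Y(t¹_{-k₁-1/2} ⋯ tᵐ_{-kₘ-1/2}, z) = :∂^(k₁)t¹(z) ⋯ ∂^(kₘ)tᵐ(z):`. -/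
structure IsFermionVertexAlgebraNS {T : Type*} [AddCommGroup T] [Module ℂ T]
    (g : LinearMap.BilinForm ℂ T) (T' T'' : Submodule ℂ T)
    (F : VertexAlgebra (FermionFockNS T)) : Prop where
  vacuum_eq : F.vacuum = 1
  gen_mem' : ∀ (k : ℕ), ∀ t ∈ T', fermionGenNS k t ∈ F.grading (-1)
  gen_mem'' : ∀ (k : ℕ), ∀ t ∈ T'', fermionGenNS k t ∈ F.grading 1
  mode_eq : ∀ (l : List (ℕ × T)) (n : ℤ) (v : FermionFockNS T),
    F.mode (l.map fun x => fermionGenNS x.1 x.2).prod n v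
      = normalProductList (-1)
          (l.map fun x => distDividedDeriv x.1 fun m w => fermionModeNS g x.2 m w) n v

/-! ### The fermionic Fock space, R sector -/

/-- `F(T,g)_R = Λ(⨁_{n≥0} t^(-n) T') ⊗ Λ(⨁_{n>0} t^(-n) T'')`, written as the exterior algebra of
the direct sum; the coefficient at `k : ℕ` is the one of `t^(-k)` in the first summand and the one
of `t^(-k-1)` in the second. -/
abbrev FermionFockR {T : Type*} [AddCommGroup T] [Module ℂ T] (T' T'' : Submodule ℂ T) : Type _ :=
  ExteriorAlgebra ℂ ((ℕ →₀ T') × (ℕ →₀ T''))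

/-- The generators of `F(T,g)_R`: `φ_{-k}` for `(k, φ)` with `φ ∈ T'`, and `ψ_{-k-1}` for `(k, ψ)`
with `ψ ∈ T''`. -/
def fermionGenR {T : Type*} [AddCommGroup T] [Module ℂ T] {T' T'' : Submodule ℂ T} :
    (ℕ × T') ⊕ (ℕ × T'') → FermionFockR T' T''
  | Sum.inl x => ExteriorAlgebra.ι ℂ (Finsupp.single x.1 x.2, 0)
  | Sum.inr y => ExteriorAlgebra.ι ℂ (0, Finsupp.single y.1 y.2)

/-- The modes of `φ(z) = ∑ φ_n z^(-n)` for `φ ∈ T'`, and of `ψ(z) = ∑ ψ_n z^(-n-1)` for `ψ ∈ T''`,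
on `F(T,g)_R`, as coefficients of `z^(-n-1)`. For `φ ∈ T'` the coefficient is `φ_{n+1}`: exterior
product by `φ_{n+1}` if `n + 1 ≤ 0`, contraction by `φ_{-n-1}` if `n + 1 > 0`. For `ψ ∈ T''` it is
`ψ_n`: exterior product by `ψ_n` if `n < 0`, contraction by `ψ_{-n}` if `n ≥ 0`. Here
`φ_{-n-1}` is paired with `t^(-n-1) T''`, and `ψ_{-n}` with `t^(-n) T'`, through `g`. -/
def fermionModeR {T : Type*} [AddCommGroup T] [Module ℂ T] (g : LinearMap.BilinForm ℂ T)
    {T' T'' : Submodule ℂ T} : T' ⊕ T'' → ℤ → Module.End ℂ (FermionFockR T' T'')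
  | Sum.inl φ, Int.negSucc k => LinearMap.mulLeft ℂ (fermionGenR (Sum.inl (k, φ)))
  | Sum.inl φ, Int.ofNat k => CliffordAlgebra.contractLeft
      ((g (φ : T) ∘ₗ T''.subtype) ∘ₗ Finsupp.lapply k ∘ₗ LinearMap.snd ℂ (ℕ →₀ T') (ℕ →₀ T''))
  | Sum.inr ψ, Int.negSucc k => LinearMap.mulLeft ℂ (fermionGenR (Sum.inr (k, ψ)))
  | Sum.inr ψ, Int.ofNat k => CliffordAlgebra.contractLeft
      ((g (ψ : T) ∘ₗ T'.subtype) ∘ₗ Finsupp.lapply k ∘ₗ LinearMap.fst ℂ (ℕ →₀ T') (ℕ →₀ T''))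

/-- `∂^(k)φ(z)` resp. `∂^(k)ψ(z)` on `F(T,g)_R`. -/
def fermionDerivR {T : Type*} [AddCommGroup T] [Module ℂ T] (g : LinearMap.BilinForm ℂ T)
    {T' T'' : Submodule ℂ T} :
    (ℕ × T') ⊕ (ℕ × T'') → ℤ → FermionFockR T' T'' → FermionFockR T' T''
  | Sum.inl x => distDividedDeriv x.1 fun m w => fermionModeR g (Sum.inl x.2) m w
  | Sum.inr y => distDividedDeriv y.1 fun m w => fermionModeR g (Sum.inr y.2) m w

/-- `F` is the vertex algebra structure on `F(T' ⊕ T'',g)_R`, with vacuum `1`, generators from `T'`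
(resp. `T''`) of degree `-1` (resp. `1`), and
`Y(φ¹_{-k₁} ⋯ φᵐ_{-kₘ} ψ¹_{-l₁-1} ⋯ ψⁿ_{-lₙ-1}, z) = :∂^(k₁)φ¹(z) ⋯ ∂^(lₙ)ψⁿ(z):`
(the generators may come in any order). -/
structure IsFermionVertexAlgebraR {T : Type*} [AddCommGroup T] [Module ℂ T]
    (g : LinearMap.BilinForm ℂ T) (T' T'' : Submodule ℂ T)
    (F : VertexAlgebra (FermionFockR T' T'')) : Prop where
  vacuum_eq : F.vacuum = 1
  gen_mem' : ∀ x : ℕ × T', fermionGenR (Sum.inl x) ∈ F.grading (-1)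
  gen_mem'' : ∀ y : ℕ × T'', fermionGenR (Sum.inr y) ∈ F.grading 1
  mode_eq : ∀ (l : List ((ℕ × T') ⊕ (ℕ × T''))) (n : ℤ) (v : FermionFockR T' T''),
    F.mode (l.map fermionGenR).prod n v
      = normalProductList (-1) (l.map (fermionDerivR g)) n v

/-! ### The distinguished vectors

Both sectors are treated at once: `φ k i` stands for `φ^i_{-k-1/2}` (NS) or `φ^i_{-k}` (R), and
`ψ k i` for `ψ^i_{-k-1/2}` (NS) or `ψ^i_{-k-1}` (R). -/

/-- NS: `ν_lam = (1-lam) ∑ φ^i_{-3/2} ψ^i_{-1/2} + lam ∑ ψ^i_{-3/2} φ^i_{-1/2}`;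
R: `ν_lam = (1-lam) ∑ φ^i_{-1} ψ^i_{-1} + lam ∑ ψ^i_{-2} φ^i_0`. -/
def fermionConformalVector {ι F : Type*} [Fintype ι] [Ring F] [Algebra ℂ F] (φ ψ : ℕ → ι → F)
    (lam : ℂ) : F :=
  (1 - lam) • ∑ i, φ 1 i * ψ 0 i + lam • ∑ i, ψ 1 i * φ 0 i

/-- `τ⁺ = ∑ b^i_{-1} ψ^i_{-1/2}` (R: `ψ^i_{-1}`), where `b = (b^i_{-1})`. -/
def tauPlus {ι F B : Type*} [Fintype ι] [Ring F] [Algebra ℂ F] [CommRing B] [Algebra ℂ B]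
    (ψ : ℕ → ι → F) (b : ι → B) : F ⊗[ℂ] B :=
  ∑ i, ψ 0 i ⊗ₜ[ℂ] b i

/-- `τ⁻ = ∑ c^i_{-1} φ^i_{-1/2}` (R: `φ^i_0`), where `c = (c^i_{-1})`. -/
def tauMinus {ι F B : Type*} [Fintype ι] [Ring F] [Algebra ℂ F] [CommRing B] [Algebra ℂ B]
    (φ : ℕ → ι → F) (c : ι → B) : F ⊗[ℂ] B :=
  ∑ i, φ 0 i ⊗ₜ[ℂ] c i

/-- `j = ∑ ψ^i_{-1/2} φ^i_{-1/2}` (R: `∑ ψ^i_{-1} φ^i_0`). -/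
def currentVector {ι F : Type*} (B : Type*) [Fintype ι] [Ring F] [Algebra ℂ F] [CommRing B]
    [Algebra ℂ B] (φ ψ : ℕ → ι → F) : F ⊗[ℂ] B :=
  ∑ i, (ψ 0 i * φ 0 i) ⊗ₜ[ℂ] (1 : B)

/-- `ν = ∑ (b^i_{-1} c^i_{-1} + ½ φ^i_{-3/2} ψ^i_{-1/2} + ½ ψ^i_{-3/2} φ^i_{-1/2})`
(R: `∑ (b^i_{-1} c^i_{-1} + ½ φ^i_{-1} ψ^i_{-1} + ½ ψ^i_{-2} φ^i_0)`). -/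
def conformalVector {ι F B : Type*} [Fintype ι] [Ring F] [Algebra ℂ F] [CommRing B] [Algebra ℂ B]
    (φ ψ : ℕ → ι → F) (b c : ι → B) : F ⊗[ℂ] B :=
  ∑ i, ((1 : F) ⊗ₜ[ℂ] (b i * c i) + (1 / 2 : ℂ) • ((φ 1 i * ψ 0 i) ⊗ₜ[ℂ] (1 : B))
    + (1 / 2 : ℂ) • ((ψ 1 i * φ 0 i) ⊗ₜ[ℂ] (1 : B)))

end

set_option linter.unusedSectionVars false

noncomputable section

/-! ### Formal distributions in several variables -/


namespace FormalDistribution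

variable {X Y V W : Type*} [AddCommGroup V] [Module ℂ V] [AddCommGroup W] [Module ℂ W]

/-! Everything is forced by the commutation relations of finitely many free fields. Creation modes
multiply in an exterior or symmetric algebra and annihilation modes contract. When every mode is
indexed by z^(-n-1), dual bases make φ^i, ψ^i anticommute to δ_ij δ_(m+n,-1) and b^i, c^i commute to
m δ_ij δ_(m+n,0). In this indexing the NS and R sectors obey identical relations, so both are
instances of `FockData` with `FockData.IsPolarized` and are treated by one argument.

Existence is the reconstruction theorem `GeneratingFields.vertexAlgebra`. Iterated normally ordered
products of derivatives of the generating fields stay translation covariant, and they stay mutually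
local by Dong's lemma `IsLocal.normalOrder`. Goddard's argument `GeneratingFields.eq_of_state_eq`
shows that such a field is determined by its state: a covariant field with zero state kills the
vacuum, and locality spreads this to all states. Hence states and fields correspond bijectively in
each charge, and the formula for Y on monomials (`GeneratingFields.stateField_list_prod`) follows by
comparing states. To avoid infinite sums, both halves of a normally ordered product are treated as
(z-w)⁻¹a(z)b(w), characterised as the only solution of (z-w)f = a(z)b(w) bounded in the second index
(`halfProduct_unique`). The tensor product is reconstructed in the same way from the fields a(z) ⊗ 1
and 1 ⊗ b(z); the bosons have degree 0, so no Koszul sign appears.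

The identities rest on Borcherds' formula `VertexAlgebra.mode_commutator`: a commutator of modes
depends only on the products a_(j)b with j ≥ 0. For `VertexAlgebra.FreeFields` these are found by
moving annihilation modes to the vacuum. The generators turn out to be primary of weights λ, 1-λ, 1,
1. By `VertexAlgebra.isConformal_of_primary` this yields L_(-1) = T and diagonalizability of L_0,
while the Virasoro relations need only ν_(j)ν, with the central charge read from ν_(3)ν. The N = 2
relations come from the products of orders 0, 1, 2 of τ⁻ with τ⁺, namely ν - ½Tj, -j and ½ dim T
times the vacuum, and from the primarity of the currents. The symmetry `FreeFields.swap`, which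
exchanges φ with ψ and b with c and λ with 1-λ, supplies half of all computations. -/

/-- The difference of two reindexing operators. For shifts of two of the indices this is
multiplication by `z - w` on formal distributions. -/
def shiftSub (V : Type*) [AddCommGroup V] [Module ℂ V] (e₁ e₂ : X → X) :
    Module.End ℂ (X → V) :=
  LinearMap.funLeft ℂ V e₁ - LinearMap.funLeft ℂ V e₂

@[simp]
theorem shiftSub_apply (e₁ e₂ : X → X) (f : X → V) (x : X) :
    shiftSub V e₁ e₂ f x = f (e₁ x) - f (e₂ x) := rfl

theorem shiftSub_commute {e₁ e₂ e₃ e₄ : X → X} (h₁₃ : ∀ x, e₁ (e₃ x) = e₃ (e₁ x))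
    (h₁₄ : ∀ x, e₁ (e₄ x) = e₄ (e₁ x)) (h₂₃ : ∀ x, e₂ (e₃ x) = e₃ (e₂ x))
    (h₂₄ : ∀ x, e₂ (e₄ x) = e₄ (e₂ x)) :
    Commute (shiftSub V e₁ e₂) (shiftSub V e₃ e₄) := by
  apply LinearMap.ext
  intro f
  funext x
  simp only [Module.End.mul_apply, shiftSub_apply, h₁₃, h₁₄, h₂₃, h₂₄]
  abel

/-- Used to freeze one of three variables or to interchange two of them, so that two-variable
locality applies to three-variable distributions. -/
theorem shiftSub_pow_comp {e₁ e₂ : X → X} {d₁ d₂ : Y → Y} (π : Y → X)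
    (h₁ : ∀ y, e₁ (π y) = π (d₁ y)) (h₂ : ∀ y, e₂ (π y) = π (d₂ y)) (N : ℕ) (f : X → V) (y : Y) :
    (shiftSub V e₁ e₂ ^ N) f (π y) = (shiftSub V d₁ d₂ ^ N) (fun y => f (π y)) y := by
  induction N generalizing f with
  | zero => rfl
  | succ N ih =>
    rw [pow_succ, pow_succ, Module.End.mul_apply, Module.End.mul_apply, ih]
    have : (fun y => shiftSub V e₁ e₂ f (π y)) = shiftSub V d₁ d₂ fun y => f (π y) := by
      funext y
      simp [h₁, h₂]
    rw [this]

/-- The factor z - w only moves indices, so it commutes with any fixed linear map on coefficients,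
such as an operator or evaluation at a vector. -/
theorem shiftSub_pow_map {e₁ e₂ : X → X} (L : V →ₗ[ℂ] W) (N : ℕ) (f : X → V) (x : X) :
    (shiftSub W e₁ e₂ ^ N) (fun x => L (f x)) x = L ((shiftSub V e₁ e₂ ^ N) f x) := by
  induction N generalizing f with
  | zero => rfl
  | succ N ih =>
    rw [pow_succ, pow_succ, Module.End.mul_apply, Module.End.mul_apply, ← ih]
    have : shiftSub W e₁ e₂ (fun x => L (f x)) = fun x => L (shiftSub V e₁ e₂ f x) := by
      funext y
      simp
    rw [this]

theorem pow_apply_eq_zero_of_le {M : Type*} [AddCommGroup M] [Module ℂ M] {p : Module.End ℂ M}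
    {x : M} {m n : ℕ} (h : m ≤ n) (hx : (p ^ m) x = 0) : (p ^ n) x = 0 := by
  rw [← Nat.sub_add_cancel h, pow_add, Module.End.mul_apply, hx, map_zero]

theorem neg_pow_apply {M : Type*} [AddCommGroup M] [Module ℂ M] (p : Module.End ℂ M) (N : ℕ)
    (x : M) : ((-p) ^ N) x = (-1 : ℂ) ^ N • (p ^ N) x := by
  induction N generalizing x with
  | zero => simp
  | succ N ih =>
    rw [pow_succ, pow_succ, pow_succ, Module.End.mul_apply, Module.End.mul_apply, ih,
      LinearMap.neg_apply, map_neg]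
    simp

/-- If `q - p = r` for commuting operators, then a vector killed by `p ^ N` and by `q ^ N * r ^ N`
is killed by a power of `r`. -/
theorem pow_apply_eq_zero_of_commute {M : Type*} [AddCommGroup M] [Module ℂ M]
    {p q r : Module.End ℂ M} (hpq : Commute p q) (hr : r = q - p) {x : M} {N : ℕ}
    (hp : (p ^ N) x = 0) (hq : (q ^ N) ((r ^ N) x) = 0) : (r ^ (3 * N)) x = 0 := by
  have hpr : Commute p r := by rw [hr]; exact hpq.sub_right (Commute.refl p)
  have hp' : (p ^ N) ((r ^ N) x) = 0 := by
    rw [← Module.End.mul_apply, (hpr.pow_pow N N).eq, Module.End.mul_apply, hp, map_zero]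
  -- One factor r^N makes the vector accessible to `hq`; the remaining r^(2N) = (q - p)^(2N) is
  -- expanded, and every term contains q^N or p^N.
  have h3 : 3 * N = 2 * N + N := by ring
  rw [h3, pow_add, Module.End.mul_apply]
  generalize (r ^ N) x = y at hq hp'
  have hc : Commute q (-p) := hpq.symm.neg_right
  rw [hr, sub_eq_add_neg, hc.add_pow, LinearMap.sum_apply]
  refine Finset.sum_eq_zero fun i _ => ?_
  have key : (q ^ i) (((-p) ^ (2 * N - i)) y) = 0 := by
    rcases le_total N i with h | h
    · rw [← Module.End.mul_apply, (hc.pow_pow _ _).eq, Module.End.mul_apply,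
        pow_apply_eq_zero_of_le h hq, map_zero]
    · have h' : N ≤ 2 * N - i := by omega
      have : ((-p) ^ N) y = 0 := by
        rw [neg_pow_apply, hp', smul_zero]
      rw [pow_apply_eq_zero_of_le h' this, map_zero]
  rw [(Nat.cast_commute _ _).symm.eq, Module.End.mul_apply, Module.End.mul_apply, key, map_zero]

/-- Multiplication by `z - w` on formal distributions in two variables. -/
abbrev delta (V : Type*) [AddCommGroup V] [Module ℂ V] : Module.End ℂ (ℤ × ℤ → V) :=
  shiftSub V (fun x => (x.1 + 1, x.2)) (fun x => (x.1, x.2 + 1))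

/-- The binomial theorem for two commuting shifts. It links the operator form of locality with the
explicit sum in the axioms of `VertexAlgebra`. -/
theorem delta_pow_apply (N : ℕ) (f : ℤ × ℤ → V) (m n : ℤ) :
    (delta V ^ N) f (m, n) = ∑ i ∈ Finset.range (N + 1),
      ((-1 : ℂ) ^ i * (N.choose i : ℂ)) • f (m + N - i, n + i) := by
  have hpow1 : ∀ (k : ℕ) (f : ℤ × ℤ → V) (x : ℤ × ℤ),
      ((LinearMap.funLeft ℂ V (fun x : ℤ × ℤ => (x.1 + 1, x.2))) ^ k) f x = f (x.1 + k, x.2) := by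
    intro k
    induction k with
    | zero => intro f x; simp
    | succ k ih =>
      intro f x
      rw [pow_succ, Module.End.mul_apply, ih, LinearMap.funLeft_apply]
      simp [add_assoc]
  have hpow2 : ∀ (k : ℕ) (f : ℤ × ℤ → V) (x : ℤ × ℤ),
      ((-LinearMap.funLeft ℂ V (fun x : ℤ × ℤ => (x.1, x.2 + 1))) ^ k) f x
        = (-1 : ℂ) ^ k • f (x.1, x.2 + k) := by
    intro k
    induction k with
    | zero => intro f x; simp
    | succ k ih =>
      intro f x
      rw [pow_succ, Module.End.mul_apply, ih, LinearMap.neg_apply, Pi.neg_apply,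
        LinearMap.funLeft_apply, pow_succ]
      simp [add_assoc]
  have hc : Commute (-(LinearMap.funLeft ℂ V (fun x : ℤ × ℤ => (x.1, x.2 + 1))))
      (LinearMap.funLeft ℂ V (fun x : ℤ × ℤ => (x.1 + 1, x.2))) := by
    apply LinearMap.ext
    intro f
    funext x
    simp [Module.End.mul_apply, LinearMap.funLeft_apply]
  have hcast : ∀ (k : ℕ) (g : ℤ × ℤ → V), ((k : Module.End ℂ (ℤ × ℤ → V))) g = (k : ℂ) • g := by
    intro k g
    rw [← nsmul_one, LinearMap.smul_apply, Module.End.one_apply, Nat.cast_smul_eq_nsmul]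
  rw [delta, shiftSub, sub_eq_add_neg, add_comm, hc.add_pow, LinearMap.sum_apply,
    Finset.sum_apply]
  refine Finset.sum_congr rfl fun i hi => ?_
  have hi' : i ≤ N := Nat.lt_succ_iff.mp (Finset.mem_range.mp hi)
  rw [Module.End.mul_apply, Module.End.mul_apply, hpow2, hpow1, hcast, Pi.smul_apply, smul_smul]
  congr 2
  push_cast [hi']
  ext <;> simp; ring

/-- A formal distribution in two variables that is bounded in the second index is determined by
its product with `z - w`. -/
theorem eq_zero_of_shift_eq {f : ℤ → ℤ → V} {N : ℤ} (hN : ∀ m n, N ≤ n → f m n = 0)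
    (h : ∀ m n, f (m + 1) n = f m (n + 1)) (m n : ℤ) : f m n = 0 := by
  -- The hypothesis makes f constant along the lines m + n = const; sliding far enough reaches the
  -- region where f vanishes.
  have key : ∀ (k : ℕ) (m n : ℤ), f m n = f (m - k) (n + k) := by
    intro k
    induction k with
    | zero => intro m n; simp
    | succ k ih =>
      intro m n
      rw [ih m n]
      have := h (m - k - 1) (n + k)
      rw [sub_add_cancel] at this
      rw [this]
      congr 1 <;> push_cast <;> ring
  rw [key (N - n).toNat m n]
  apply hN
  have := Int.self_le_toNat (N - n)
  omega

/-- The factor z - w preserves boundedness in the second index, hence it can be cancelled one power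
at a time. -/
theorem eq_zero_of_delta_pow_eq_zero {f : ℤ × ℤ → V} {N : ℤ}
    (hN : ∀ m n, N ≤ n → f (m, n) = 0) {K : ℕ} (h : (delta V ^ K) f = 0) : f = 0 := by
  induction K generalizing f with
  | zero => simpa using h
  | succ K ih =>
    rw [pow_succ, Module.End.mul_apply] at h
    have h1 := ih (f := delta V f) (fun m n hn => by
      rw [shiftSub_apply, hN _ _ hn, hN _ _ (by omega), sub_zero]) h
    funext ⟨m, n⟩
    refine eq_zero_of_shift_eq (f := fun m n => f (m, n)) hN (fun m n => ?_) m n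
    have := congrFun h1 (m, n)
    simpa [sub_eq_zero] using this

/-! ### Locality -/

/-- Mutual locality of two formal distributions with the sign `ε` of their interchange. -/
def IsLocal (ε : ℂ) (a b : ℤ → Module.End ℂ V) : Prop :=
  ∃ N : ℕ, ∀ v : V, (delta V ^ N) (fun x => a x.1 (b x.2 v) - ε • b x.2 (a x.1 v)) = 0

theorem isLocal_iff (ε : ℂ) (a b : ℤ → Module.End ℂ V) : IsLocal ε a b ↔
    ∃ N : ℕ, ∀ (m n : ℤ) (v : V), ∑ i ∈ Finset.range (N + 1), ((-1 : ℂ) ^ i * (N.choose i : ℂ)) •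
      (a (m + N - i) (b (n + i) v) - ε • b (n + i) (a (m + N - i) v)) = 0 := by
  refine exists_congr fun N => ⟨fun h m n v => ?_, fun h v => ?_⟩
  · rw [← delta_pow_apply N (fun x => a x.1 (b x.2 v) - ε • b x.2 (a x.1 v)), h v]; rfl
  · funext ⟨m, n⟩
    rw [delta_pow_apply]
    exact h m n v

/-- Interchanging the variables turns z - w into its negative and the supercommutator into -ε times
the other one; ε² = 1 is what makes these match. -/
theorem IsLocal.symm {ε : ℂ} (hε : ε * ε = 1) {a b : ℤ → Module.End ℂ V} (h : IsLocal ε a b) :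
    IsLocal ε b a := by
  obtain ⟨N, h⟩ := h
  refine ⟨N, fun v => ?_⟩
  have h1 := h v
  funext x
  have h2 := congrFun h1 (x.2, x.1)
  rw [shiftSub_pow_comp (d₁ := fun x => (x.1, x.2 + 1)) (d₂ := fun x => (x.1 + 1, x.2))
    (fun x : ℤ × ℤ => (x.2, x.1)) (fun _ => rfl) (fun _ => rfl)] at h2
  have h3 : shiftSub V (fun x : ℤ × ℤ => (x.1, x.2 + 1)) (fun x => (x.1 + 1, x.2)) = -delta V := by
    simp [delta, shiftSub]
  have h4 : (fun x : ℤ × ℤ => b x.1 (a x.2 v) - ε • a x.2 (b x.1 v))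
      = (-ε) • (fun x : ℤ × ℤ => a x.2 (b x.1 v) - ε • b x.1 (a x.2 v)) := by
    funext x
    simp only [Pi.smul_apply, smul_sub, smul_smul, neg_mul, hε]
    module
  have h6 : (delta V ^ N) (fun x : ℤ × ℤ => a x.2 (b x.1 v) - ε • b x.1 (a x.2 v)) x = 0 := by
    rw [h3] at h2
    rw [neg_pow_apply, Pi.smul_apply] at h2
    exact (smul_eq_zero.mp h2).resolve_left (by simp)
  rw [h4, map_smul, Pi.smul_apply, h6, smul_zero]
  rfl

theorem IsLocal.add {ε : ℂ} {a a' b : ℤ → Module.End ℂ V} (h : IsLocal ε a b)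
    (h' : IsLocal ε a' b) : IsLocal ε (a + a') b := by
  obtain ⟨N, h⟩ := h
  obtain ⟨N', h'⟩ := h'
  refine ⟨N + N', fun v => ?_⟩
  have : (fun x : ℤ × ℤ => (a + a') x.1 (b x.2 v) - ε • b x.2 ((a + a') x.1 v))
      = (fun x => a x.1 (b x.2 v) - ε • b x.2 (a x.1 v))
        + (fun x => a' x.1 (b x.2 v) - ε • b x.2 (a' x.1 v)) := by
    funext x
    simp only [Pi.add_apply, LinearMap.add_apply, map_add, smul_add]
    abel
  rw [this, map_add, pow_apply_eq_zero_of_le (Nat.le_add_right _ _) (h v),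
    pow_apply_eq_zero_of_le (Nat.le_add_left _ _) (h' v), add_zero]

theorem IsLocal.smul {ε : ℂ} {a b : ℤ → Module.End ℂ V} (c : ℂ) (h : IsLocal ε a b) :
    IsLocal ε (c • a) b := by
  obtain ⟨N, h⟩ := h
  refine ⟨N, fun v => ?_⟩
  have : (fun x : ℤ × ℤ => (c • a) x.1 (b x.2 v) - ε • b x.2 ((c • a) x.1 v))
      = c • (fun x => a x.1 (b x.2 v) - ε • b x.2 (a x.1 v)) := by
    funext x
    simp only [Pi.smul_apply, LinearMap.smul_apply, map_smul, smul_sub, smul_comm ε c]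
  rw [this, map_smul, h v, smul_zero]

theorem IsLocal.zero (ε : ℂ) (b : ℤ → Module.End ℂ V) : IsLocal ε 0 b :=
  ⟨0, fun v => by funext x; simp⟩

/-- A distribution that annihilates the vacuum and is local with `c` annihilates all `c_(n)|0⟩`. -/
theorem IsLocal.apply_eq_zero {ε : ℂ} {g c : ℤ → Module.End ℂ V} {vac : V} (h : IsLocal ε g c)
    (hg : ∀ n, g n vac = 0) (hc : ∀ n, 0 ≤ n → c n vac = 0) (m n : ℤ) : g m (c n vac) = 0 := by
  obtain ⟨N, h⟩ := h
  have h1 := h vac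
  -- On the vacuum the term c(w)g(z) drops out, so g(z)c(w)|0⟩ itself is killed by a power of z - w.
  -- It has no terms with n ≥ 0, so the power cancels.
  simp only [hg, map_zero, smul_zero, sub_zero] at h1
  have := eq_zero_of_delta_pow_eq_zero (N := 0) (fun m n hn => by simp [hc n hn]) h1
  exact congrFun this (m, n)

end FormalDistribution

namespace FormalDistribution

variable {V : Type*} [AddCommGroup V] [Module ℂ V]

/-! ### Fields and normally ordered products -/

/-- The space of fields: the distributions `a` with `a_(n) v = 0` for `n ≫ 0`. -/
def fieldSpace (V : Type*) [AddCommGroup V] [Module ℂ V] : Submodule ℂ (ℤ → Module.End ℂ V) where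
  carrier := {a | ∀ v, ∀ᶠ n in Filter.atTop, a n v = 0}
  add_mem' {a b} ha hb v := by
    filter_upwards [ha v, hb v] with n h1 h2
    simp [h1, h2]
  zero_mem' v := by simp
  smul_mem' c a ha v := by
    filter_upwards [ha v] with n h
    simp [h]

theorem exists_bound (a : fieldSpace V) (v : V) : ∃ N : ℤ, ∀ n, N ≤ n → a.1 n v = 0 :=
  Filter.eventually_atTop.mp (a.2 v)

/-- The series `∑ a_(m-1-i) b_(n+i) v`, the expansion of `(z - w)⁻¹ a(z) b(w) v` for
`|z| > |w|`. -/
def halfProduct (a b : ℤ → Module.End ℂ V) (v : V) (m n : ℤ) : V :=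
  ∑ᶠ i : ℕ, a (m - 1 - i) (b (n + i) v)

theorem halfProduct_eq_sum (a : ℤ → Module.End ℂ V) {b : ℤ → Module.End ℂ V} {v : V} {N : ℤ}
    (hN : ∀ n, N ≤ n → b n v = 0) (m n : ℤ) {K : ℕ} (hK : N ≤ n + K) :
    halfProduct a b v m n = ∑ i ∈ Finset.range K, a (m - 1 - i) (b (n + i) v) := by
  refine finsum_eq_sum_of_support_subset _ fun i hi => ?_
  by_contra h
  have h1 : K ≤ i := by simpa using h
  refine hi ?_
  change a (m - 1 - i) (b (n + i) v) = 0
  rw [hN _ (by omega), map_zero]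

theorem halfProduct_eq_zero (a : ℤ → Module.End ℂ V) {b : ℤ → Module.End ℂ V} {v : V} {N : ℤ}
    (hN : ∀ n, N ≤ n → b n v = 0) (m n : ℤ) (hn : N ≤ n) : halfProduct a b v m n = 0 := by
  rw [halfProduct_eq_sum a hN m n (K := 0) (by simpa using hn), Finset.sum_range_zero]

/-- The two sums telescope: after reindexing only the term i = 0 is left. -/
theorem halfProduct_shift (a : ℤ → Module.End ℂ V) (b : fieldSpace V) (v : V) (m n : ℤ) :
    halfProduct a b.1 v (m + 1) n - halfProduct a b.1 v m (n + 1) = a m (b.1 n v) := by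
  obtain ⟨N, hN⟩ := exists_bound b v
  have hK := Int.self_le_toNat (N - n)
  rw [halfProduct_eq_sum a hN (m + 1) n (K := (N - n).toNat + 1) (by push_cast; omega),
    halfProduct_eq_sum a hN m (n + 1) (K := (N - n).toNat) (by omega), Finset.sum_range_succ']
  have : ∀ i : ℕ, a (m + 1 - 1 - ((i + 1 : ℕ) : ℤ)) (b.1 (n + ((i + 1 : ℕ) : ℤ)) v)
      = a (m - 1 - i) (b.1 (n + 1 + i) v) := by
    intro i
    have e1 : m + 1 - 1 - ((i + 1 : ℕ) : ℤ) = m - 1 - i := by push_cast; ring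
    have e2 : n + ((i + 1 : ℕ) : ℤ) = n + 1 + i := by push_cast; ring
    rw [e1, e2]
  rw [Finset.sum_congr rfl fun i _ => this i]
  simp

/-- The half product is the only solution of `(z - w) f = a(z) b(w) v` that is bounded in the
second index. -/
theorem halfProduct_unique {a : ℤ → Module.End ℂ V} {b : fieldSpace V} {v : V} {f : ℤ → ℤ → V}
    (hb : ∃ N : ℤ, ∀ m n, N ≤ n → f m n = 0)
    (hf : ∀ m n, f (m + 1) n - f m (n + 1) = a m (b.1 n v)) (m n : ℤ) :
    halfProduct a b.1 v m n = f m n := by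
  obtain ⟨N, hN⟩ := exists_bound b v
  obtain ⟨N', hN'⟩ := hb
  refine sub_eq_zero.mp (eq_zero_of_shift_eq
    (f := fun m n => halfProduct a b.1 v m n - f m n) (N := max N N') (fun m n hn => ?_)
    (fun m n => ?_) m n)
  · rw [halfProduct_eq_zero a hN _ _ (le_trans (le_max_left _ _) hn),
      hN' _ _ (le_trans (le_max_right _ _) hn), sub_zero]
  · have h1 := halfProduct_shift a b v m n
    have h2 := hf m n
    rw [← sub_eq_zero, ← sub_eq_zero.mpr (h1.trans h2.symm)]
    abel

theorem halfProduct_bounded (a : ℤ → Module.End ℂ V) (b : fieldSpace V) (v : V) :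
    ∃ N : ℤ, ∀ m n, N ≤ n → halfProduct a b.1 v m n = 0 := by
  obtain ⟨N, hN⟩ := exists_bound b v
  exact ⟨N, fun m n hn => halfProduct_eq_zero a hN m n hn⟩

/-- Bilinearity is deduced from uniqueness instead of by splitting infinite sums: the right side is
bounded and solves the same difference equation. -/
theorem halfProduct_add (a : ℤ → Module.End ℂ V) (b : fieldSpace V) (v w : V) (m n : ℤ) :
    halfProduct a b.1 (v + w) m n = halfProduct a b.1 v m n + halfProduct a b.1 w m n := by
  refine halfProduct_unique (f := fun m n => halfProduct a b.1 v m n + halfProduct a b.1 w m n)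
    ?_ (fun m n => ?_) m n
  · obtain ⟨N, hN⟩ := halfProduct_bounded a b v
    obtain ⟨N', hN'⟩ := halfProduct_bounded a b w
    exact ⟨max N N', fun m n hn => by
      rw [hN _ _ (le_trans (le_max_left _ _) hn), hN' _ _ (le_trans (le_max_right _ _) hn),
        add_zero]⟩
  · rw [map_add, map_add, ← halfProduct_shift, ← halfProduct_shift]
    abel

theorem halfProduct_smul (a : ℤ → Module.End ℂ V) (b : fieldSpace V) (c : ℂ) (v : V) (m n : ℤ) :
    halfProduct a b.1 (c • v) m n = c • halfProduct a b.1 v m n := by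
  refine halfProduct_unique (f := fun m n => c • halfProduct a b.1 v m n) ?_ (fun m n => ?_) m n
  · obtain ⟨N, hN⟩ := halfProduct_bounded a b v
    exact ⟨N, fun m n hn => by rw [hN _ _ hn, smul_zero]⟩
  · rw [map_smul, map_smul, ← halfProduct_shift, smul_sub]

theorem halfProduct_add_left (a a' : ℤ → Module.End ℂ V) (b : fieldSpace V) (v : V) (m n : ℤ) :
    halfProduct (a + a') b.1 v m n = halfProduct a b.1 v m n + halfProduct a' b.1 v m n := by
  refine halfProduct_unique (f := fun m n => halfProduct a b.1 v m n + halfProduct a' b.1 v m n)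
    ?_ (fun m n => ?_) m n
  · obtain ⟨N, hN⟩ := halfProduct_bounded a b v
    obtain ⟨N', hN'⟩ := halfProduct_bounded a' b v
    exact ⟨max N N', fun m n hn => by
      rw [hN _ _ (le_trans (le_max_left _ _) hn), hN' _ _ (le_trans (le_max_right _ _) hn),
        add_zero]⟩
  · rw [Pi.add_apply, LinearMap.add_apply, ← halfProduct_shift, ← halfProduct_shift]
    abel

theorem halfProduct_add_right (a : ℤ → Module.End ℂ V) (b b' : fieldSpace V) (v : V) (m n : ℤ) :
    halfProduct a (b + b').1 v m n = halfProduct a b.1 v m n + halfProduct a b'.1 v m n := by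
  refine halfProduct_unique (f := fun m n => halfProduct a b.1 v m n + halfProduct a b'.1 v m n)
    ?_ (fun m n => ?_) m n
  · obtain ⟨N, hN⟩ := halfProduct_bounded a b v
    obtain ⟨N', hN'⟩ := halfProduct_bounded a b' v
    exact ⟨max N N', fun m n hn => by
      rw [hN _ _ (le_trans (le_max_left _ _) hn), hN' _ _ (le_trans (le_max_right _ _) hn),
        add_zero]⟩
  · rw [Submodule.coe_add, Pi.add_apply, LinearMap.add_apply, map_add, ← halfProduct_shift,
      ← halfProduct_shift]
    abel

/-- The normally ordered product of fields as a field. -/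
def normalOrder (ε : ℂ) (a b : fieldSpace V) : fieldSpace V :=
  ⟨fun n =>
    { toFun := fun v => halfProduct a.1 b.1 v 0 n + ε • halfProduct b.1 a.1 v n 0
      map_add' := fun v w => by
        rw [halfProduct_add, halfProduct_add, smul_add]
        abel
      map_smul' := fun c v => by
        rw [halfProduct_smul, halfProduct_smul, RingHom.id_apply, smul_add, smul_comm ε c] },
    fun v => by
      obtain ⟨N, hN⟩ := exists_bound a v
      obtain ⟨N', hN'⟩ := exists_bound b v
      -- Only finitely many a_(i)v are nonzero, and each of them is killed by b_(n-1-i) for large n.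
      have h1 : ∀ᶠ n : ℤ in Filter.atTop,
          ∀ i ∈ Finset.range N.toNat, b.1 (n - 1 - i) (a.1 (0 + i) v) = 0 := by
        rw [Filter.eventually_all_finset]
        intro i _
        obtain ⟨M, hM⟩ := exists_bound b (a.1 (0 + i) v)
        filter_upwards [Filter.eventually_ge_atTop (M + 1 + i)] with n hn
        exact hM _ (by omega)
      filter_upwards [h1, Filter.eventually_ge_atTop N'] with n h2 h3
      have h4 := Int.self_le_toNat N
      simp only [LinearMap.coe_mk, AddHom.coe_mk]
      rw [halfProduct_eq_zero a.1 hN' 0 n h3,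
        halfProduct_eq_sum b.1 hN n 0 (K := N.toNat) (by omega), Finset.sum_eq_zero h2,
        smul_zero, add_zero]⟩

theorem normalOrder_apply (ε : ℂ) (a b : fieldSpace V) (n : ℤ) (v : V) :
    (normalOrder ε a b).1 n v = halfProduct a.1 b.1 v 0 n + ε • halfProduct b.1 a.1 v n 0 := rfl

theorem normalOrder_apply_eq_normalProduct (ε : ℂ) (a b : fieldSpace V) (n : ℤ) (v : V) :
    (normalOrder ε a b).1 n v
      = normalProduct ε (fun n v => a.1 n v) (fun n v => b.1 n v) n v := by
  rw [normalOrder_apply, normalProduct, halfProduct, halfProduct]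
  congr 1
  · refine finsum_congr fun i => ?_
    have e : (0 : ℤ) - 1 - i = -i - 1 := by ring
    rw [e]
  · congr 1
    refine finsum_congr fun i => ?_
    have e : n - 1 - (i : ℤ) = n - i - 1 := by ring
    rw [e, zero_add]

theorem normalOrder_add_left (ε : ℂ) (a a' b : fieldSpace V) :
    normalOrder ε (a + a') b = normalOrder ε a b + normalOrder ε a' b := by
  ext n v
  simp only [normalOrder_apply, Submodule.coe_add, Pi.add_apply, LinearMap.add_apply]
  rw [halfProduct_add_left, ← Submodule.coe_add, halfProduct_add_right, smul_add]
  abel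

theorem normalOrder_add_right (ε : ℂ) (a b b' : fieldSpace V) :
    normalOrder ε a (b + b') = normalOrder ε a b + normalOrder ε a b' := by
  ext n v
  simp only [normalOrder_apply, Submodule.coe_add, Pi.add_apply, LinearMap.add_apply]
  rw [halfProduct_add_left, ← Submodule.coe_add, halfProduct_add_right, smul_add]
  abel

/-- The derivative of a field. -/
def fieldDeriv (V : Type*) [AddCommGroup V] [Module ℂ V] : fieldSpace V →ₗ[ℂ] fieldSpace V where
  toFun a := ⟨fun n => (-(n : ℂ)) • a.1 (n - 1), fun v => by
    obtain ⟨N, hN⟩ := exists_bound a v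
    filter_upwards [Filter.eventually_ge_atTop (N + 1)] with n hn
    rw [LinearMap.smul_apply, hN _ (by omega), smul_zero]⟩
  map_add' a b := by ext n v; simp
  map_smul' c a := by ext n v; simp; ring_nf; simp [smul_comm c]

theorem fieldDeriv_apply (a : fieldSpace V) (n : ℤ) :
    (fieldDeriv V a).1 n = (-(n : ℂ)) • a.1 (n - 1) := rfl

/-- The divided derivatives of a field. -/
def fieldDividedDeriv (k : ℕ) (a : fieldSpace V) : fieldSpace V :=
  (k.factorial : ℂ)⁻¹ • ((fieldDeriv V)^[k] a)

theorem fieldDividedDeriv_apply (k : ℕ) (a : fieldSpace V) (n : ℤ) (v : V) :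
    (fieldDividedDeriv k a).1 n v = distDividedDeriv k (fun n v => a.1 n v) n v := by
  have : ∀ a : fieldSpace V, (fun n v => ((fieldDeriv V)^[k] a).1 n v)
      = distDeriv^[k] (fun n v => a.1 n v) := by
    induction k with
    | zero => intro a; rfl
    | succ k ih =>
      intro a
      rw [Function.iterate_succ_apply, Function.iterate_succ_apply, ih]
      rfl
  rw [distDividedDeriv, ← this]
  rfl

/-- The factor k! produced by differentiating cancels the one in the divided derivative. Thus ∂^(k)a
creates a_(-1-k)|0⟩ from the vacuum, with no scalar. -/
theorem fieldDividedDeriv_neg_one (k : ℕ) (a : fieldSpace V) :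
    (fieldDividedDeriv k a).1 (-1) = a.1 (-1 - k) := by
  have : ∀ a : fieldSpace V, ((fieldDeriv V)^[k] a).1 (-1) = (k.factorial : ℂ) • a.1 (-1 - k) := by
    induction k with
    | zero => intro a; simp
    | succ k ih =>
      intro a
      have e : -1 - (k : ℤ) - 1 = -1 - ((k + 1 : ℕ) : ℤ) := by push_cast; ring
      rw [Function.iterate_succ_apply, ih, fieldDeriv_apply, smul_smul, Nat.factorial_succ, e]
      congr 1
      push_cast
      ring
  have hk : (k.factorial : ℂ) ≠ 0 := by exact_mod_cast k.factorial_ne_zero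
  rw [fieldDividedDeriv, Submodule.coe_smul, Pi.smul_apply, this, smul_smul, inv_mul_cancel₀ hk,
    one_smul]

theorem fieldDividedDeriv_add (k : ℕ) (a b : fieldSpace V) :
    fieldDividedDeriv k (a + b) = fieldDividedDeriv k a + fieldDividedDeriv k b := by
  rw [fieldDividedDeriv, iterate_map_add, smul_add]
  rfl

/-! ### Translation covariant fields of a given charge -/

/-- `a` is a translation covariant field of charge `p` that annihilates the vacuum in nonnegative
modes. -/
structure IsCovariant (T Q : Module.End ℂ V) (vac : V) (p : ℤ) (a : ℤ → Module.End ℂ V) :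
    Prop where
  translation : ∀ n v, T (a n v) - a n (T v) = (-(n : ℂ)) • a (n - 1) v
  charge : ∀ n v, Q (a n v) - a n (Q v) = (p : ℂ) • a n v
  vacuum : ∀ n, 0 ≤ n → a n vac = 0

section Covariant

variable {T Q : Module.End ℂ V} {vac : V} {p q : ℤ}

theorem IsCovariant.zero : IsCovariant T Q vac p 0 :=
  ⟨fun n v => by simp, fun n v => by simp, fun n _ => by simp⟩

theorem IsCovariant.add {a b : ℤ → Module.End ℂ V} (ha : IsCovariant T Q vac p a)
    (hb : IsCovariant T Q vac p b) : IsCovariant T Q vac p (a + b) where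
  translation n v := by
    have h1 := ha.translation n v
    have h2 := hb.translation n v
    simp only [Pi.add_apply, LinearMap.add_apply, map_add, smul_add, ← h1, ← h2]
    abel
  charge n v := by
    have h1 := ha.charge n v
    have h2 := hb.charge n v
    simp only [Pi.add_apply, LinearMap.add_apply, map_add, smul_add, ← h1, ← h2]
    abel
  vacuum n hn := by simp [ha.vacuum n hn, hb.vacuum n hn]

theorem IsCovariant.smul {a : ℤ → Module.End ℂ V} (c : ℂ) (ha : IsCovariant T Q vac p a) :
    IsCovariant T Q vac p (c • a) where
  translation n v := by
    simp only [Pi.smul_apply, LinearMap.smul_apply, map_smul, ← smul_sub, ha.translation n v]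
    rw [smul_comm]
  charge n v := by
    simp only [Pi.smul_apply, LinearMap.smul_apply, map_smul, ← smul_sub, ha.charge n v]
    rw [smul_comm]
  vacuum n hn := by simp [ha.vacuum n hn]

theorem IsCovariant.fieldDeriv {a : fieldSpace V} (ha : IsCovariant T Q vac p a.1) :
    IsCovariant T Q vac p (fieldDeriv V a).1 where
  translation n v := by
    simp only [fieldDeriv_apply, LinearMap.smul_apply, map_smul, ← smul_sub,
      ha.translation (n - 1) v]
  charge n v := by
    simp only [fieldDeriv_apply, LinearMap.smul_apply, map_smul, ← smul_sub, ha.charge (n - 1) v]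
    rw [smul_comm]
  vacuum n hn := by
    rcases hn.eq_or_lt with rfl | h
    · simp [fieldDeriv_apply]
    · rw [fieldDeriv_apply, LinearMap.smul_apply, ha.vacuum _ (by omega), smul_zero]

theorem IsCovariant.fieldDividedDeriv (k : ℕ) {a : fieldSpace V}
    (ha : IsCovariant T Q vac p a.1) : IsCovariant T Q vac p (fieldDividedDeriv k a).1 := by
  refine IsCovariant.smul _ ?_
  induction k generalizing a with
  | zero => exact ha
  | succ k ih => exact ih ha.fieldDeriv

/-- T acts on a(z)b(w) as ∂_z + ∂_w by the Leibniz rule, and ∂_z + ∂_w annihilates z - w. Both sides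
therefore solve the same difference equation, and uniqueness applies. -/
theorem IsCovariant.halfProduct_translation {a : ℤ → Module.End ℂ V} {b : fieldSpace V}
    (ha : IsCovariant T Q vac p a) (hb : IsCovariant T Q vac q b.1) (v : V) (m n : ℤ) :
    T (halfProduct a b.1 v m n) - halfProduct a b.1 (T v) m n
      = -((m : ℂ) • halfProduct a b.1 v (m - 1) n + (n : ℂ) • halfProduct a b.1 v m (n - 1)) := by
  have key := halfProduct_unique (a := a) (b := b) (v := T v)
    (f := fun m n => T (halfProduct a b.1 v m n)
      + ((m : ℂ) • halfProduct a b.1 v (m - 1) n + (n : ℂ) • halfProduct a b.1 v m (n - 1)))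
    ?_ (fun m n => ?_) m n
  · rw [key]; abel
  · obtain ⟨N, hN⟩ := halfProduct_bounded a b v
    exact ⟨N + 1, fun m n hn => by
      rw [hN _ _ (by omega), hN _ _ (by omega), hN _ _ (by omega)]; simp⟩
  · have h1 := halfProduct_shift a b v m n
    have h2 := halfProduct_shift a b v (m - 1) n
    have h3 := halfProduct_shift a b v m (n - 1)
    rw [sub_add_cancel] at h2 h3
    have h4 := ha.translation m (b.1 n v)
    have h5 := congrArg (a m) (hb.translation n v)
    rw [map_sub, map_smul] at h5
    have h6 := congrArg T h1
    rw [map_sub] at h6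
    rw [← h2, sub_eq_iff_eq_add] at h4
    rw [← h3] at h5
    rw [sub_eq_iff_eq_add] at h5
    rw [h4, h5] at h6
    simp only [add_sub_cancel_right]
    rw [sub_eq_iff_eq_add] at h6
    rw [h6]
    push_cast
    module

theorem IsCovariant.halfProduct_charge {a : ℤ → Module.End ℂ V} {b : fieldSpace V}
    (ha : IsCovariant T Q vac p a) (hb : IsCovariant T Q vac q b.1) (v : V) (m n : ℤ) :
    Q (halfProduct a b.1 v m n) - halfProduct a b.1 (Q v) m n
      = ((p + q : ℤ) : ℂ) • halfProduct a b.1 v m n := by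
  have key := halfProduct_unique (a := a) (b := b) (v := Q v)
    (f := fun m n => Q (halfProduct a b.1 v m n) - ((p + q : ℤ) : ℂ) • halfProduct a b.1 v m n)
    ?_ (fun m n => ?_) m n
  · rw [key]; abel
  · obtain ⟨N, hN⟩ := halfProduct_bounded a b v
    exact ⟨N, fun m n hn => by rw [hN _ _ hn]; simp⟩
  · have h1 := halfProduct_shift a b v m n
    have h4 := ha.charge m (b.1 n v)
    have h5 := congrArg (a m) (hb.charge n v)
    rw [map_sub, map_smul] at h5
    have h6 := congrArg Q h1
    rw [map_sub] at h6
    rw [sub_eq_iff_eq_add] at h4 h5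
    rw [h4, h5, ← h1, sub_eq_iff_eq_add] at h6
    rw [h6]
    push_cast
    module

theorem IsCovariant.normalOrder {a b : fieldSpace V} (ε : ℂ) (ha : IsCovariant T Q vac p a.1)
    (hb : IsCovariant T Q vac q b.1) : IsCovariant T Q vac (p + q) (normalOrder ε a b).1 where
  translation n v := by
    have h1 := ha.halfProduct_translation hb v 0 n
    have h2 := hb.halfProduct_translation ha v n 0
    simp only [normalOrder_apply, map_add, map_smul]
    rw [sub_eq_iff_eq_add] at h1 h2
    rw [h1, h2]
    push_cast
    module
  charge n v := by
    have h1 := ha.halfProduct_charge hb v 0 n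
    have h2 := hb.halfProduct_charge ha v n 0
    simp only [normalOrder_apply, map_add, map_smul]
    rw [sub_eq_iff_eq_add] at h1 h2
    rw [h1, h2]
    push_cast
    module
  vacuum n hn := by
    rw [normalOrder_apply, halfProduct_eq_zero a.1 hb.vacuum 0 n hn,
      halfProduct_eq_zero b.1 ha.vacuum n 0 le_rfl, smul_zero, add_zero]

/-- The half with a to the right annihilates the vacuum, and of the other half a single term
remains. -/
theorem normalOrder_vacuum (ε : ℂ) {a b : fieldSpace V} (ha : IsCovariant T Q vac p a.1)
    (hb : IsCovariant T Q vac q b.1) :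
    (normalOrder ε a b).1 (-1) vac = a.1 (-1) (b.1 (-1) vac) := by
  have h := halfProduct_shift a.1 b vac (-1) (-1)
  norm_num at h
  rw [halfProduct_eq_zero a.1 hb.vacuum (-1) 0 le_rfl, sub_zero] at h
  rw [normalOrder_apply, h, halfProduct_eq_zero b.1 ha.vacuum (-1) 0 le_rfl, smul_zero, add_zero]

/-- A translation covariant field is determined on the vacuum by its `(-1)`-mode. -/
theorem IsCovariant.apply_vacuum {a : ℤ → Module.End ℂ V} (ha : IsCovariant T Q vac p a)
    (hT : T vac = 0) (h : a (-1) vac = 0) (n : ℤ) : a n vac = 0 := by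
  rcases le_or_gt 0 n with hn | hn
  · exact ha.vacuum n hn
  · obtain ⟨k, rfl⟩ : ∃ k : ℕ, n = -1 - k := ⟨(-1 - n).toNat, by omega⟩
    clear hn
    induction k with
    | zero => simpa using h
    | succ k ih =>
      -- Covariance reads (k+1) a_(-2-k)|0⟩ = T a_(-1-k)|0⟩, because T kills the vacuum; the factor
      -- k + 1 is invertible.
      have := ha.translation (-1 - k) vac
      rw [ih, hT, map_zero, map_zero, sub_zero, eq_comm, smul_eq_zero] at this
      have h2 : (-1 - (k : ℤ) - 1) = -1 - ((k + 1 : ℕ) : ℤ) := by push_cast; ring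
      rw [h2] at this
      refine this.resolve_left ?_
      push_cast
      have : ((k : ℂ) + 1) ≠ 0 := Nat.cast_add_one_ne_zero k
      intro h3
      exact this (by linear_combination h3)

end Covariant

/-! ### Dong's lemma -/

/-- Differentiation costs one more power of z - w: multiplying ∂_z f by z - w gives ∂_z((z-w)f) - f,
and induction on the exponent finishes. -/
theorem IsLocal.fieldDeriv {ε : ℂ} {a : fieldSpace V} {b : ℤ → Module.End ℂ V}
    (h : IsLocal ε a.1 b) : IsLocal ε (fieldDeriv V a).1 b := by
  obtain ⟨N, h⟩ := h
  have key : ∀ (N : ℕ) (f : ℤ × ℤ → V), (delta V ^ N) f = 0 →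
      (delta V ^ (N + 1)) (fun x => (-(x.1 : ℂ)) • f (x.1 - 1, x.2)) = 0 := by
    intro N
    induction N with
    | zero =>
      intro f hf
      have hf' : f = 0 := hf
      subst hf'
      have : (fun x : ℤ × ℤ => (-(x.1 : ℂ)) • (0 : ℤ × ℤ → V) (x.1 - 1, x.2)) = 0 := by
        funext x; simp
      rw [this, map_zero]
    | succ N ih =>
      intro f hf
      have h1 : delta V (fun x : ℤ × ℤ => (-(x.1 : ℂ)) • f (x.1 - 1, x.2))
          = (fun x : ℤ × ℤ => (-(x.1 : ℂ)) • delta V f (x.1 - 1, x.2)) - f := by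
        funext x
        simp only [shiftSub_apply, Pi.sub_apply, add_sub_cancel_right, sub_add_cancel]
        push_cast
        module
      rw [pow_succ, Module.End.mul_apply] at hf ⊢
      rw [h1, map_sub, ih _ hf, pow_succ, Module.End.mul_apply, hf, sub_zero]
  refine ⟨N + 1, fun v => ?_⟩
  have := key N _ (h v)
  convert this using 3 with x
  simp only [fieldDeriv_apply, LinearMap.smul_apply, map_smul, smul_sub]
  rw [smul_comm]

theorem IsLocal.fieldDividedDeriv {ε : ℂ} (k : ℕ) {a : fieldSpace V} {b : ℤ → Module.End ℂ V}
    (h : IsLocal ε a.1 b) : IsLocal ε (fieldDividedDeriv k a).1 b := by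
  refine IsLocal.smul _ ?_
  induction k generalizing a with
  | zero => exact h
  | succ k ih => exact ih h.fieldDeriv

/-- Multiplication by `z₁ - z₂` on formal distributions in three variables. -/
abbrev delta12 (V : Type*) [AddCommGroup V] [Module ℂ V] : Module.End ℂ (ℤ × ℤ × ℤ → V) :=
  shiftSub V (fun x => (x.1 + 1, x.2.1, x.2.2)) (fun x => (x.1, x.2.1 + 1, x.2.2))

/-- Multiplication by `z₁ - z₃` on formal distributions in three variables. -/
abbrev delta13 (V : Type*) [AddCommGroup V] [Module ℂ V] : Module.End ℂ (ℤ × ℤ × ℤ → V) :=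
  shiftSub V (fun x => (x.1 + 1, x.2.1, x.2.2)) (fun x => (x.1, x.2.1, x.2.2 + 1))

/-- Multiplication by `z₂ - z₃` on formal distributions in three variables. -/
abbrev delta23 (V : Type*) [AddCommGroup V] [Module ℂ V] : Module.End ℂ (ℤ × ℤ × ℤ → V) :=
  shiftSub V (fun x => (x.1, x.2.1 + 1, x.2.2)) (fun x => (x.1, x.2.1, x.2.2 + 1))

theorem commute_delta12_delta13 : Commute (delta12 V) (delta13 V) :=
  shiftSub_commute (fun _ => rfl) (fun _ => rfl) (fun _ => rfl) (fun _ => rfl)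

theorem commute_delta12_delta23 : Commute (delta12 V) (delta23 V) :=
  shiftSub_commute (fun _ => rfl) (fun _ => rfl) (fun _ => rfl) (fun _ => rfl)

theorem commute_delta13_delta23 : Commute (delta13 V) (delta23 V) :=
  shiftSub_commute (fun _ => rfl) (fun _ => rfl) (fun _ => rfl) (fun _ => rfl)

theorem delta23_eq_sub : delta23 V = delta13 V - delta12 V := by
  apply LinearMap.ext
  intro f
  funext x
  simp

/-- Here the middle variable is a spectator carried by an arbitrary family of vectors; in
`IsLocal.delta23_pow` the first variable is one, carried by operators on the left. -/
theorem IsLocal.delta13_pow {ε : ℂ} {a b : ℤ → Module.End ℂ V} (h : IsLocal ε a b) :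
    ∃ N : ℕ, ∀ u : ℤ → V, (delta13 V ^ N) (fun x => a x.1 (b x.2.2 (u x.2.1))
      - ε • b x.2.2 (a x.1 (u x.2.1))) = 0 := by
  obtain ⟨N, h⟩ := h
  refine ⟨N, fun u => ?_⟩
  funext ⟨m, n, l⟩
  rw [shiftSub_pow_comp (d₁ := fun x => (x.1 + 1, x.2)) (d₂ := fun x => (x.1, x.2 + 1))
    (fun x : ℤ × ℤ => (x.1, n, x.2)) (fun _ => rfl) (fun _ => rfl) N _ (m, l)]
  exact congrFun (h (u n)) (m, l)

theorem IsLocal.delta23_pow {ε : ℂ} {a b : ℤ → Module.End ℂ V} (h : IsLocal ε a b) :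
    ∃ N : ℕ, ∀ (v : V) (L : ℤ → Module.End ℂ V), (delta23 V ^ N) (fun x => L x.1
      (a x.2.1 (b x.2.2 v) - ε • b x.2.2 (a x.2.1 v))) = 0 := by
  obtain ⟨N, h⟩ := h
  refine ⟨N, fun v L => ?_⟩
  funext ⟨m, n, l⟩
  rw [shiftSub_pow_comp (d₁ := fun x => (x.1 + 1, x.2)) (d₂ := fun x => (x.1, x.2 + 1))
    (fun x : ℤ × ℤ => (m, x.1, x.2)) (fun _ => rfl) (fun _ => rfl) N _ (n, l)]
  rw [shiftSub_pow_map (L m) N (fun x : ℤ × ℤ => a x.1 (b x.2 v) - ε • b x.2 (a x.1 v)), h]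
  exact map_zero _

/-- Commuting `c` through a product of two fields that are local with it. -/
theorem exists_delta_triple {ε₁ ε₂ : ℂ} {a b c : ℤ → Module.End ℂ V} (hac : IsLocal ε₁ a c)
    (hbc : IsLocal ε₂ b c) : ∃ N₀ : ℕ, ∀ N, N₀ ≤ N → ∀ v : V,
      (delta13 V ^ N) ((delta23 V ^ N) (fun x => a x.1 (b x.2.1 (c x.2.2 v))
        - (ε₁ * ε₂) • c x.2.2 (a x.1 (b x.2.1 v)))) = 0 := by
  obtain ⟨N₁, h₁⟩ := hac.delta13_pow
  obtain ⟨N₂, h₂⟩ := hbc.delta23_pow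
  refine ⟨max N₁ N₂, fun N hN v => ?_⟩
  have h1 := pow_apply_eq_zero_of_le (le_trans (le_max_left _ _) hN) (h₁ fun n => b n v)
  have h2 := pow_apply_eq_zero_of_le (le_trans (le_max_right _ _) hN) (h₂ v a)
  have : (fun x : ℤ × ℤ × ℤ => a x.1 (b x.2.1 (c x.2.2 v))
        - (ε₁ * ε₂) • c x.2.2 (a x.1 (b x.2.1 v)))
      = (fun x : ℤ × ℤ × ℤ => a x.1 (b x.2.1 (c x.2.2 v) - ε₂ • c x.2.2 (b x.2.1 v)))
        + ε₂ • (fun x : ℤ × ℤ × ℤ => a x.1 (c x.2.2 (b x.2.1 v))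
          - ε₁ • c x.2.2 (a x.1 (b x.2.1 v))) := by
    funext x
    simp only [Pi.add_apply, Pi.smul_apply, map_sub, map_smul]
    module
  rw [this, map_add, map_smul, h2, zero_add, map_smul, ← Module.End.mul_apply,
    (commute_delta13_delta23.pow_pow N N).eq, Module.End.mul_apply, h1, map_zero, smul_zero]

/-- The function in `exists_delta_triple` with `a(z₁) b(z₂)` replaced by
`(z₁ - z₂)⁻¹ a(z₁) b(z₂)`. -/
theorem exists_delta_halfProduct {ε₁ ε₂ : ℂ} {a c : ℤ → Module.End ℂ V} {b : fieldSpace V}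
    (hac : IsLocal ε₁ a c) (hbc : IsLocal ε₂ b.1 c) : ∃ N₀ : ℕ, ∀ N, N₀ ≤ N → ∀ v : V,
      (delta13 V ^ N) ((delta23 V ^ N) (fun x => halfProduct a b.1 (c x.2.2 v) x.1 x.2.1
        - (ε₁ * ε₂) • c x.2.2 (halfProduct a b.1 v x.1 x.2.1))) = 0 := by
  obtain ⟨N₀, h₀⟩ := exists_delta_triple hac hbc
  refine ⟨N₀, fun N hN v => ?_⟩
  have h1 := h₀ N hN v
  set f : ℤ × ℤ × ℤ → V := fun x => halfProduct a b.1 (c x.2.2 v) x.1 x.2.1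
        - (ε₁ * ε₂) • c x.2.2 (halfProduct a b.1 v x.1 x.2.1) with hf
  have h2 : delta12 V f = fun x => a x.1 (b.1 x.2.1 (c x.2.2 v))
        - (ε₁ * ε₂) • c x.2.2 (a x.1 (b.1 x.2.1 v)) := by
    funext x
    simp only [hf, shiftSub_apply]
    rw [← halfProduct_shift a b (c x.2.2 v), ← halfProduct_shift a b v, map_sub, smul_sub]
    abel
  -- Multiplying by z₁ - z₂ reduces to `exists_delta_triple`. It remains to cancel this factor,
  -- which is allowed for distributions bounded in the second index.
  have h3 : Commute (delta12 V) (delta13 V ^ N * delta23 V ^ N) :=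
    (commute_delta12_delta13.pow_right N).mul_right (commute_delta12_delta23.pow_right N)
  rw [← h2, ← Module.End.mul_apply, ← Module.End.mul_apply, ← h3.eq,
    Module.End.mul_apply, Module.End.mul_apply] at h1
  have hbd : ∀ l : ℤ, ∃ B : ℤ, ∀ m n, B ≤ n → f (m, n, l) = 0 := by
    intro l
    obtain ⟨B, hB⟩ := halfProduct_bounded a b (c l v)
    obtain ⟨B', hB'⟩ := halfProduct_bounded a b v
    exact ⟨max B B', fun m n hn => by
      simp only [hf]
      rw [hB _ _ (le_trans (le_max_left _ _) hn), hB' _ _ (le_trans (le_max_right _ _) hn)]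
      simp⟩
  -- Boundedness survives the factors z₁ - z₃ and z₂ - z₃: the second index never decreases, and the
  -- third moves by at most one, so the maximum of the bounds at l and l + 1 works.
  have hstep : ∀ (e₁ e₂ : ℤ × ℤ × ℤ → ℤ × ℤ × ℤ),
      (∀ x, x.2.1 ≤ (e₁ x).2.1 ∧ ((e₁ x).2.2 = x.2.2 ∨ (e₁ x).2.2 = x.2.2 + 1)) →
      (∀ x, x.2.1 ≤ (e₂ x).2.1 ∧ ((e₂ x).2.2 = x.2.2 ∨ (e₂ x).2.2 = x.2.2 + 1)) →
      ∀ (K : ℕ) (f : ℤ × ℤ × ℤ → V), (∀ l : ℤ, ∃ B : ℤ, ∀ m n, B ≤ n → f (m, n, l) = 0) →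
      ∀ l : ℤ, ∃ B : ℤ, ∀ m n, B ≤ n → (shiftSub V e₁ e₂ ^ K) f (m, n, l) = 0 := by
    intro e₁ e₂ he₁ he₂ K
    induction K with
    | zero => intro f hf; exact hf
    | succ K ih =>
      intro f hf
      rw [pow_succ]
      refine ih _ fun l => ?_
      obtain ⟨B, hB⟩ := hf l
      obtain ⟨B', hB'⟩ := hf (l + 1)
      have hz : ∀ x : ℤ × ℤ × ℤ, max B B' ≤ x.2.1 → (x.2.2 = l ∨ x.2.2 = l + 1) → f x = 0 := by
        rintro ⟨m, n, l'⟩ hn (h | h)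
        · simp only at h hn; subst h; exact hB _ _ (le_trans (le_max_left _ _) hn)
        · simp only at h hn; subst h; exact hB' _ _ (le_trans (le_max_right _ _) hn)
      refine ⟨max B B', fun m n hn => ?_⟩
      rw [shiftSub_apply, hz _ (hn.trans (he₁ (m, n, l)).1) (he₁ (m, n, l)).2,
        hz _ (hn.trans (he₂ (m, n, l)).1) (he₂ (m, n, l)).2, sub_zero]
  have hbd2 := hstep (fun x => (x.1 + 1, x.2.1, x.2.2)) (fun x => (x.1, x.2.1, x.2.2 + 1))
    (fun x => ⟨le_rfl, Or.inl rfl⟩) (fun x => ⟨le_rfl, Or.inr rfl⟩) N _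
    (hstep (fun x => (x.1, x.2.1 + 1, x.2.2)) (fun x => (x.1, x.2.1, x.2.2 + 1))
    (fun x => ⟨by simp, Or.inl rfl⟩) (fun x => ⟨le_rfl, Or.inr rfl⟩) N f hbd)
  funext ⟨m, n, l⟩
  obtain ⟨B, hB⟩ := hbd2 l
  refine eq_zero_of_shift_eq
    (f := fun m n => (delta13 V ^ N) ((delta23 V ^ N) f) (m, n, l)) hB (fun m n => ?_) m n
  have := congrFun h1 (m, n, l)
  rw [shiftSub_apply] at this
  exact sub_eq_zero.mp this

/-- **Dong's lemma** for the normally ordered product. -/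
theorem IsLocal.normalOrder {ε ε₁ ε₂ : ℂ} {a b : fieldSpace V} {c : ℤ → Module.End ℂ V}
    (hab : IsLocal ε a.1 b.1) (hac : IsLocal ε₁ a.1 c) (hbc : IsLocal ε₂ b.1 c) :
    IsLocal (ε₁ * ε₂) (normalOrder ε a b).1 c := by
  obtain ⟨N₁, h₁⟩ := exists_delta_halfProduct (b := b) hac hbc
  obtain ⟨N₂, h₂⟩ := exists_delta_halfProduct (b := a) hbc hac
  obtain ⟨N₃, h₃⟩ := hab
  -- The extra power in N₃ + 1 clears the denominator z₁ - z₂ of the half products before the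
  -- locality of a and b is used.
  set N := max N₁ (max N₂ (N₃ + 1)) with hNdef
  refine ⟨3 * N, fun v => ?_⟩
  -- P and P' are the two halves of :ab: commuted with c, with the variable z₁ still free.
  -- Multiplied by z₁ - z₂, the combination P + εP' involves only the supercommutator of a and b.
  let P : ℤ × ℤ × ℤ → V := fun x => halfProduct a.1 b.1 (c x.2.2 v) x.1 x.2.1
        - (ε₁ * ε₂) • c x.2.2 (halfProduct a.1 b.1 v x.1 x.2.1)
  let P' : ℤ × ℤ × ℤ → V := fun x => halfProduct b.1 a.1 (c x.2.2 v) x.2.1 x.1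
        - (ε₁ * ε₂) • c x.2.2 (halfProduct b.1 a.1 v x.2.1 x.1)
  have hP : (delta13 V ^ N) ((delta23 V ^ N) P) = 0 := h₁ N (le_max_left _ _) v
  have hP' : (delta13 V ^ N) ((delta23 V ^ N) P') = 0 := by
    have h := h₂ N (le_trans (le_max_left _ _) (le_max_right _ _)) v
    rw [← Module.End.mul_apply, (commute_delta13_delta23.pow_pow N N).eq, Module.End.mul_apply]
    funext ⟨m, n, l⟩
    have := congrFun h (n, m, l)
    rw [shiftSub_pow_comp (d₁ := fun x => (x.1, x.2.1 + 1, x.2.2))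
      (d₂ := fun x => (x.1, x.2.1, x.2.2 + 1)) (fun x : ℤ × ℤ × ℤ => (x.2.1, x.1, x.2.2))
      (fun _ => rfl) (fun _ => rfl) N _ (m, n, l)] at this
    have h' := fun y => shiftSub_pow_comp (V := V) (e₁ := fun x => (x.1, x.2.1 + 1, x.2.2))
      (e₂ := fun x => (x.1, x.2.1, x.2.2 + 1)) (d₁ := fun x => (x.1 + 1, x.2.1, x.2.2))
      (d₂ := fun x => (x.1, x.2.1, x.2.2 + 1)) (fun x : ℤ × ℤ × ℤ => (x.2.1, x.1, x.2.2))
      (fun _ => rfl) (fun _ => rfl) N (fun x => halfProduct b.1 a.1 (c x.2.2 v) x.1 x.2.1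
        - (ε₂ * ε₁) • c x.2.2 (halfProduct b.1 a.1 v x.1 x.2.1)) y
    rw [funext h', mul_comm ε₂ ε₁] at this
    exact this
  have h12 : (delta12 V ^ N) (P + ε • P') = 0 := by
    refine pow_apply_eq_zero_of_le (m := N₃ + 1)
      (le_trans (le_max_right _ _) (le_max_right _ _)) ?_
    have e : delta12 V (P + ε • P') = (fun x => a.1 x.1 (b.1 x.2.1 (c x.2.2 v))
          - ε • b.1 x.2.1 (a.1 x.1 (c x.2.2 v)))
        - (ε₁ * ε₂) • (fun x => c x.2.2 (a.1 x.1 (b.1 x.2.1 v) - ε • b.1 x.2.1 (a.1 x.1 v))) := by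
      funext x
      simp only [P, P', shiftSub_apply, Pi.add_apply, Pi.sub_apply, Pi.smul_apply]
      rw [← halfProduct_shift a.1 b (c x.2.2 v), ← halfProduct_shift b.1 a (c x.2.2 v),
        ← halfProduct_shift a.1 b v, ← halfProduct_shift b.1 a v]
      simp only [map_sub, map_smul]
      module
    rw [pow_succ, Module.End.mul_apply, e, map_sub, map_smul]
    have e1 : (delta12 V ^ N₃) (fun x => a.1 x.1 (b.1 x.2.1 (c x.2.2 v))
          - ε • b.1 x.2.1 (a.1 x.1 (c x.2.2 v))) = 0 := by
      funext ⟨m, n, l⟩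
      rw [shiftSub_pow_comp (d₁ := fun x => (x.1 + 1, x.2)) (d₂ := fun x => (x.1, x.2 + 1))
        (fun x : ℤ × ℤ => (x.1, x.2, l)) (fun _ => rfl) (fun _ => rfl) N₃ _ (m, n)]
      exact congrFun (h₃ (c l v)) (m, n)
    have e2 : (delta12 V ^ N₃) (fun x => c x.2.2 (a.1 x.1 (b.1 x.2.1 v)
          - ε • b.1 x.2.1 (a.1 x.1 v))) = 0 := by
      funext ⟨m, n, l⟩
      rw [shiftSub_pow_comp (d₁ := fun x => (x.1 + 1, x.2)) (d₂ := fun x => (x.1, x.2 + 1))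
        (fun x : ℤ × ℤ => (x.1, x.2, l)) (fun _ => rfl) (fun _ => rfl) N₃ _ (m, n),
        shiftSub_pow_map (c l) N₃
          (fun x : ℤ × ℤ => a.1 x.1 (b.1 x.2 v) - ε • b.1 x.2 (a.1 x.1 v)), h₃]
      exact map_zero _
    rw [e1, e2, smul_zero, sub_zero]
  have h := pow_apply_eq_zero_of_commute commute_delta12_delta13 delta23_eq_sub h12
    (by rw [map_add, map_add, map_smul, map_smul, hP, hP', smul_zero, add_zero])
  funext ⟨n, l⟩
  -- Index 0 in z₁ extracts the normally ordered product, and z₂ - z₃ does not touch that index.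
  have h' := congrFun h (0, n, l)
  rw [shiftSub_pow_comp (d₁ := fun x => (x.1 + 1, x.2)) (d₂ := fun x => (x.1, x.2 + 1))
    (fun x : ℤ × ℤ => (0, x.1, x.2)) (fun _ => rfl) (fun _ => rfl) (3 * N) _ (n, l)] at h'
  have e : (fun x : ℤ × ℤ => (FormalDistribution.normalOrder ε a b).1 x.1 (c x.2 v)
        - (ε₁ * ε₂) • c x.2 ((FormalDistribution.normalOrder ε a b).1 x.1 v))
      = fun y => (P + ε • P') (0, y.1, y.2) := by
    funext x
    simp only [P, P', normalOrder_apply, Pi.add_apply, Pi.smul_apply, map_add, map_smul]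
    module
  rw [e]
  exact h'

/-- **Dong's lemma** for the products of nonnegative order. -/
theorem IsLocal.residueProduct {ε ε₁ ε₂ : ℂ} {a b c : ℤ → Module.End ℂ V}
    (hab : IsLocal ε a b) (hac : IsLocal ε₁ a c) (hbc : IsLocal ε₂ b c) (j : ℕ) :
    IsLocal (ε₁ * ε₂) (fun n => (delta (Module.End ℂ V) ^ j)
      (fun x => a x.1 * b x.2 - ε • (b x.2 * a x.1)) (0, n)) c := by
  obtain ⟨N₁, h₁⟩ := exists_delta_triple hac hbc
  obtain ⟨N₂, h₂⟩ := exists_delta_triple hbc hac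
  obtain ⟨N₃, h₃⟩ := hab
  set N := max N₁ (max N₂ N₃) with hNdef
  refine ⟨3 * N, fun v => ?_⟩
  let P : ℤ × ℤ × ℤ → V := fun x => a x.1 (b x.2.1 (c x.2.2 v))
        - (ε₁ * ε₂) • c x.2.2 (a x.1 (b x.2.1 v))
  let P' : ℤ × ℤ × ℤ → V := fun x => b x.2.1 (a x.1 (c x.2.2 v))
        - (ε₁ * ε₂) • c x.2.2 (b x.2.1 (a x.1 v))
  have hP : (delta13 V ^ N) ((delta23 V ^ N) P) = 0 := h₁ N (le_max_left _ _) v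
  have hP' : (delta13 V ^ N) ((delta23 V ^ N) P') = 0 := by
    have h := h₂ N (le_trans (le_max_left _ _) (le_max_right _ _)) v
    rw [← Module.End.mul_apply, (commute_delta13_delta23.pow_pow N N).eq, Module.End.mul_apply]
    funext ⟨m, n, l⟩
    have := congrFun h (n, m, l)
    rw [shiftSub_pow_comp (d₁ := fun x => (x.1, x.2.1 + 1, x.2.2))
      (d₂ := fun x => (x.1, x.2.1, x.2.2 + 1)) (fun x : ℤ × ℤ × ℤ => (x.2.1, x.1, x.2.2))
      (fun _ => rfl) (fun _ => rfl) N _ (m, n, l)] at this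
    have h' := fun y => shiftSub_pow_comp (V := V) (e₁ := fun x => (x.1, x.2.1 + 1, x.2.2))
      (e₂ := fun x => (x.1, x.2.1, x.2.2 + 1)) (d₁ := fun x => (x.1 + 1, x.2.1, x.2.2))
      (d₂ := fun x => (x.1, x.2.1, x.2.2 + 1)) (fun x : ℤ × ℤ × ℤ => (x.2.1, x.1, x.2.2))
      (fun _ => rfl) (fun _ => rfl) N (fun x => b x.1 (a x.2.1 (c x.2.2 v))
        - (ε₂ * ε₁) • c x.2.2 (b x.1 (a x.2.1 v))) y
    rw [funext h', mul_comm ε₂ ε₁] at this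
    exact this
  have h12 : (delta12 V ^ N) (P - ε • P') = 0 := by
    refine pow_apply_eq_zero_of_le (m := N₃)
      (le_trans (le_max_right _ _) (le_max_right _ _)) ?_
    have e : (P - ε • P') = (fun x => a x.1 (b x.2.1 (c x.2.2 v))
          - ε • b x.2.1 (a x.1 (c x.2.2 v)))
        - (ε₁ * ε₂) • (fun x => c x.2.2 (a x.1 (b x.2.1 v) - ε • b x.2.1 (a x.1 v))) := by
      funext x
      simp only [P, P', Pi.sub_apply, Pi.smul_apply, map_sub, map_smul]
      module
    rw [e, map_sub, map_smul]
    have e1 : (delta12 V ^ N₃) (fun x => a x.1 (b x.2.1 (c x.2.2 v))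
          - ε • b x.2.1 (a x.1 (c x.2.2 v))) = 0 := by
      funext ⟨m, n, l⟩
      rw [shiftSub_pow_comp (d₁ := fun x => (x.1 + 1, x.2)) (d₂ := fun x => (x.1, x.2 + 1))
        (fun x : ℤ × ℤ => (x.1, x.2, l)) (fun _ => rfl) (fun _ => rfl) N₃ _ (m, n)]
      exact congrFun (h₃ (c l v)) (m, n)
    have e2 : (delta12 V ^ N₃) (fun x => c x.2.2 (a x.1 (b x.2.1 v)
          - ε • b x.2.1 (a x.1 v))) = 0 := by
      funext ⟨m, n, l⟩
      rw [shiftSub_pow_comp (d₁ := fun x => (x.1 + 1, x.2)) (d₂ := fun x => (x.1, x.2 + 1))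
        (fun x : ℤ × ℤ => (x.1, x.2, l)) (fun _ => rfl) (fun _ => rfl) N₃ _ (m, n),
        shiftSub_pow_map (c l) N₃
          (fun x : ℤ × ℤ => a x.1 (b x.2 v) - ε • b x.2 (a x.1 v)), h₃]
      exact map_zero _
    rw [e1, e2, smul_zero, sub_zero]
  -- The factor (z₁-z₂)^j commutes with all the differences in play, so the argument for the bare
  -- supercommutator P - εP' carries over; the residue is again index 0 in z₁.
  have hcomm : ∀ {d : Module.End ℂ (ℤ × ℤ × ℤ → V)} (K : ℕ), Commute (delta12 V) d →
      ∀ f, (d ^ K) ((delta12 V ^ j) f) = (delta12 V ^ j) ((d ^ K) f) := by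
    intro d K hd f
    rw [← Module.End.mul_apply, ((hd.pow_pow j K).eq).symm, Module.End.mul_apply]
  have h := pow_apply_eq_zero_of_commute (x := (delta12 V ^ j) (P - ε • P'))
    commute_delta12_delta13 delta23_eq_sub
    (by rw [hcomm N (Commute.refl _), h12, map_zero])
    (by rw [hcomm N commute_delta12_delta23, hcomm N commute_delta12_delta13, map_sub, map_sub,
      map_smul, map_smul, hP, hP', smul_zero, sub_zero, map_zero])
  funext ⟨n, l⟩
  have h' := congrFun h (0, n, l)
  rw [shiftSub_pow_comp (d₁ := fun x => (x.1 + 1, x.2)) (d₂ := fun x => (x.1, x.2 + 1))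
    (fun x : ℤ × ℤ => (0, x.1, x.2)) (fun _ => rfl) (fun _ => rfl) (3 * N) _ (n, l)] at h'
  have ev : ∀ (n : ℤ) (u : V), (delta (Module.End ℂ V) ^ j)
      (fun x => a x.1 * b x.2 - ε • (b x.2 * a x.1)) (0, n) u
      = (delta V ^ j) (fun x => a x.1 (b x.2 u) - ε • b x.2 (a x.1 u)) (0, n) :=
    fun n u => (shiftSub_pow_map (LinearMap.applyₗ u : Module.End ℂ V →ₗ[ℂ] V) j _ (0, n)).symm
  have e : (fun x : ℤ × ℤ => (delta (Module.End ℂ V) ^ j)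
        (fun x => a x.1 * b x.2 - ε • (b x.2 * a x.1)) (0, x.1) (c x.2 v)
        - (ε₁ * ε₂) • c x.2 ((delta (Module.End ℂ V) ^ j)
        (fun x => a x.1 * b x.2 - ε • (b x.2 * a x.1)) (0, x.1) v))
      = fun y => (delta12 V ^ j) (P - ε • P') (0, y.1, y.2) := by
    funext ⟨n, l⟩
    simp only [ev]
    rw [shiftSub_pow_comp (d₁ := fun x => (x.1 + 1, x.2)) (d₂ := fun x => (x.1, x.2 + 1))
      (fun x : ℤ × ℤ => (x.1, x.2, l)) (fun _ => rfl) (fun _ => rfl) j _ (0, n),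
      ← shiftSub_pow_map (c l), ← Pi.smul_apply, ← map_smul, ← Pi.sub_apply, ← map_sub]
    have e' : ((fun x : ℤ × ℤ => a x.1 (b x.2 (c l v)) - ε • b x.2 (a x.1 (c l v)))
        - (ε₁ * ε₂) • fun x : ℤ × ℤ => c l (a x.1 (b x.2 v) - ε • b x.2 (a x.1 v)))
        = fun y => (P - ε • P') (y.1, y.2, l) := by
      funext x
      simp only [P, P', Pi.sub_apply, Pi.smul_apply, map_sub, map_smul]
      module
    rw [e']
  rw [e]
  exact h'

end FormalDistribution

namespace FormalDistribution

variable {V : Type*} [AddCommGroup V] [Module ℂ V]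

/-! ### The reconstruction theorem -/

/-- Fields as vertex operators. -/
def toVertexOperator (V : Type*) [AddCommGroup V] [Module ℂ V] :
    fieldSpace V →ₗ[ℂ] VertexOperator ℂ V where
  -- Coefficients are indexed by the power of z, and a_(n) belongs to z^(-n-1).
  toFun a := VertexOperator.of_coeff (fun n => a.1 (-n - 1)) fun v => by
    obtain ⟨N, hN⟩ := exists_bound a v
    refine ⟨-N - 1, fun n hn => ?_⟩
    by_contra h
    exact hn (hN _ (by omega))
  map_add' a b := HVertexOperator.coeff_inj (by
    rw [map_add]
    rfl)
  map_smul' c a := HVertexOperator.coeff_inj (by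
    rw [map_smul]
    rfl)

theorem ncoeff_toVertexOperator (a : fieldSpace V) (n : ℤ) :
    VertexOperator.ncoeff (toVertexOperator V a) n = a.1 n := by
  have : VertexOperator.ncoeff (toVertexOperator V a) n = a.1 (-(-n - 1) - 1) :=
    LinearMap.ext fun _ => rfl
  have e : -(-n - 1) - 1 = n := by ring
  rw [this, e]

/-- The identity field. -/
def idField (V : Type*) [AddCommGroup V] [Module ℂ V] : fieldSpace V :=
  ⟨fun n => if n = -1 then 1 else 0, fun v => by
    filter_upwards [Filter.eventually_ge_atTop 0] with n hn
    rw [if_neg (by omega), LinearMap.zero_apply]⟩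

theorem idField_apply (n : ℤ) : (idField V).1 n = if n = -1 then 1 else 0 := rfl

theorem idField_isCovariant {T Q : Module.End ℂ V} {vac : V} :
    IsCovariant T Q vac 0 (idField V).1 where
  translation n v := by
    rcases eq_or_ne n 0 with rfl | h
    · simp [idField_apply]
    · have h1 : n - 1 ≠ -1 := by omega
      by_cases h2 : n = -1 <;> simp [idField_apply, h1, h2]
  charge n v := by
    by_cases h2 : n = -1 <;> simp [idField_apply, h2]
  vacuum n hn := by rw [idField_apply, if_neg (by omega), LinearMap.zero_apply]

theorem idField_isLocal (a : ℤ → Module.End ℂ V) : IsLocal 1 (idField V).1 a :=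
  ⟨0, fun v => by
    funext x
    by_cases h2 : x.1 = -1 <;> simp [idField_apply, h2]⟩

theorem sign_mul_self (n : ℤ) : (-1 : ℂ) ^ n * (-1 : ℂ) ^ n = 1 := by
  rw [← mul_zpow]
  simp

theorem sign_add_mul (p q r : ℤ) :
    (-1 : ℂ) ^ ((p + q) * r) = (-1 : ℂ) ^ (p * r) * (-1 : ℂ) ^ (q * r) := by
  rw [add_mul, zpow_add₀ (by norm_num)]

/-- Mutually local translation covariant fields that generate `V` from the vacuum. -/
structure GeneratingFields (V : Type*) [AddCommGroup V] [Module ℂ V] (I : Type*) where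
  /-- the vacuum -/
  vac : V
  /-- the translation operator -/
  T : Module.End ℂ V
  /-- the charge operator, whose eigenspaces are the homogeneous components -/
  Q : Module.End ℂ V
  /-- the fields -/
  field : I → fieldSpace V
  /-- the charges of the fields -/
  deg : I → ℤ
  T_vac : T vac = 0
  Q_vac : Q vac = 0
  covariant : ∀ i, IsCovariant T Q vac (deg i) (field i).1
  isLocal : ∀ i j, IsLocal ((-1) ^ (deg i * deg j)) (field i).1 (field j).1
  span : ∀ U : Submodule ℂ V, vac ∈ U →
    (∀ (i : I) (k : ℕ), ∀ v ∈ U, (field i).1 (-1 - k) v ∈ U) → U = ⊤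

namespace GeneratingFields

variable {I : Type*} (G : GeneratingFields V I)

/-- The fields obtained from the generating fields by normally ordered products with their
derivatives. -/
inductive IsStateField : ℤ → fieldSpace V → Prop
  | id : IsStateField 0 (idField V)
  | zero (p : ℤ) : IsStateField p 0
  | add {p : ℤ} {a b : fieldSpace V} :
      IsStateField p a → IsStateField p b → IsStateField p (a + b)
  | smul {p : ℤ} (c : ℂ) {a : fieldSpace V} : IsStateField p a → IsStateField p (c • a)
  | normalOrder (i : I) (k : ℕ) {q : ℤ} {a : fieldSpace V} : IsStateField q a →
      IsStateField (G.deg i + q)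
        (normalOrder ((-1) ^ (G.deg i * q)) (fieldDividedDeriv k (G.field i)) a)

variable {G}

theorem IsStateField.isCovariant {p : ℤ} {a : fieldSpace V} (h : G.IsStateField p a) :
    IsCovariant G.T G.Q G.vac p a.1 := by
  induction h with
  | id => exact idField_isCovariant
  | zero p => exact IsCovariant.zero
  | add _ _ h h' => exact h.add h'
  | smul c _ h => exact h.smul c
  | normalOrder i k _ h => exact ((G.covariant i).fieldDividedDeriv k).normalOrder _ h

/-- Dong's lemma peels off the outermost generator of a. It needs that generator to be local with b
and also with the remaining field. -/
theorem IsStateField.isLocal_of_generators {p q : ℤ} {a b : fieldSpace V}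
    (h : G.IsStateField p a)
    (hb : ∀ i, IsLocal ((-1) ^ (G.deg i * q)) (G.field i).1 b.1)
    (hab : ∀ (i : I) {p : ℤ} {a : fieldSpace V}, G.IsStateField p a →
      IsLocal ((-1) ^ (G.deg i * p)) (G.field i).1 a.1) :
    IsLocal ((-1) ^ (p * q)) a.1 b.1 := by
  induction h with
  | id => simpa using idField_isLocal b.1
  | zero p => exact IsLocal.zero _ _
  | add _ _ h h' => exact h.add h'
  | smul c _ h => exact h.smul c
  | normalOrder i k h0 h =>
    rw [sign_add_mul]
    exact ((hab i h0).fieldDividedDeriv k).normalOrder ((hb i).fieldDividedDeriv k) h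

theorem IsStateField.isLocal_generator {p : ℤ} {a : fieldSpace V} (h : G.IsStateField p a)
    (i : I) : IsLocal ((-1) ^ (G.deg i * p)) (G.field i).1 a.1 := by
  -- Dong's lemma treats products in the first argument, so the generator is put second. In the
  -- inductive step the locality of the new generator with the old field is the induction
  -- hypothesis, flipped.
  suffices H : ∀ i, IsLocal ((-1) ^ (p * G.deg i)) a.1 (G.field i).1 by
    rw [mul_comm]
    exact (H i).symm (sign_mul_self _)
  induction h with
  | id => intro i; simpa using idField_isLocal (G.field i).1
  | zero p => exact fun i => IsLocal.zero _ _
  | add _ _ h h' => exact fun i => (h i).add (h' i)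
  | smul c _ h => exact fun i => (h i).smul c
  | @normalOrder j k q a h0 h =>
    intro i
    rw [sign_add_mul]
    refine IsLocal.normalOrder ?_ ((G.isLocal j i).fieldDividedDeriv k) (h i)
    have := (h j).symm (sign_mul_self _)
    rw [mul_comm] at this
    exact this.fieldDividedDeriv k

theorem IsStateField.isLocal {p q : ℤ} {a b : fieldSpace V} (ha : G.IsStateField p a)
    (hb : G.IsStateField q b) : IsLocal ((-1) ^ (p * q)) a.1 b.1 :=
  ha.isLocal_of_generators hb.isLocal_generator fun i _ _ h => h.isLocal_generator i

variable (G)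

/-- The state fields of charge `p`. -/
def stateFields (p : ℤ) : Submodule ℂ (fieldSpace V) where
  carrier := {a | G.IsStateField p a}
  add_mem' := IsStateField.add
  zero_mem' := IsStateField.zero p
  smul_mem' c _ := IsStateField.smul c

/-- The homogeneous components. -/
def grading (p : ℤ) : Submodule ℂ V := Module.End.eigenspace G.Q (p : ℂ)

theorem mem_grading {p : ℤ} {v : V} : v ∈ G.grading p ↔ G.Q v = (p : ℂ) • v :=
  Module.End.mem_eigenspace_iff

/-- The state of a field. -/
def state : fieldSpace V →ₗ[ℂ] V where
  toFun a := a.1 (-1) G.vac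
  map_add' _ _ := rfl
  map_smul' _ _ := rfl

theorem state_mem {p : ℤ} {a : fieldSpace V} (ha : a ∈ G.stateFields p) :
    G.state a ∈ G.grading p := by
  have := (IsStateField.isCovariant ha).charge (-1) G.vac
  rw [G.Q_vac, map_zero, sub_zero] at this
  exact G.mem_grading.mpr this

/-- The states of state fields include the vacuum and are stable under creation modes, since
a_(-1-k) is realised by the normally ordered product with ∂^(k)a; the `span` axiom then applies. -/
theorem iSup_map_state : ⨆ p, (G.stateFields p).map G.state = ⊤ := by
  refine G.span _ ?_ fun i k v hv => ?_
  · refine Submodule.mem_iSup_of_mem 0 ⟨idField V, IsStateField.id, ?_⟩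
    change (idField V).1 (-1) G.vac = G.vac
    simp [idField_apply]
  · refine Submodule.iSup_induction (fun p => (G.stateFields p).map G.state)
      (motive := fun v => (G.field i).1 (-1 - k) v ∈ ⨆ p, (G.stateFields p).map G.state) hv
      ?_ ?_ ?_
    · rintro p v ⟨a, ha, rfl⟩
      refine Submodule.mem_iSup_of_mem (G.deg i + p) ⟨_, IsStateField.normalOrder i k ha, ?_⟩
      refine (normalOrder_vacuum _ ((G.covariant i).fieldDividedDeriv k)
        (IsStateField.isCovariant ha)).trans ?_
      rw [fieldDividedDeriv_neg_one]
      rfl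
    · rw [map_zero]; exact Submodule.zero_mem _
    · intro v w hv hw
      rw [map_add]; exact Submodule.add_mem _ hv hw

theorem iSupIndep_grading : iSupIndep G.grading :=
  (Module.End.eigenspaces_iSupIndep G.Q).comp (f := fun p : ℤ => (p : ℂ)) Int.cast_injective

/-- The images exhaust V and lie in independent eigenspaces of the charge operator. A vector of
charge p is thus a state of charge p plus a part from other charges, and independence kills that
part. -/
theorem map_state (p : ℤ) : (G.stateFields p).map G.state = G.grading p := by
  have hle : ∀ p, (G.stateFields p).map G.state ≤ G.grading p := by
    rintro p _ ⟨a, ha, rfl⟩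
    exact G.state_mem ha
  refine le_antisymm (hle p) ?_
  have h1 : (G.stateFields p).map G.state ⊔ (⨆ (q) (_ : q ≠ p), G.grading q) = ⊤ := by
    rw [eq_top_iff, ← G.iSup_map_state]
    refine iSup_le fun q => ?_
    by_cases h : q = p
    · subst h; exact le_sup_left
    · exact le_trans (le_trans (hle q) (le_iSup₂_of_le q h le_rfl)) le_sup_right
  have h2 := G.iSupIndep_grading p
  intro v hv
  have hv' : v ∈ (G.stateFields p).map G.state ⊔ (⨆ (q) (_ : q ≠ p), G.grading q) := by
    rw [h1]; trivial
  obtain ⟨u, hu, w, hw, rfl⟩ := Submodule.mem_sup.mp hv'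
  have hw' : w ∈ G.grading p := by
    have := Submodule.sub_mem _ hv (hle p hu)
    simpa using this
  have : w = 0 := by
    have := Submodule.disjoint_def.mp h2 w hw' hw
    exact this
  rw [this, add_zero]
  exact hu

theorem isInternal_grading : DirectSum.IsInternal G.grading := by
  rw [DirectSum.isInternal_submodule_iff_iSupIndep_and_iSup_eq_top]
  refine ⟨G.iSupIndep_grading, ?_⟩
  rw [← G.iSup_map_state]
  exact iSup_congr fun p => (G.map_state p).symm

/-- Goddard's uniqueness theorem for state fields. -/
theorem eq_of_state_eq {p : ℤ} {a b : fieldSpace V} (ha : a ∈ G.stateFields p)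
    (hb : b ∈ G.stateFields p) (h : G.state a = G.state b) : a = b := by
  rw [← sub_eq_zero]
  have hc : a - b ∈ G.stateFields p := Submodule.sub_mem _ ha hb
  have hs : G.state (a - b) = 0 := by rw [map_sub, h, sub_self]
  generalize a - b = c at hc hs
  -- A difference with zero state annihilates the vacuum in all modes, by covariance; being local
  -- with every state field it then annihilates every state.
  have h0 := (IsStateField.isCovariant hc).apply_vacuum G.T_vac hs
  refine Subtype.ext (funext fun m => ?_)
  refine LinearMap.ker_eq_top.mp (?_ : LinearMap.ker (c.1 m) = ⊤)
  rw [eq_top_iff, ← G.iSup_map_state]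
  refine iSup_le fun q => ?_
  rintro _ ⟨d, hd, rfl⟩
  exact (IsStateField.isLocal hc hd).apply_eq_zero h0 (IsStateField.isCovariant hd).vacuum m (-1)

/-- States and state fields of a given charge correspond bijectively. -/
def stateEquiv (p : ℤ) : G.stateFields p ≃ₗ[ℂ] G.grading p :=
  LinearEquiv.ofBijective
    ((G.state.domRestrict (G.stateFields p)).codRestrict (G.grading p)
      fun a => G.state_mem a.2)
    ⟨fun a b h => Subtype.ext (G.eq_of_state_eq a.2 b.2 (congrArg Subtype.val h)), fun v => by
      have hv : v.1 ∈ (G.stateFields p).map G.state := by rw [map_state]; exact v.2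
      obtain ⟨a, ha, h⟩ := hv
      exact ⟨⟨a, ha⟩, Subtype.ext h⟩⟩

/-- The state-field correspondence. -/
def stateField : V →ₗ[ℂ] fieldSpace V :=
  (DirectSum.toModule ℂ ℤ (fieldSpace V) fun p =>
    (G.stateFields p).subtype ∘ₗ (G.stateEquiv p).symm.toLinearMap) ∘ₗ
  (LinearEquiv.ofBijective (DirectSum.coeLinearMap G.grading) G.isInternal_grading).symm.toLinearMap

theorem stateField_of_mem {p : ℤ} {v : V} (hv : v ∈ G.grading p) :
    G.stateField v = ((G.stateEquiv p).symm ⟨v, hv⟩ : fieldSpace V) := by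
  have h : (LinearEquiv.ofBijective (DirectSum.coeLinearMap G.grading)
      G.isInternal_grading).symm v = DirectSum.lof ℂ ℤ (fun p => G.grading p) p ⟨v, hv⟩ := by
    rw [LinearEquiv.symm_apply_eq]
    exact (DirectSum.coeLinearMap_lof G.grading p ⟨v, hv⟩).symm
  simp only [stateField, LinearMap.comp_apply, LinearEquiv.coe_coe]
  rw [h, DirectSum.toModule_lof]
  rfl

theorem stateField_mem {p : ℤ} {v : V} (hv : v ∈ G.grading p) :
    G.stateField v ∈ G.stateFields p := by
  rw [G.stateField_of_mem hv]
  exact Subtype.mem _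

theorem state_stateField_of_mem {p : ℤ} {v : V} (hv : v ∈ G.grading p) :
    G.state (G.stateField v) = v := by
  rw [G.stateField_of_mem hv]
  exact congrArg Subtype.val ((G.stateEquiv p).apply_symm_apply ⟨v, hv⟩)

theorem stateField_eq {p : ℤ} {a : fieldSpace V} (ha : a ∈ G.stateFields p) :
    G.stateField (G.state a) = a :=
  G.eq_of_state_eq (G.stateField_mem (G.state_mem ha)) ha
    (G.state_stateField_of_mem (G.state_mem ha))

theorem grading_induction {motive : V → Prop} (v : V)
    (mem : ∀ (p : ℤ), ∀ v ∈ G.grading p, motive v) (zero : motive 0)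
    (add : ∀ v w, motive v → motive w → motive (v + w)) : motive v := by
  have hv : v ∈ ⨆ p, G.grading p := by
    rw [G.isInternal_grading.submodule_iSup_eq_top]; trivial
  exact Submodule.iSup_induction G.grading (motive := motive) hv mem zero add

theorem vac_mem : G.vac ∈ G.grading 0 := by
  rw [mem_grading, G.Q_vac, Int.cast_zero, zero_smul]

theorem state_stateField (v : V) : G.state (G.stateField v) = v := by
  refine G.grading_induction (motive := fun v => G.state (G.stateField v) = v) v
    (fun p v hv => G.state_stateField_of_mem hv) (by simp) ?_
  intro v w hv hw
  rw [map_add, map_add, hv, hw]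

theorem stateField_vac : G.stateField G.vac = idField V := by
  have h := G.stateField_eq (p := 0) (a := idField V) IsStateField.id
  have h1 : G.state (idField V) = G.vac := by
    change (idField V).1 (-1) G.vac = G.vac
    simp [idField_apply]
  rwa [h1] at h

theorem stateField_translation (a : V) (n : ℤ) (v : V) :
    G.T ((G.stateField a).1 n v) - (G.stateField a).1 n (G.T v)
      = (-(n : ℂ)) • (G.stateField a).1 (n - 1) v := by
  refine G.grading_induction (motive := fun a => G.T ((G.stateField a).1 n v)
      - (G.stateField a).1 n (G.T v) = (-(n : ℂ)) • (G.stateField a).1 (n - 1) v) a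
    (fun p a ha => (IsStateField.isCovariant (G.stateField_mem ha)).translation n v)
    (by simp) ?_
  intro a b ha hb
  simp only [map_add, Submodule.coe_add, Pi.add_apply, LinearMap.add_apply, smul_add, ← ha, ← hb]
  abel

/-- Identifies the given operator T with the one built from (-2)-modes in the axioms: this is
covariance for n = -1 on the vacuum. -/
theorem stateField_neg_two (a : V) : (G.stateField a).1 (-2) G.vac = G.T a := by
  have h := G.stateField_translation a (-1) G.vac
  rw [G.T_vac, map_zero, sub_zero] at h
  have h1 : (G.stateField a).1 (-1) G.vac = a := G.state_stateField a
  rw [h1] at h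
  rw [h]
  norm_num

theorem stateField_vacuum (a : V) (n : ℤ) (hn : 0 ≤ n) : (G.stateField a).1 n G.vac = 0 := by
  refine G.grading_induction (motive := fun a => (G.stateField a).1 n G.vac = 0) a
    (fun p a ha => (IsStateField.isCovariant (G.stateField_mem ha)).vacuum n hn)
    (by simp) ?_
  intro a b ha hb
  simp [ha, hb]

/-- **Reconstruction theorem**: generating fields define a vertex algebra. -/
def vertexAlgebra : VertexAlgebra V where
  grading := G.grading
  isInternal := G.isInternal_grading
  vacuum := G.vac
  vacuum_mem := G.vac_mem
  Y := toVertexOperator V ∘ₗ G.stateField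
  mode_mem {p q a b} ha hb n := by
    rw [LinearMap.comp_apply, ncoeff_toVertexOperator]
    have h := (IsStateField.isCovariant (G.stateField_mem ha)).charge n b
    rw [G.mem_grading] at hb ⊢
    rw [hb, map_smul, sub_eq_iff_eq_add] at h
    rw [h]
    push_cast
    module
  translation a v n := by
    simp only [LinearMap.comp_apply, ncoeff_toVertexOperator, stateField_neg_two]
    exact G.stateField_translation a n v
  vacuum_mode n v := by
    rw [LinearMap.comp_apply, ncoeff_toVertexOperator, stateField_vac, idField_apply]
    split_ifs <;> rfl
  mode_vacuum a n hn := by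
    rw [LinearMap.comp_apply, ncoeff_toVertexOperator]
    exact G.stateField_vacuum a n hn
  creation a := by
    rw [LinearMap.comp_apply, ncoeff_toVertexOperator]
    exact G.state_stateField a
  locality {p q a b} ha hb := by
    simp only [LinearMap.comp_apply, ncoeff_toVertexOperator]
    exact (isLocal_iff _ _ _).mp
      (IsStateField.isLocal (G.stateField_mem ha) (G.stateField_mem hb))

theorem vertexAlgebra_mode (v : V) (n : ℤ) : G.vertexAlgebra.mode v n = (G.stateField v).1 n :=
  ncoeff_toVertexOperator _ n

/-- Both sides are state fields of the same charge with the same state. All explicit formulas for Y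
come from this. -/
theorem stateField_normalOrder (i : I) (k : ℕ) {q : ℤ} {v : V} (hv : v ∈ G.grading q) :
    G.stateField ((G.field i).1 (-1 - k) v)
      = normalOrder ((-1) ^ (G.deg i * q)) (fieldDividedDeriv k (G.field i)) (G.stateField v) := by
  have h := G.stateField_eq (IsStateField.normalOrder i k (G.stateField_mem hv))
  have h1 : G.state (normalOrder ((-1) ^ (G.deg i * q)) (fieldDividedDeriv k (G.field i))
      (G.stateField v)) = (G.field i).1 (-1 - k) v := by
    refine (normalOrder_vacuum _ ((G.covariant i).fieldDividedDeriv k)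
      (IsStateField.isCovariant (G.stateField_mem hv))).trans ?_
    rw [fieldDividedDeriv_neg_one]
    congr 1
    exact G.state_stateField v
  rwa [h1] at h

/-- The state of a generating field corresponds to this field. -/
theorem stateField_generator (i : I) :
    G.stateField ((G.field i).1 (-1) G.vac) = G.field i := by
  have h := G.stateField_normalOrder i 0 G.vac_mem
  rw [G.stateField_vac] at h
  simp only [Nat.cast_zero, sub_zero] at h
  rw [h]
  refine Subtype.ext (funext fun n => LinearMap.ext fun v => ?_)
  have h0 : fieldDividedDeriv 0 (G.field i) = G.field i := by simp [fieldDividedDeriv]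
  have hb : ∀ n : ℤ, 0 ≤ n → (idField V).1 n v = 0 := fun n hn => by
    rw [idField_apply, if_neg (by omega), LinearMap.zero_apply]
  obtain ⟨N, hN⟩ := exists_bound (G.field i) v
  rw [h0, mul_zero, zpow_zero, normalOrder_apply, one_smul,
    halfProduct_eq_sum (G.field i).1 hb 0 n (K := (-n).toNat)
      (by have := Int.self_le_toNat (-n); omega),
    halfProduct_eq_sum (idField V).1 hN n 0 (K := N.toNat)
      (by have := Int.self_le_toNat N; omega)]
  simp only [idField_apply]
  -- A single term can survive: i = -1 - n in the first half if n < 0, and i = n in the second half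
  -- if n ≥ 0.
  rcases lt_or_ge n 0 with hn | hn
  · rw [Finset.sum_eq_single_of_mem (-1 - n).toNat (Finset.mem_range.mpr (by omega)), Finset.sum_eq_zero, add_zero,
      if_pos (by omega)]
    · have : (0 : ℤ) - 1 - ((-1 - n).toNat : ℤ) = n := by omega
      rw [this, Module.End.one_apply]
    · intro j _
      rw [if_neg (by omega), LinearMap.zero_apply]
    · intro j _ hj
      rw [if_neg (by omega), LinearMap.zero_apply, map_zero]
  · rw [Finset.sum_eq_zero, zero_add]
    · rcases lt_or_ge n N with h | h
      · rw [Finset.sum_eq_single_of_mem n.toNat (Finset.mem_range.mpr (by omega)), if_pos (by omega),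
          Module.End.one_apply]
        · have e : (0 : ℤ) + n.toNat = n := by omega
          rw [e]
        · intro j _ hj
          rw [if_neg (by omega), LinearMap.zero_apply]
      · rw [hN n h, Finset.sum_eq_zero]
        intro j hj
        have := Finset.mem_range.mp hj
        rw [if_neg (by omega), LinearMap.zero_apply]
    · intro j _
      rw [if_neg (by omega), LinearMap.zero_apply, map_zero]

end GeneratingFields

end FormalDistribution

/-! ### Generalized binomial coefficients -/

/-- The binomial coefficient `x (x - 1) ⋯ (x - j + 1) / j!`. -/
def genChoose (x : ℂ) : ℕ → ℂ
  | 0 => 1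
  | j + 1 => genChoose x j * (x - j) / (j + 1)

theorem genChoose_succ_succ (x : ℂ) (j : ℕ) :
    genChoose (x + 1) (j + 1) = genChoose x (j + 1) + genChoose x j := by
  induction j with
  | zero => simp [genChoose]
  | succ j ih =>
    have h1 : ((j : ℂ) + 1) ≠ 0 := Nat.cast_add_one_ne_zero j
    have h2 : ((j : ℂ) + 1 + 1) ≠ 0 := by exact_mod_cast Nat.cast_add_one_ne_zero (R := ℂ) (j + 1)
    have h3 : genChoose x (j + 1) * ((j : ℂ) + 1) = genChoose x j * (x - j) := by
      rw [genChoose]; field_simp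
    have e1 : genChoose (x + 1) (j + 1 + 1)
        = genChoose (x + 1) (j + 1) * (x + 1 - ((j + 1 : ℕ) : ℂ)) / (((j + 1 : ℕ) : ℂ) + 1) := rfl
    have e2 : genChoose x (j + 1 + 1)
        = genChoose x (j + 1) * (x - ((j + 1 : ℕ) : ℂ)) / (((j + 1 : ℕ) : ℂ) + 1) := rfl
    rw [e1, e2, ih]
    push_cast
    field_simp
    linear_combination (-1 : ℂ) * h3

theorem genChoose_zero_succ (j : ℕ) : genChoose 0 (j + 1) = 0 := by
  induction j with
  | zero => simp [genChoose]
  | succ j ih => rw [genChoose, ih]; simp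

/-! ### Expansion of a local distribution in its residues -/

namespace FormalDistribution

variable {V : Type*} [AddCommGroup V] [Module ℂ V]

/-- A distribution killed by a power of `z - w` is determined by its residues. -/
theorem eq_sum_of_delta_pow_eq_zero (N : ℕ) (f : ℤ × ℤ → V) (hf : (delta V ^ N) f = 0) (m n : ℤ) :
    f (m, n) = ∑ j ∈ Finset.range N, genChoose m j • (delta V ^ j) f (0, m + n - j) := by
  induction N generalizing f m n with
  | zero =>
    have : f = 0 := hf
    simp [this]
  | succ N ih =>
    rw [pow_succ, Module.End.mul_apply] at hf
    have h1 : ∀ m n : ℤ, f (m + 1, n) - f (m, n + 1)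
        = ∑ j ∈ Finset.range N, genChoose m j • (delta V ^ (j + 1)) f (0, m + n - j) := by
      intro m n
      have := ih (delta V f) hf m n
      rw [shiftSub_apply] at this
      rw [this]
      refine Finset.sum_congr rfl fun j _ => ?_
      rw [pow_succ, Module.End.mul_apply]
    -- By Pascal's rule R satisfies the same difference equation as f. The two agree for m = 0, and
    -- the equation propagates this to all m in both directions.
    set R : ℤ → ℤ → V := fun m n =>
      ∑ j ∈ Finset.range (N + 1), genChoose m j • (delta V ^ j) f (0, m + n - j) with hR
    have h2 : ∀ m n : ℤ, R (m + 1) n - R m (n + 1) = f (m + 1, n) - f (m, n + 1) := by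
      intro m n
      rw [h1]
      simp only [hR]
      rw [← Finset.sum_sub_distrib, Finset.sum_range_succ']
      have e0 : m + 1 + n = m + (n + 1) := by ring
      simp only [genChoose, e0, sub_self, add_zero]
      refine Finset.sum_congr rfl fun j _ => ?_
      have e1 := genChoose_succ_succ (m : ℂ) j
      have e2 : m + (n + 1) - ((j + 1 : ℕ) : ℤ) = m + n - j := by push_cast; ring
      rw [e2, ← sub_smul]
      congr 1
      change genChoose ((m + 1 : ℤ) : ℂ) (j + 1) - genChoose (m : ℂ) (j + 1) = _
      push_cast
      rw [e1]
      ring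
    have h3 : ∀ n : ℤ, R 0 n = f (0, n) := by
      intro n
      simp only [hR]
      rw [Finset.sum_range_succ', Finset.sum_eq_zero]
      · simp [genChoose]
      · intro j _
        rw [Int.cast_zero, genChoose_zero_succ, zero_smul]
    have h4 : ∀ m n : ℤ, R m n = f (m, n) := by
      intro m
      induction m using Int.induction_on with
      | zero => exact h3
      | succ i h =>
        intro n
        have := h2 i n
        rw [h (n + 1)] at this
        exact sub_left_inj.mp this
      | pred i h =>
        intro n
        have := h2 (-(i : ℤ) - 1) (n - 1)
        rw [sub_add_cancel, sub_add_cancel, h (n - 1)] at this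
        exact sub_right_inj.mp this
    exact (h4 m n).symm

end FormalDistribution

open FormalDistribution

namespace VertexAlgebra

variable {V : Type*} [AddCommGroup V] [Module ℂ V] (A : VertexAlgebra V)

/-! ### The commutator formula in a vertex algebra -/

theorem mode_add (a b : V) (n : ℤ) : A.mode (a + b) n = A.mode a n + A.mode b n := by
  simp [mode, map_add]

theorem mode_smul (c : ℂ) (a : V) (n : ℤ) : A.mode (c • a) n = c • A.mode a n := by
  simp [mode, map_smul]

theorem mode_zero (n : ℤ) : A.mode 0 n = 0 := by
  simp [mode]

theorem mode_neg (a : V) (n : ℤ) : A.mode (-a) n = -A.mode a n := by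
  simp [mode, map_neg]

/-- The field of a state. -/
def modeField (a : V) : fieldSpace V :=
  ⟨A.mode a, fun v => by
    filter_upwards [Filter.eventually_gt_atTop
      (-1 - HahnSeries.order ((HahnModule.of ℂ).symm (A.Y a v)))] with n hn
    exact VertexOperator.ncoeff_eq_zero_of_lt_order _ _ _ (by omega)⟩

/-- The translation operator. -/
def translationOperator : Module.End ℂ V where
  toFun a := A.mode a (-2) A.vacuum
  map_add' a b := by rw [mode_add]; rfl
  map_smul' c a := by rw [mode_smul]; rfl

theorem translationOperator_apply (a : V) : A.translationOperator a = A.mode a (-2) A.vacuum := rfl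

theorem translationOperator_vacuum : A.translationOperator A.vacuum = 0 :=
  A.vacuum_mode (-2) A.vacuum

theorem translation_mode (a : V) (n : ℤ) (v : V) :
    A.translationOperator (A.mode a n v) - A.mode a n (A.translationOperator v)
      = (-(n : ℂ)) • A.mode a (n - 1) v :=
  A.translation a v n

theorem mode_nonneg_vacuum (a : V) {n : ℤ} (hn : 0 ≤ n) : A.mode a n A.vacuum = 0 :=
  A.mode_vacuum a n hn

theorem mode_neg_one_vacuum (a : V) : A.mode a (-1) A.vacuum = a :=
  A.creation a

theorem vacuum_mode_eq (n : ℤ) : A.mode A.vacuum n = if n = -1 then 1 else 0 := by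
  refine LinearMap.ext fun v => ?_
  have := A.vacuum_mode n v
  rw [mode, this]
  split_ifs <;> rfl

theorem mode_mem_grading {p q : ℤ} {a b : V} (ha : a ∈ A.grading p) (hb : b ∈ A.grading q)
    (n : ℤ) : A.mode a n b ∈ A.grading (p + q) :=
  A.mode_mem ha hb n

theorem isLocal_mode {p q : ℤ} {a b : V} (ha : a ∈ A.grading p) (hb : b ∈ A.grading q) :
    IsLocal ((-1) ^ (p * q)) (A.mode a) (A.mode b) :=
  (isLocal_iff _ _ _).mpr (A.locality ha hb)

theorem eq_top_of_grading_le {U : Submodule ℂ V} (h : ∀ p, A.grading p ≤ U) : U = ⊤ := by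
  rw [eq_top_iff, ← A.isInternal.submodule_iSup_eq_top]
  exact iSup_le h

/-- Uniqueness: a translation covariant field that is local with all fields of the vertex algebra
is the field of a state. -/
theorem eq_mode_of_isLocal {p : ℤ} {c : V} (hc : c ∈ A.grading p) {g : ℤ → Module.End ℂ V}
    (ht : ∀ n v, A.translationOperator (g n v) - g n (A.translationOperator v)
      = (-(n : ℂ)) • g (n - 1) v)
    (hv : ∀ n, 0 ≤ n → g n A.vacuum = 0) (hg : g (-1) A.vacuum = c)
    (hl : ∀ (r : ℤ), ∀ d ∈ A.grading r, IsLocal ((-1) ^ (p * r)) g (A.mode d)) (n : ℤ) :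
    g n = A.mode c n := by
  -- The charge condition is made empty by the zero charge operator; only covariance and the vacuum
  -- condition matter here.
  have h1 : IsCovariant A.translationOperator 0 A.vacuum 0 g := ⟨ht, by simp, hv⟩
  have h2 : IsCovariant A.translationOperator 0 A.vacuum 0 (A.mode c) :=
    ⟨A.translation_mode c, by simp, fun n hn => A.mode_nonneg_vacuum c hn⟩
  have h3 := h1.add (h2.smul (-1))
  have h4 := h3.apply_vacuum A.translationOperator_vacuum (by
    simp [hg, A.mode_neg_one_vacuum])
  have h5 : LinearMap.ker ((g + (-1 : ℂ) • A.mode c) n) = ⊤ := by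
    refine A.eq_top_of_grading_le fun r d hd => ?_
    have h6 := ((hl r d hd).add ((A.isLocal_mode hc hd).smul (-1))).apply_eq_zero h4
      (fun n hn => A.mode_nonneg_vacuum d hn) n (-1)
    rw [mode_neg_one_vacuum] at h6
    exact h6
  have h6 := LinearMap.ker_eq_top.mp h5
  rw [Pi.add_apply, Pi.smul_apply, neg_one_smul, ← sub_eq_add_neg] at h6
  exact sub_eq_zero.mp h6

/-- The field of `T a` is the derivative of the field of `a`. -/
theorem mode_translationOperator {p : ℤ} {a : V} (ha : a ∈ A.grading p) (n : ℤ) :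
    A.mode (A.translationOperator a) n = (-(n : ℂ)) • A.mode a (n - 1) := by
  have h2 : IsCovariant A.translationOperator 0 A.vacuum 0 (A.modeField a).1 :=
    ⟨A.translation_mode a, by simp, fun n hn => A.mode_nonneg_vacuum a hn⟩
  have h3 := h2.fieldDeriv
  refine (A.eq_mode_of_isLocal (p := p) (g := (fieldDeriv V (A.modeField a)).1) ?_
    h3.translation h3.vacuum ?_ (fun r d hd => ?_) n).symm
  · have := A.mode_mem_grading ha A.vacuum_mem (-2)
    rwa [add_zero] at this
  · rw [fieldDeriv_apply]
    change (-((-1 : ℤ) : ℂ)) • A.mode a (-1 - 1) A.vacuum = A.mode a (-2) A.vacuum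
    norm_num
  · exact IsLocal.fieldDeriv (a := A.modeField a) (A.isLocal_mode ha hd)

/-- The product of two fields of nonnegative order is the field of the product of states. -/
theorem residue_eq_mode {p q : ℤ} {a b : V} (ha : a ∈ A.grading p) (hb : b ∈ A.grading q) (j : ℕ)
    (n : ℤ) : (delta (Module.End ℂ V) ^ j)
      (fun x => A.mode a x.1 * A.mode b x.2 - ((-1 : ℂ) ^ (p * q)) • (A.mode b x.2 * A.mode a x.1))
      (0, n) = A.mode (A.mode a j b) n := by
  set f : ℤ × ℤ → Module.End ℂ V := fun x =>
    A.mode a x.1 * A.mode b x.2 - ((-1 : ℂ) ^ (p * q)) • (A.mode b x.2 * A.mode a x.1) with hf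
  have hfv : ∀ m n : ℤ, 0 ≤ n → 0 ≤ m → f (m, n) A.vacuum = 0 := by
    intro m n hn hm
    simp [hf, A.mode_nonneg_vacuum _ hn, A.mode_nonneg_vacuum _ hm]
  refine A.eq_mode_of_isLocal (g := fun n => (delta (Module.End ℂ V) ^ j) f (0, n))
    (A.mode_mem_grading ha hb j) ?_ ?_ ?_ ?_ n
  -- Multiplication by z - w commutes with ∂_z + ∂_w, so covariance survives every power. At first
  -- index 0 the ∂_z term has coefficient 0.
  · have key : ∀ (j : ℕ) (f : ℤ × ℤ → Module.End ℂ V),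
        (∀ m n v, A.translationOperator (f (m, n) v) - f (m, n) (A.translationOperator v)
          = (-(m : ℂ)) • f (m - 1, n) v + (-(n : ℂ)) • f (m, n - 1) v) →
        ∀ m n v, A.translationOperator ((delta (Module.End ℂ V) ^ j) f (m, n) v)
          - (delta (Module.End ℂ V) ^ j) f (m, n) (A.translationOperator v)
          = (-(m : ℂ)) • (delta (Module.End ℂ V) ^ j) f (m - 1, n) v
            + (-(n : ℂ)) • (delta (Module.End ℂ V) ^ j) f (m, n - 1) v := by
      intro j
      induction j with
      | zero => intro f h; exact h
      | succ j ih =>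
        intro f h
        rw [pow_succ]
        refine ih (delta (Module.End ℂ V) f) fun m n v => ?_
        have h1 := h (m + 1) n v
        have h2 := h m (n + 1) v
        simp only [shiftSub_apply, LinearMap.sub_apply, map_sub]
        rw [sub_eq_iff_eq_add] at h1 h2
        rw [h1, h2]
        simp only [add_sub_cancel_right, sub_add_cancel]
        push_cast
        module
    intro n v
    have := key j f (fun m n v => by
      have h1 := A.translation_mode a m (A.mode b n v)
      have h2 := congrArg (A.mode a m) (A.translation_mode b n v)
      have h3 := A.translation_mode b n (A.mode a m v)
      have h4 := congrArg (A.mode b n) (A.translation_mode a m v)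
      rw [map_sub, map_smul] at h2 h4
      simp only [hf, LinearMap.sub_apply, LinearMap.smul_apply, Module.End.mul_apply, map_sub,
        map_smul]
      rw [sub_eq_iff_eq_add] at h1 h2 h3 h4
      rw [h1, h2, h3, h4]
      module) 0 n v
    simpa using this
  · intro n hn
    rw [delta_pow_apply, LinearMap.sum_apply]
    refine Finset.sum_eq_zero fun i hi => ?_
    have := Finset.mem_range.mp hi
    rw [LinearMap.smul_apply, hfv _ _ (by omega) (by omega), smul_zero]
  -- The terms with i > 0 involve only nonnegative modes and die on the vacuum; i = 0 gives
  -- a_(j)b_(-1)|0⟩ = a_(j)b.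
  · rw [delta_pow_apply, LinearMap.sum_apply, Finset.sum_range_succ', Finset.sum_eq_zero]
    · simp [hf, A.mode_nonneg_vacuum a (Int.natCast_nonneg j), A.mode_neg_one_vacuum]
    · intro i hi
      have := Finset.mem_range.mp hi
      rw [LinearMap.smul_apply, hfv _ _ (by push_cast; omega) (by push_cast; omega), smul_zero]
  · intro r d hd
    rw [sign_add_mul]
    exact IsLocal.residueProduct (A.isLocal_mode ha hb) (A.isLocal_mode ha hd)
      (A.isLocal_mode hb hd) j

/-- **Borcherds' commutator formula**. -/
theorem mode_commutator {p q : ℤ} {a b : V} (ha : a ∈ A.grading p) (hb : b ∈ A.grading q) {N : ℕ}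
    (hN : ∀ j : ℕ, N ≤ j → A.mode a j b = 0) (m n : ℤ) :
    A.mode a m * A.mode b n - ((-1 : ℂ) ^ (p * q)) • (A.mode b n * A.mode a m)
      = ∑ j ∈ Finset.range N, genChoose m j • A.mode (A.mode a j b) (m + n - j) := by
  set f : ℤ × ℤ → Module.End ℂ V := fun x =>
    A.mode a x.1 * A.mode b x.2 - ((-1 : ℂ) ^ (p * q)) • (A.mode b x.2 * A.mode a x.1) with hf
  obtain ⟨N', hN'⟩ := A.isLocal_mode ha hb
  have h0 : (delta (Module.End ℂ V) ^ N') f = 0 := by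
    funext x
    refine LinearMap.ext fun v => ?_
    have h1 := shiftSub_pow_map (e₁ := fun x : ℤ × ℤ => (x.1 + 1, x.2))
      (e₂ := fun x => (x.1, x.2 + 1)) (LinearMap.applyₗ v : Module.End ℂ V →ₗ[ℂ] V) N' f x
    exact h1.symm.trans (congrFun (hN' v) x)
  -- The exponent is raised so that the sum covers both the locality order N' and the range N; the
  -- terms beyond N vanish because a_(j)b does.
  have h1 := eq_sum_of_delta_pow_eq_zero (N + N') f
    (pow_apply_eq_zero_of_le (Nat.le_add_left _ _) h0) m n
  refine h1.trans ?_
  rw [Finset.sum_range_add, Finset.sum_eq_zero (s := Finset.range N'), add_zero]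
  · exact Finset.sum_congr rfl fun j _ => by rw [A.residue_eq_mode ha hb]
  · intro j _
    rw [A.residue_eq_mode ha hb, hN _ (Nat.le_add_right _ _), mode_zero, smul_zero]

/-! ### Primary vectors and conformal vectors -/

/-- `x` is primary of weight `Δ` with respect to `ν`. -/
def IsPrimary (ν : V) (Δ : ℂ) (x : V) : Prop :=
  ∀ m n : ℤ, A.mode ν m * A.mode x n - A.mode x n * A.mode ν m
    = ((Δ - 1) * m - n) • A.mode x (m + n - 1)

variable {A}

/-- Only orders 0 and 1 enter the commutator formula, with coefficients -(m+n) from (Tx)_(m+n) and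
mΔ. -/
theorem isPrimary_of_mode {ν x : V} {Δ : ℂ} {p : ℤ} (hν : ν ∈ A.grading 0) (hx : x ∈ A.grading p)
    (h0 : A.mode ν 0 x = A.translationOperator x) (h1 : A.mode ν 1 x = Δ • x)
    (h2 : ∀ j : ℕ, 2 ≤ j → A.mode ν j x = 0) : A.IsPrimary ν Δ x := by
  intro m n
  have h := A.mode_commutator hν hx h2 m n
  rw [zero_mul, zpow_zero, one_smul] at h
  rw [h, Finset.sum_range_succ, Finset.sum_range_one, Nat.cast_zero, Nat.cast_one, h0, h1,
    A.mode_translationOperator hx, mode_smul, sub_zero]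
  simp only [genChoose, smul_smul, ← add_smul]
  congr 1
  push_cast
  ring

theorem IsPrimary.mode_apply {ν x : V} {Δ : ℂ} (h : A.IsPrimary ν Δ x) (m n : ℤ) (v : V) :
    A.mode ν m (A.mode x n v)
      = ((Δ - 1) * m - n) • A.mode x (m + n - 1) v + A.mode x n (A.mode ν m v) := by
  have := congrArg (fun F => F v) (h m n)
  simp only [LinearMap.sub_apply, Module.End.mul_apply, LinearMap.smul_apply] at this
  rw [← this, sub_add_cancel]

theorem IsPrimary.mode_self {ν x : V} {Δ : ℂ} (h : A.IsPrimary ν Δ x) {m : ℤ} (hm : 0 ≤ m) :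
    A.mode ν m x = ((Δ - 1) * m + 1) • A.mode x (m - 2) A.vacuum := by
  have := h.mode_apply m (-1) A.vacuum
  rw [A.mode_nonneg_vacuum ν hm, map_zero, add_zero, A.mode_neg_one_vacuum] at this
  rw [this]
  have e : m + -1 - 1 = m - 2 := by ring
  rw [e]
  push_cast
  rw [sub_neg_eq_add]

/-- The vectors `x i` generate the vertex algebra. -/
def Generates {I : Type*} (A : VertexAlgebra V) (x : I → V) : Prop :=
  ∀ U : Submodule ℂ V, A.vacuum ∈ U →
    (∀ (i : I) (k : ℕ), ∀ v ∈ U, A.mode (x i) (-1 - k) v ∈ U) → U = ⊤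

/-- For m = 0 the weight drops out of the primary relation, so ν_(0) and T have the same commutators
with the generators; both kill the vacuum. -/
theorem mode_zero_eq_translationOperator {I : Type*} {x : I → V} (hgen : A.Generates x) {ν : V}
    {Δ : I → ℂ} (hx : ∀ i, A.IsPrimary ν (Δ i) (x i)) (a : V) :
    A.mode ν 0 a = A.translationOperator a := by
  have : LinearMap.ker (A.mode ν 0 - A.translationOperator) = ⊤ := by
    refine hgen _ ?_ fun i k v hv => ?_
    · rw [LinearMap.mem_ker, LinearMap.sub_apply, A.mode_nonneg_vacuum ν le_rfl,
        A.translationOperator_vacuum, sub_zero]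
    · rw [LinearMap.mem_ker, LinearMap.sub_apply, sub_eq_zero] at hv ⊢
      have h := A.translation_mode (x i) (-1 - k) v
      have e : (0 : ℤ) + (-1 - k) - 1 = -1 - k - 1 := by ring
      rw [sub_eq_iff_eq_add] at h
      rw [(hx i).mode_apply, hv, h, e]
      push_cast
      module
  have h := LinearMap.ker_eq_top.mp this
  exact congrArg (fun F => F a) (sub_eq_zero.mp h)

/-- Primarity of generators settles translation and diagonalizability, so the Virasoro relations
reduce to four products of ν with itself. -/
theorem isConformal_of_primary {I : Type*} {x : I → V} (hgen : A.Generates x) {ν : V} {c : ℂ}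
    {Δ : I → ℂ} (hν : ν ∈ A.grading 0) (hx : ∀ i, A.IsPrimary ν (Δ i) (x i))
    (h1 : A.mode ν 1 ν = (2 : ℂ) • ν) (h2 : A.mode ν 2 ν = 0)
    (h3 : A.mode ν 3 ν = (c / 2) • A.vacuum) (h4 : ∀ j : ℕ, 4 ≤ j → A.mode ν j ν = 0) :
    A.IsConformal ν c where
  mem := hν
  virasoro m n := by
    have h := A.mode_commutator hν hν h4 (m + 1) (n + 1)
    rw [zero_mul, zpow_zero, one_smul] at h
    rw [h]
    -- Orders 0 and 1 combine to -(m+n+2) + 2(m+1) = m - n. Order 3 contributes (m+1)m(m-1)/6 · c/2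
    -- = (m³-m)c/12.
    simp only [Finset.sum_range_succ, Finset.sum_range_zero, zero_add]
    have e0 := mode_zero_eq_translationOperator hgen hx ν
    rw [Nat.cast_zero, Nat.cast_one, Nat.cast_ofNat, Nat.cast_ofNat, e0, h1, h2, h3,
      A.mode_translationOperator hν, mode_smul, mode_smul, mode_zero, vacuum_mode_eq]
    have e1 : m + 1 + (n + 1) - 0 - 1 = m + n + 1 := by ring
    have e2 : m + 1 + (n + 1) - 1 = m + n + 1 := by ring
    rw [e1, e2]
    have e3 : (m + 1 + (n + 1) - 3 = -1) ↔ (m + n = 0) := by omega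
    simp only [e3]
    split_ifs with h0
    · simp only [genChoose]
      push_cast
      module
    · simp only [genChoose]
      push_cast
      module
  translation a := mode_zero_eq_translationOperator hgen hx a
  diagonalizable := by
    refine hgen _ ?_ fun i k v hv => ?_
    · refine Submodule.mem_iSup_of_mem 0 ?_
      rw [Module.End.mem_eigenspace_iff, A.mode_nonneg_vacuum ν zero_le_one, zero_smul]
    · refine Submodule.iSup_induction (fun μ : ℂ => Module.End.eigenspace (A.mode ν 1) μ)
        (motive := fun v => A.mode (x i) (-1 - k) v
          ∈ ⨆ μ : ℂ, Module.End.eigenspace (A.mode ν 1) μ) hv ?_ ?_ ?_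
      · intro μ v hv
        -- The mode x_(-1-k) of a primary vector of weight Δ raises L_0-eigenvalues by Δ + k.
        refine Submodule.mem_iSup_of_mem (μ + Δ i + k) ?_
        rw [Module.End.mem_eigenspace_iff] at hv ⊢
        rw [(hx i).mode_apply, hv, map_smul]
        have e : (1 : ℤ) + (-1 - k) - 1 = -1 - k := by ring
        rw [e, ← add_smul]
        congr 1
        push_cast
        ring
      · rw [map_zero]; exact Submodule.zero_mem _
      · intro v w hv hw
        rw [map_add]; exact Submodule.add_mem _ hv hw

end VertexAlgebra

namespace VertexAlgebra

variable {V : Type*} [AddCommGroup V] [Module ℂ V]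

/-! ### Free fields -/

/-- Free fermions `φ i`, `ψ i` and free bosons `b i`, `c i` that generate a vertex algebra;
`d` and `-d` are the degrees of the fermions. -/
structure FreeFields {ι κ : Type*} [DecidableEq ι] [DecidableEq κ] (A : VertexAlgebra V)
    (d : ℤ) (φ ψ : ι → V) (b c : κ → V) : Prop where
  odd : Odd d
  φ_mem : ∀ i, φ i ∈ A.grading d
  ψ_mem : ∀ i, ψ i ∈ A.grading (-d)
  b_mem : ∀ i, b i ∈ A.grading 0
  c_mem : ∀ i, c i ∈ A.grading 0
  φψ : ∀ i j m n v, A.mode (φ i) m (A.mode (ψ j) n v) + A.mode (ψ j) n (A.mode (φ i) m v)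
    = if i = j ∧ m + n = -1 then v else 0
  φφ : ∀ i j m n v, A.mode (φ i) m (A.mode (φ j) n v) + A.mode (φ j) n (A.mode (φ i) m v) = 0
  ψψ : ∀ i j m n v, A.mode (ψ i) m (A.mode (ψ j) n v) + A.mode (ψ j) n (A.mode (ψ i) m v) = 0
  bc : ∀ i j m n v, A.mode (b i) m (A.mode (c j) n v) - A.mode (c j) n (A.mode (b i) m v)
    = if i = j ∧ m + n = 0 then (m : ℂ) • v else 0
  bb : ∀ i j m n v, A.mode (b i) m (A.mode (b j) n v) = A.mode (b j) n (A.mode (b i) m v)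
  cc : ∀ i j m n v, A.mode (c i) m (A.mode (c j) n v) = A.mode (c j) n (A.mode (c i) m v)
  φb : ∀ i j m n v, A.mode (φ i) m (A.mode (b j) n v) = A.mode (b j) n (A.mode (φ i) m v)
  φc : ∀ i j m n v, A.mode (φ i) m (A.mode (c j) n v) = A.mode (c j) n (A.mode (φ i) m v)
  ψb : ∀ i j m n v, A.mode (ψ i) m (A.mode (b j) n v) = A.mode (b j) n (A.mode (ψ i) m v)
  ψc : ∀ i j m n v, A.mode (ψ i) m (A.mode (c j) n v) = A.mode (c j) n (A.mode (ψ i) m v)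
  generates : A.Generates (Sum.elim (Sum.elim φ ψ) (Sum.elim b c))

/-- The conformal vector of a system of free fields. -/
def freeConformalVector {ι κ : Type*} [Fintype ι] [Fintype κ] (A : VertexAlgebra V)
    (φ ψ : ι → V) (b c : κ → V) (lam : ℂ) : V :=
  ∑ i, A.mode (b i) (-1) (c i)
    + ((1 - lam) • ∑ i, A.mode (φ i) (-2) (ψ i) + lam • ∑ i, A.mode (ψ i) (-2) (φ i))

namespace FreeFields

variable {ι κ : Type*} [DecidableEq ι] [DecidableEq κ] {A : VertexAlgebra V}
  {d : ℤ} {φ ψ : ι → V} {b c : κ → V} (h : FreeFields A d φ ψ b c)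

include h

theorem ψφ (i j : ι) (m n : ℤ) (v : V) :
    A.mode (ψ i) m (A.mode (φ j) n v) + A.mode (φ j) n (A.mode (ψ i) m v)
      = if i = j ∧ m + n = -1 then v else 0 := by
  have e : j = i ↔ i = j := eq_comm
  rw [add_comm, h.φψ j i n m v, add_comm n m]
  simp only [e]

theorem cb (i j : κ) (m n : ℤ) (v : V) :
    A.mode (c i) m (A.mode (b j) n v) - A.mode (b j) n (A.mode (c i) m v)
      = if i = j ∧ m + n = 0 then (m : ℂ) • v else 0 := by
  have e : j = i ↔ i = j := eq_comm
  rw [← neg_sub, h.bc j i n m v, add_comm n m]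
  simp only [e]
  split_ifs with h0
  · have : (n : ℂ) = -m := by
      rw [eq_neg_iff_add_eq_zero, add_comm]
      exact_mod_cast h0.2
    rw [this, neg_smul, neg_neg]
  · exact neg_zero

/-- All relations are symmetric under φ ↔ ψ, b ↔ c, d ↔ -d, and the conformal vector is preserved
when λ is replaced by 1 - λ. Statements about ψ and c thus follow from those about φ and b. -/
theorem swap : FreeFields A (-d) ψ φ c b where
  odd := h.odd.neg
  φ_mem := h.ψ_mem
  ψ_mem := by rw [neg_neg]; exact h.φ_mem
  b_mem := h.c_mem
  c_mem := h.b_mem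
  φψ := h.ψφ
  φφ := h.ψψ
  ψψ := h.φφ
  bc := h.cb
  bb := h.cc
  cc := h.bb
  φb := h.ψc
  φc := h.ψb
  ψb := h.φc
  ψc := h.φb
  generates U hU hx := h.generates U hU fun i k v hv => by
    rcases i with (i | i) | (i | i)
    · exact hx (Sum.inl (Sum.inr i)) k v hv
    · exact hx (Sum.inl (Sum.inl i)) k v hv
    · exact hx (Sum.inr (Sum.inr i)) k v hv
    · exact hx (Sum.inr (Sum.inl i)) k v hv

/-! ### Nonnegative products of the free fields -/

section Values

variable {m : ℤ} (hm : 0 ≤ m)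

include hm

/-- Since ψ = ψ_(-1)|0⟩, the mode of φ is moved past ψ_(-1) onto the vacuum, which it kills. The
other products below arise in the same way. -/
theorem mode_φ_ψ (i j : ι) : A.mode (φ i) m (ψ j) = if i = j ∧ m = 0 then A.vacuum else 0 := by
  have := h.φψ i j m (-1) A.vacuum
  rw [A.mode_neg_one_vacuum, A.mode_nonneg_vacuum _ hm, map_zero, add_zero] at this
  have e : m + -1 = -1 ↔ m = 0 := by omega
  simpa only [e] using this

theorem mode_φ_φ (i j : ι) : A.mode (φ i) m (φ j) = 0 := by
  have := h.φφ i j m (-1) A.vacuum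
  rwa [A.mode_neg_one_vacuum, A.mode_nonneg_vacuum _ hm, map_zero, add_zero] at this

theorem mode_φ_b (i : ι) (j : κ) : A.mode (φ i) m (b j) = 0 := by
  have := h.φb i j m (-1) A.vacuum
  rwa [A.mode_neg_one_vacuum, A.mode_nonneg_vacuum _ hm, map_zero] at this

theorem mode_φ_c (i : ι) (j : κ) : A.mode (φ i) m (c j) = 0 := by
  have := h.φc i j m (-1) A.vacuum
  rwa [A.mode_neg_one_vacuum, A.mode_nonneg_vacuum _ hm, map_zero] at this

theorem mode_b_φ (i : κ) (j : ι) : A.mode (b i) m (φ j) = 0 := by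
  have := (h.φb j i (-1) m A.vacuum).symm
  rwa [A.mode_neg_one_vacuum, A.mode_nonneg_vacuum _ hm, map_zero] at this

theorem mode_b_ψ (i : κ) (j : ι) : A.mode (b i) m (ψ j) = 0 := by
  have := (h.ψb j i (-1) m A.vacuum).symm
  rwa [A.mode_neg_one_vacuum, A.mode_nonneg_vacuum _ hm, map_zero] at this

theorem mode_b_b (i j : κ) : A.mode (b i) m (b j) = 0 := by
  have := h.bb i j m (-1) A.vacuum
  rwa [A.mode_neg_one_vacuum, A.mode_nonneg_vacuum _ hm, map_zero] at this

theorem mode_b_c (i j : κ) : A.mode (b i) m (c j) = if i = j ∧ m = 1 then A.vacuum else 0 := by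
  have := h.bc i j m (-1) A.vacuum
  rw [A.mode_neg_one_vacuum, A.mode_nonneg_vacuum _ hm, map_zero, sub_zero] at this
  have e : m + -1 = 0 ↔ m = 1 := by omega
  rw [this]
  simp only [e]
  split_ifs with h0
  · rw [h0.2, Int.cast_one, one_smul]
  · rfl

end Values

/-! #### The conformal vector -/

section Conformal

variable [Fintype ι] [Fintype κ] (lam : ℂ)

theorem freeConformalVector_mem : A.freeConformalVector φ ψ b c lam ∈ A.grading 0 := by
  refine Submodule.add_mem _ (Submodule.sum_mem _ fun i _ => ?_) (Submodule.add_mem _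
    (Submodule.smul_mem _ _ (Submodule.sum_mem _ fun i _ => ?_))
    (Submodule.smul_mem _ _ (Submodule.sum_mem _ fun i _ => ?_)))
  · simpa using A.mode_mem_grading (h.b_mem i) (h.c_mem i) (-1)
  · simpa using A.mode_mem_grading (h.φ_mem i) (h.ψ_mem i) (-2)
  · simpa using A.mode_mem_grading (h.ψ_mem i) (h.φ_mem i) (-2)

theorem mode_c_b_neg_one (i : κ) : A.mode (c i) (-1) (b i) = A.mode (b i) (-1) (c i) := by
  have := h.bc i i (-1) (-1) A.vacuum
  rw [if_neg (by omega), A.mode_neg_one_vacuum, A.mode_neg_one_vacuum] at this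
  exact (sub_eq_zero.mp this).symm

theorem freeConformalVector_swap :
    A.freeConformalVector ψ φ c b (1 - lam) = A.freeConformalVector φ ψ b c lam := by
  simp only [freeConformalVector, h.mode_c_b_neg_one, sub_sub_cancel]
  rw [add_comm ((lam • ∑ i, A.mode (ψ i) (-2) (φ i)))]

/-- This order of the factors needs only the free anticommutators; the action of ν on φ is obtained
afterwards by reversing the commutator. -/
theorem mode_φ_freeConformalVector {m : ℤ} (hm : 0 ≤ m) (k : ι) :
    A.mode (φ k) m (A.freeConformalVector φ ψ b c lam)
      = (if m = 0 then -(1 - lam) else 0) • A.mode (φ k) (-2) A.vacuum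
        + (if m = 1 then lam else 0) • φ k := by
  have e1 : ∀ i, A.mode (φ k) m (A.mode (b i) (-1) (c i)) = 0 := fun i => by
    rw [h.φb, h.mode_φ_c hm, map_zero]
  have e2 : ∀ i, A.mode (φ k) m (A.mode (φ i) (-2) (ψ i))
      = if i = k then (if m = 0 then -A.mode (φ k) (-2) A.vacuum else 0) else 0 := fun i => by
    rw [eq_neg_of_add_eq_zero_left (h.φφ k i m (-2) (ψ i)), h.mode_φ_ψ hm]
    by_cases h1 : i = k
    · subst h1
      by_cases h2 : m = 0 <;> simp [h2]
    · simp [h1, Ne.symm h1]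
  have e3 : ∀ i, A.mode (φ k) m (A.mode (ψ i) (-2) (φ i))
      = if i = k then (if m = 1 then φ k else 0) else 0 := fun i => by
    rw [eq_sub_of_add_eq (h.φψ k i m (-2) (φ i)), h.mode_φ_φ hm, map_zero, sub_zero]
    have e : m + -2 = -1 ↔ m = 1 := by omega
    by_cases h1 : i = k
    · subst h1
      by_cases h2 : m = 1 <;> simp [e, h2]
    · simp [h1, Ne.symm h1]
  simp only [freeConformalVector, map_add, map_smul, map_sum, e1, e2, e3, Finset.sum_const_zero,
    Finset.sum_ite_eq', Finset.mem_univ, if_true, zero_add]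
  congr 1
  · split_ifs
    · rw [smul_neg, neg_smul]
    · simp
  · split_ifs <;> simp

theorem mode_b_freeConformalVector {m : ℤ} (hm : 0 ≤ m) (k : κ) :
    A.mode (b k) m (A.freeConformalVector φ ψ b c lam) = if m = 1 then b k else 0 := by
  have e1 : ∀ i, A.mode (b k) m (A.mode (b i) (-1) (c i))
      = if i = k then (if m = 1 then b k else 0) else 0 := fun i => by
    rw [h.bb, h.mode_b_c hm]
    by_cases h1 : i = k
    · subst h1
      by_cases h2 : m = 1 <;> simp [h2, A.mode_neg_one_vacuum]
    · simp [h1, Ne.symm h1]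
  have e2 : ∀ i, A.mode (b k) m (A.mode (φ i) (-2) (ψ i)) = 0 := fun i => by
    rw [← h.φb, h.mode_b_ψ hm, map_zero]
  have e3 : ∀ i, A.mode (b k) m (A.mode (ψ i) (-2) (φ i)) = 0 := fun i => by
    rw [← h.ψb, h.mode_b_φ hm, map_zero]
  simp only [freeConformalVector, map_add, map_smul, map_sum, e1, e2, e3, Finset.sum_const_zero,
    Finset.sum_ite_eq', Finset.mem_univ, if_true, smul_zero, add_zero]

/-- The commutator formula is applied to φ and ν, with just orders 0 and 1 present, and the sign is
then reversed. The order 0 term is a derivative of φ. -/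
theorem isPrimary_φ (k : ι) : A.IsPrimary (A.freeConformalVector φ ψ b c lam) lam (φ k) := by
  intro m n
  have hc := A.mode_commutator (h.φ_mem k) (h.freeConformalVector_mem lam) (N := 2)
    (fun j hj => by
      rw [h.mode_φ_freeConformalVector lam (Int.natCast_nonneg j), if_neg (by omega),
        if_neg (by omega), zero_smul, zero_smul, add_zero]) n m
  rw [mul_zero, zpow_zero, one_smul, Finset.sum_range_succ, Finset.sum_range_one,
    h.mode_φ_freeConformalVector lam (Int.natCast_nonneg _),
    h.mode_φ_freeConformalVector lam (Int.natCast_nonneg _)] at hc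
  have ht := A.mode_translationOperator (h.φ_mem k) (n + m)
  rw [translationOperator_apply] at ht
  simp only [Nat.cast_zero, Nat.cast_one, if_true, zero_ne_one, one_ne_zero, if_false, zero_smul,
    add_zero, zero_add, mode_smul, genChoose, sub_zero, ht] at hc
  rw [← neg_sub, hc, add_comm n m]
  push_cast
  module

theorem isPrimary_b (k : κ) : A.IsPrimary (A.freeConformalVector φ ψ b c lam) 1 (b k) := by
  intro m n
  have hc := A.mode_commutator (h.b_mem k) (h.freeConformalVector_mem lam) (N := 2)
    (fun j hj => by
      rw [h.mode_b_freeConformalVector lam (Int.natCast_nonneg j), if_neg (by omega)]) n m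
  rw [mul_zero, zpow_zero, one_smul, Finset.sum_range_succ, Finset.sum_range_one,
    h.mode_b_freeConformalVector lam (Int.natCast_nonneg _),
    h.mode_b_freeConformalVector lam (Int.natCast_nonneg _)] at hc
  simp only [Nat.cast_zero, Nat.cast_one, if_true, zero_ne_one, if_false, mode_zero, smul_zero,
    zero_add, genChoose] at hc
  rw [← neg_sub, hc, add_comm n m]
  module

theorem isPrimary_ψ (k : ι) :
    A.IsPrimary (A.freeConformalVector φ ψ b c lam) (1 - lam) (ψ k) := by
  rw [← h.freeConformalVector_swap]
  exact h.swap.isPrimary_φ (1 - lam) k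

theorem isPrimary_c (k : κ) : A.IsPrimary (A.freeConformalVector φ ψ b c lam) 1 (c k) := by
  rw [← h.freeConformalVector_swap]
  exact h.swap.isPrimary_b (1 - lam) k

/-- Primarity lets the mode of ν pass through φ_(-2) and then act on ψ. The mode products of ν with
itself are assembled from this and its bosonic analogue. -/
theorem mode_freeConformalVector_φψ {m : ℤ} (hm : 0 ≤ m) (i : ι) :
    A.mode (A.freeConformalVector φ ψ b c lam) m (A.mode (φ i) (-2) (ψ i))
      = ((lam - 1) * m + 2) • A.mode (φ i) (m - 3) (ψ i)
        + (-lam * m + 1) • A.mode (φ i) (-2) (A.mode (ψ i) (m - 2) A.vacuum) := by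
  rw [(h.isPrimary_φ lam i).mode_apply, (h.isPrimary_ψ lam i).mode_self hm, map_smul]
  have e : m + -2 - 1 = m - 3 := by ring
  rw [e]
  congr 2
  · push_cast; ring
  · ring

theorem mode_freeConformalVector_bc {m : ℤ} (hm : 0 ≤ m) (i : κ) :
    A.mode (A.freeConformalVector φ ψ b c lam) m (A.mode (b i) (-1) (c i))
      = A.mode (b i) (m - 2) (c i) + A.mode (b i) (-1) (A.mode (c i) (m - 2) A.vacuum) := by
  rw [(h.isPrimary_b lam i).mode_apply, (h.isPrimary_c lam i).mode_self hm]
  have e : m + -1 - 1 = m - 2 := by ring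
  rw [e, sub_self, zero_mul, zero_add, one_smul]
  rw [zero_sub, Int.cast_neg, Int.cast_one, neg_neg, one_smul]

theorem mode_freeConformalVector_φψ_one (i : ι) :
    A.mode (A.freeConformalVector φ ψ b c lam) 1 (A.mode (φ i) (-2) (ψ i))
      = (2 : ℂ) • A.mode (φ i) (-2) (ψ i) := by
  rw [h.mode_freeConformalVector_φψ lam zero_le_one]
  norm_num [A.mode_neg_one_vacuum]
  module

theorem mode_freeConformalVector_φψ_two (i : ι) :
    A.mode (A.freeConformalVector φ ψ b c lam) 2 (A.mode (φ i) (-2) (ψ i))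
      = (2 * lam) • A.mode (φ i) (-1) (ψ i) := by
  rw [h.mode_freeConformalVector_φψ lam zero_le_two, sub_self,
    A.mode_nonneg_vacuum (ψ i) (n := 0) le_rfl]
  norm_num
  congr 1
  ring

theorem mode_freeConformalVector_φψ_three (i : ι) :
    A.mode (A.freeConformalVector φ ψ b c lam) 3 (A.mode (φ i) (-2) (ψ i))
      = (3 * lam - 1) • A.vacuum := by
  rw [h.mode_freeConformalVector_φψ lam zero_le_three, sub_self, h.mode_φ_ψ le_rfl]
  norm_num [A.mode_nonneg_vacuum (ψ i) (n := 1) zero_le_one]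
  congr 1
  ring

theorem mode_freeConformalVector_φψ_of_le {m : ℤ} (hm : 4 ≤ m) (i : ι) :
    A.mode (A.freeConformalVector φ ψ b c lam) m (A.mode (φ i) (-2) (ψ i)) = 0 := by
  rw [h.mode_freeConformalVector_φψ lam (by omega), h.mode_φ_ψ (by omega), if_neg (by omega),
    A.mode_nonneg_vacuum (ψ i) (by omega), map_zero, smul_zero, smul_zero, add_zero]

theorem mode_φ_ψ_neg_one (i : ι) : A.mode (ψ i) (-1) (φ i) = -A.mode (φ i) (-1) (ψ i) := by
  have := h.φψ i i (-1) (-1) A.vacuum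
  rw [if_neg (by omega), A.mode_neg_one_vacuum, A.mode_neg_one_vacuum] at this
  exact eq_neg_of_add_eq_zero_right this

/-- The fermionic and bosonic free fields have a conformal vector. -/
theorem isConformal : A.IsConformal (A.freeConformalVector φ ψ b c lam)
    (2 * Fintype.card κ - 2 * (6 * lam ^ 2 - 6 * lam + 1) * Fintype.card ι) := by
  have hs := h.freeConformalVector_swap lam
  have t : ∀ (m : ℤ), A.mode (A.freeConformalVector φ ψ b c lam) m
      (A.freeConformalVector φ ψ b c lam)
      = ∑ i, A.mode (A.freeConformalVector φ ψ b c lam) m (A.mode (b i) (-1) (c i))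
        + ((1 - lam) • ∑ i,
            A.mode (A.freeConformalVector φ ψ b c lam) m (A.mode (φ i) (-2) (ψ i))
          + lam • ∑ i, A.mode (A.freeConformalVector φ ψ b c lam) m (A.mode (ψ i) (-2) (φ i))) := by
    intro m
    generalize A.mode (A.freeConformalVector φ ψ b c lam) m = L
    simp only [freeConformalVector, map_add, map_smul, map_sum]
  have s1 := h.swap.mode_freeConformalVector_φψ_one (1 - lam)
  have s2 := h.swap.mode_freeConformalVector_φψ_two (1 - lam)
  have s3 := h.swap.mode_freeConformalVector_φψ_three (1 - lam)
  have s4 := fun m hm => h.swap.mode_freeConformalVector_φψ_of_le (1 - lam) (m := m) hm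
  rw [hs] at s1 s2 s3 s4
  refine isConformal_of_primary (x := Sum.elim (Sum.elim φ ψ) (Sum.elim b c)) h.generates
    (Δ := Sum.elim (Sum.elim (fun _ => lam) (fun _ => 1 - lam))
      (Sum.elim (fun _ => 1) (fun _ => 1)))
    (h.freeConformalVector_mem lam) ?_ ?_ ?_ ?_ ?_
  · rintro ((i | i) | (i | i))
    · exact h.isPrimary_φ lam i
    · exact h.isPrimary_ψ lam i
    · exact h.isPrimary_b lam i
    · exact h.isPrimary_c lam i
  · have e1 : ∀ i, A.mode (A.freeConformalVector φ ψ b c lam) 1 (A.mode (b i) (-1) (c i))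
        = (2 : ℂ) • A.mode (b i) (-1) (c i) := fun i => by
      rw [h.mode_freeConformalVector_bc lam zero_le_one]
      norm_num [A.mode_neg_one_vacuum]
      module
    rw [t]
    simp only [e1, s1, h.mode_freeConformalVector_φψ_one, ← Finset.smul_sum]
    conv_rhs => rw [freeConformalVector]
    module
  -- The two fermionic parts carry the same coefficient 2λ(1-λ) and cancel because ψ_(-1)φ =
  -- -φ_(-1)ψ.
  · have e1 : ∀ i, A.mode (A.freeConformalVector φ ψ b c lam) 2 (A.mode (b i) (-1) (c i))
        = 0 := fun i => by
      rw [h.mode_freeConformalVector_bc lam zero_le_two, sub_self, h.mode_b_c le_rfl,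
        A.mode_nonneg_vacuum (c i) (n := 0) le_rfl]
      simp
    rw [t]
    simp only [e1, s2, h.mode_freeConformalVector_φψ_two, ← Finset.smul_sum,
      h.mode_φ_ψ_neg_one, Finset.sum_neg_distrib, Finset.sum_const_zero]
    module
  -- This is the central term: each boson pair gives 1, and each fermion pair gives (1-λ)(3λ-1) +
  -- λ(2-3λ) = -(6λ²-6λ+1).
  · have e1 : ∀ i, A.mode (A.freeConformalVector φ ψ b c lam) 3 (A.mode (b i) (-1) (c i))
        = A.vacuum := fun i => by
      rw [h.mode_freeConformalVector_bc lam zero_le_three, h.mode_b_c (by norm_num)]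
      norm_num [A.mode_nonneg_vacuum (c i) (n := 1) zero_le_one]
    rw [t]
    simp only [e1, s3, h.mode_freeConformalVector_φψ_three, Finset.sum_const, Finset.card_univ,
      ← Nat.cast_smul_eq_nsmul ℂ]
    module
  · intro j hj
    have hj' : (4 : ℤ) ≤ j := by exact_mod_cast hj
    have e1 : ∀ i, A.mode (A.freeConformalVector φ ψ b c lam) j (A.mode (b i) (-1) (c i))
        = 0 := fun i => by
      rw [h.mode_freeConformalVector_bc lam (by omega), h.mode_b_c (by omega), if_neg (by omega),
        A.mode_nonneg_vacuum (c i) (by omega)]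
      simp
    rw [t]
    simp only [e1, s4 _ hj', h.mode_freeConformalVector_φψ_of_le lam hj', Finset.sum_const_zero,
      smul_zero, add_zero]

end Conformal

end FreeFields
end VertexAlgebra

namespace VertexAlgebra

variable {V : Type*} [AddCommGroup V] [Module ℂ V]

/-! ### The `N = 2` superconformal structure -/

/-- The supercurrent `∑ ψ^i_(-1) b^i`. -/
def superCurrent {ι : Type*} [Fintype ι] (A : VertexAlgebra V) (ψ b : ι → V) : V :=
  ∑ i, A.mode (ψ i) (-1) (b i)

/-- The current `∑ ψ^i_(-1) φ^i`. -/
def freeCurrent {ι : Type*} [Fintype ι] (A : VertexAlgebra V) (φ ψ : ι → V) : V :=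
  ∑ i, A.mode (ψ i) (-1) (φ i)

/-- Expands the current in the argument only, leaving intact its occurrence inside the operator L.
-/
theorem map_superCurrent {ι : Type*} [Fintype ι] (A : VertexAlgebra V) (ψ b : ι → V)
    (L : Module.End ℂ V) : L (A.superCurrent ψ b) = ∑ i, L (A.mode (ψ i) (-1) (b i)) :=
  map_sum L _ _

theorem map_freeCurrent {ι : Type*} [Fintype ι] (A : VertexAlgebra V) (φ ψ : ι → V)
    (L : Module.End ℂ V) : L (A.freeCurrent φ ψ) = ∑ i, L (A.mode (ψ i) (-1) (φ i)) :=
  map_sum L _ _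

/-- Only the mixed relation between τ⁻ and τ⁺ is quadratic with a nonzero right side, so the scaling
is absorbed in κ as s². -/
theorem IsN2Superconformal.rescale {A : VertexAlgebra V} {κ c : ℂ} {ν τp τm j : V}
    (h : A.IsN2Superconformal κ c ν τp τm j) (s : ℂ) :
    A.IsN2Superconformal (s ^ 2 * κ) c ν (s • τp) (s • τm) j where
  conformal := h.conformal
  τp_odd := Submodule.smul_mem _ _ h.τp_odd
  τm_odd := Submodule.smul_mem _ _ h.τm_odd
  j_even := h.j_even
  gm_gp m n := by
    simp only [mode_smul, smul_mul_smul_comm]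
    rw [← smul_add, h.gm_gp, smul_smul, pow_two s]
  gp_gp m n := by
    simp only [mode_smul, smul_mul_smul_comm]
    rw [← smul_add, h.gp_gp, smul_zero]
  gm_gm m n := by
    simp only [mode_smul, smul_mul_smul_comm]
    rw [← smul_add, h.gm_gm, smul_zero]
  l_gp m n := by
    simp only [mode_smul, mul_smul_comm, smul_mul_assoc]
    rw [← smul_sub, h.l_gp, smul_comm]
  l_gm m n := by
    simp only [mode_smul, mul_smul_comm, smul_mul_assoc]
    rw [← smul_sub, h.l_gm, smul_comm]
  l_j := h.l_j
  j_j := h.j_j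
  j_gp m n := by
    simp only [mode_smul, mul_smul_comm, smul_mul_assoc]
    rw [← smul_sub, h.j_gp]
  j_gm m n := by
    simp only [mode_smul, mul_smul_comm, smul_mul_assoc]
    rw [← smul_sub, h.j_gm, smul_neg]

namespace FreeFields

variable {ι : Type*} [DecidableEq ι] [Fintype ι] {A : VertexAlgebra V} {d : ℤ} {φ ψ b c : ι → V}
  (h : FreeFields A d φ ψ b c)

include h

theorem superCurrent_mem : A.superCurrent ψ b ∈ A.grading (-d) :=
  Submodule.sum_mem _ fun i _ => by
    simpa using A.mode_mem_grading (h.ψ_mem i) (h.b_mem i) (-1)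

theorem freeCurrent_mem : A.freeCurrent φ ψ ∈ A.grading 0 :=
  Submodule.sum_mem _ fun i _ => by
    simpa using A.mode_mem_grading (h.ψ_mem i) (h.φ_mem i) (-1)

theorem freeCurrent_swap : A.freeCurrent ψ φ = -A.freeCurrent φ ψ := by
  simp only [freeCurrent, ← h.swap.mode_φ_ψ_neg_one, ← Finset.sum_neg_distrib]

/-! #### Commutators of the free fields with the currents -/

theorem sign_odd : ((-1 : ℂ) ^ (d * -d)) = -1 := by
  exact (h.odd.mul h.odd.neg).neg_one_zpow

theorem sign_odd' : ((-1 : ℂ) ^ (d * d)) = -1 := by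
  exact (h.odd.mul h.odd).neg_one_zpow

/-- Commutators of a generator with a composite come from their nonnegative products; here only
order 0 survives, and it replaces ψ^k by b^k. -/
theorem φ_superCurrent (k : ι) (m n : ℤ) (v : V) :
    A.mode (φ k) m (A.mode (A.superCurrent ψ b) n v)
      + A.mode (A.superCurrent ψ b) n (A.mode (φ k) m v) = A.mode (b k) (m + n) v := by
  have e : ∀ {m : ℤ}, 0 ≤ m → A.mode (φ k) m (A.superCurrent ψ b)
      = if m = 0 then b k else 0 := by
    intro m hm
    have e1 : ∀ i, A.mode (φ k) m (A.mode (ψ i) (-1) (b i))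
        = if i = k then (if m = 0 then b k else 0) else 0 := fun i => by
      rw [eq_sub_of_add_eq (h.φψ k i m (-1) (b i)), h.mode_φ_b hm, map_zero, sub_zero]
      have e : m + -1 = -1 ↔ m = 0 := by omega
      by_cases h1 : i = k
      · subst h1
        by_cases h2 : m = 0 <;> simp [e, h2]
      · simp [h1, Ne.symm h1]
    simp only [superCurrent, map_sum, e1, Finset.sum_ite_eq', Finset.mem_univ, if_true]
  have hc := A.mode_commutator (h.φ_mem k) h.superCurrent_mem (N := 1)
    (fun j hj => by rw [e (Int.natCast_nonneg j), if_neg (by omega)]) m n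
  rw [h.sign_odd, Finset.sum_range_one, e (Int.natCast_nonneg _), neg_one_smul,
    sub_neg_eq_add] at hc
  simpa [genChoose] using congrArg (fun F => F v) hc

theorem ψ_superCurrent (k : ι) (m n : ℤ) (v : V) :
    A.mode (ψ k) m (A.mode (A.superCurrent ψ b) n v)
      + A.mode (A.superCurrent ψ b) n (A.mode (ψ k) m v) = 0 := by
  have e : ∀ {m : ℤ}, 0 ≤ m → A.mode (ψ k) m (A.superCurrent ψ b) = 0 := by
    intro m hm
    simp only [superCurrent, map_sum]
    refine Finset.sum_eq_zero fun i _ => ?_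
    rw [eq_neg_of_add_eq_zero_left (h.ψψ k i m (-1) (b i)), h.swap.mode_φ_c hm, map_zero, neg_zero]
  have hc := A.mode_commutator (h.ψ_mem k) h.superCurrent_mem (N := 0)
    (fun j hj => e (Int.natCast_nonneg j)) m n
  rw [neg_mul_neg, h.sign_odd', Finset.sum_range_zero, neg_one_smul, sub_neg_eq_add] at hc
  simpa using congrArg (fun F => F v) hc

theorem b_superCurrent (k : ι) (m n : ℤ) (v : V) :
    A.mode (b k) m (A.mode (A.superCurrent ψ b) n v)
      = A.mode (A.superCurrent ψ b) n (A.mode (b k) m v) := by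
  have e : ∀ {m : ℤ}, 0 ≤ m → A.mode (b k) m (A.superCurrent ψ b) = 0 := by
    intro m hm
    simp only [superCurrent, map_sum]
    refine Finset.sum_eq_zero fun i _ => ?_
    rw [← h.ψb, h.mode_b_b hm, map_zero]
  have hc := A.mode_commutator (h.b_mem k) h.superCurrent_mem (N := 0)
    (fun j hj => e (Int.natCast_nonneg j)) m n
  rw [zero_mul, zpow_zero, one_smul, Finset.sum_range_zero, sub_eq_zero] at hc
  exact congrArg (fun F => F v) hc

theorem c_superCurrent (k : ι) (m n : ℤ) (v : V) :
    A.mode (c k) m (A.mode (A.superCurrent ψ b) n v)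
      - A.mode (A.superCurrent ψ b) n (A.mode (c k) m v)
      = (m : ℂ) • A.mode (ψ k) (m + n - 1) v := by
  have e : ∀ {m : ℤ}, 0 ≤ m → A.mode (c k) m (A.superCurrent ψ b)
      = if m = 1 then ψ k else 0 := by
    intro m hm
    have e1 : ∀ i, A.mode (c k) m (A.mode (ψ i) (-1) (b i))
        = if i = k then (if m = 1 then ψ k else 0) else 0 := fun i => by
      rw [← h.ψc, h.swap.mode_b_c hm]
      by_cases h1 : i = k
      · subst h1
        by_cases h2 : m = 1 <;> simp [h2, A.mode_neg_one_vacuum]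
      · simp [h1, Ne.symm h1]
    simp only [superCurrent, map_sum, e1, Finset.sum_ite_eq', Finset.mem_univ, if_true]
  have hc := A.mode_commutator (h.c_mem k) h.superCurrent_mem (N := 2)
    (fun j hj => by rw [e (Int.natCast_nonneg j), if_neg (by omega)]) m n
  rw [zero_mul, zpow_zero, one_smul, Finset.sum_range_succ, Finset.sum_range_one,
    e (Int.natCast_nonneg _), e (Int.natCast_nonneg _)] at hc
  simpa [genChoose, mode_zero] using congrArg (fun F => F v) hc

theorem ψ_freeCurrent (k : ι) (m n : ℤ) (v : V) :
    A.mode (A.freeCurrent φ ψ) n (A.mode (ψ k) m v)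
      = A.mode (ψ k) (m + n) v + A.mode (ψ k) m (A.mode (A.freeCurrent φ ψ) n v) := by
  have e : ∀ {m : ℤ}, 0 ≤ m → A.mode (ψ k) m (A.freeCurrent φ ψ)
      = if m = 0 then -ψ k else 0 := by
    intro m hm
    have e1 : ∀ i, A.mode (ψ k) m (A.mode (ψ i) (-1) (φ i))
        = if i = k then (if m = 0 then -ψ k else 0) else 0 := fun i => by
      rw [eq_neg_of_add_eq_zero_left (h.ψψ k i m (-1) (φ i)), h.swap.mode_φ_ψ hm]
      by_cases h1 : i = k
      · subst h1
        by_cases h2 : m = 0 <;> simp [h2, A.mode_neg_one_vacuum]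
      · simp [h1, Ne.symm h1]
    simp only [freeCurrent, map_sum, e1, Finset.sum_ite_eq', Finset.mem_univ, if_true]
  have hc := A.mode_commutator (h.ψ_mem k) h.freeCurrent_mem (N := 1)
    (fun j hj => by rw [e (Int.natCast_nonneg j), if_neg (by omega)]) m n
  rw [mul_zero, zpow_zero, one_smul, Finset.sum_range_one, e (Int.natCast_nonneg _)] at hc
  have hv := congrArg (fun F => F v) hc
  simp only [Nat.cast_zero, if_true, genChoose, one_smul, sub_zero, mode_neg, LinearMap.sub_apply,
    Module.End.mul_apply, LinearMap.neg_apply] at hv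
  rw [← sub_eq_iff_eq_add, ← neg_sub, hv, neg_neg]

/-- The swap changes the sign of the current, which turns the charge of ψ into that of φ. -/
theorem φ_freeCurrent (k : ι) (m n : ℤ) (v : V) :
    A.mode (A.freeCurrent φ ψ) n (A.mode (φ k) m v)
      = -A.mode (φ k) (m + n) v + A.mode (φ k) m (A.mode (A.freeCurrent φ ψ) n v) := by
  have := h.swap.ψ_freeCurrent k m n v
  rw [h.freeCurrent_swap, mode_neg, LinearMap.neg_apply, LinearMap.neg_apply, map_neg] at this
  rw [← neg_inj, this]
  abel

theorem b_freeCurrent (k : ι) (m n : ℤ) (v : V) :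
    A.mode (A.freeCurrent φ ψ) n (A.mode (b k) m v)
      = A.mode (b k) m (A.mode (A.freeCurrent φ ψ) n v) := by
  have e : ∀ {m : ℤ}, 0 ≤ m → A.mode (b k) m (A.freeCurrent φ ψ) = 0 := by
    intro m hm
    simp only [freeCurrent, map_sum]
    refine Finset.sum_eq_zero fun i _ => ?_
    rw [← h.ψb, h.mode_b_φ hm, map_zero]
  have hc := A.mode_commutator (h.b_mem k) h.freeCurrent_mem (N := 0)
    (fun j hj => e (Int.natCast_nonneg j)) m n
  rw [zero_mul, zpow_zero, one_smul, Finset.sum_range_zero, sub_eq_zero] at hc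
  exact (congrArg (fun F => F v) hc).symm

/-! #### Commutators of the currents -/

theorem superCurrent_superCurrent (m n : ℤ) :
    A.mode (A.superCurrent ψ b) m * A.mode (A.superCurrent ψ b) n
      + A.mode (A.superCurrent ψ b) n * A.mode (A.superCurrent ψ b) m = 0 := by
  have e : ∀ j : ℕ, 0 ≤ j → A.mode (A.superCurrent ψ b) j (A.superCurrent ψ b) = 0 := by
    intro j _
    rw [A.map_superCurrent]
    refine Finset.sum_eq_zero fun i _ => ?_
    have h1 := h.b_superCurrent i (-1) j A.vacuum
    rw [A.mode_neg_one_vacuum, A.mode_nonneg_vacuum _ (Int.natCast_nonneg j), map_zero] at h1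
    rw [eq_neg_of_add_eq_zero_right (h.ψ_superCurrent i (-1) j (b i)), ← h1, map_zero, neg_zero]
  have hc := A.mode_commutator h.superCurrent_mem h.superCurrent_mem (N := 0) e m n
  rwa [neg_mul_neg, h.sign_odd', Finset.sum_range_zero, neg_one_smul, sub_neg_eq_add] at hc

/-- The current commutes with the bosons and gives ψ charge 1, so the order 0 product returns the
supercurrent and the higher ones vanish. -/
theorem freeCurrent_superCurrent (m n : ℤ) :
    A.mode (A.freeCurrent φ ψ) m * A.mode (A.superCurrent ψ b) n
      - A.mode (A.superCurrent ψ b) n * A.mode (A.freeCurrent φ ψ) m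
      = A.mode (A.superCurrent ψ b) (m + n) := by
  have e : ∀ j : ℕ, A.mode (A.freeCurrent φ ψ) j (A.superCurrent ψ b)
      = if j = 0 then A.superCurrent ψ b else 0 := by
    intro j
    have e1 : ∀ i, A.mode (A.freeCurrent φ ψ) j (A.mode (ψ i) (-1) (b i))
        = if j = 0 then A.mode (ψ i) (-1) (b i) else 0 := fun i => by
      have h1 := h.b_freeCurrent i (-1) j A.vacuum
      rw [A.mode_neg_one_vacuum, A.mode_nonneg_vacuum _ (Int.natCast_nonneg j), map_zero] at h1
      rw [h.ψ_freeCurrent, h1, map_zero, add_zero]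
      split_ifs with h2
      · rw [h2, Nat.cast_zero, add_zero]
      · rw [h.swap.mode_φ_c (by omega)]
    simp only [superCurrent, map_sum, e1]
    split_ifs <;> simp
  have hc := A.mode_commutator h.freeCurrent_mem h.superCurrent_mem (N := 1)
    (fun j hj => by rw [e, if_neg (by omega)]) m n
  rw [zero_mul, zpow_zero, one_smul, Finset.sum_range_one, e] at hc
  simpa [genChoose] using hc

theorem freeCurrent_freeCurrent (m n : ℤ) :
    A.mode (A.freeCurrent φ ψ) m * A.mode (A.freeCurrent φ ψ) n
      - A.mode (A.freeCurrent φ ψ) n * A.mode (A.freeCurrent φ ψ) m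
      = (if m + n = 0 then (Fintype.card ι : ℂ) * m else 0) • (1 : Module.End ℂ V) := by
  have e : ∀ j : ℕ, A.mode (A.freeCurrent φ ψ) j (A.freeCurrent φ ψ)
      = if j = 1 then (Fintype.card ι : ℂ) • A.vacuum else 0 := by
    intro j
    have e1 : ∀ i, A.mode (A.freeCurrent φ ψ) j (A.mode (ψ i) (-1) (φ i))
        = if j = 1 then A.vacuum else 0 := fun i => by
      have h1 := h.φ_freeCurrent i (-1) j A.vacuum
      rw [A.mode_neg_one_vacuum, A.mode_nonneg_vacuum _ (Int.natCast_nonneg j), map_zero,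
        add_zero] at h1
      rw [h.ψ_freeCurrent, h1, map_neg]
      rcases Nat.eq_zero_or_pos j with h2 | h2
      · subst h2
        simp [A.mode_neg_one_vacuum]
      · rw [A.mode_nonneg_vacuum (φ i) (by omega), map_zero, neg_zero, add_zero,
          h.swap.mode_φ_ψ (by omega)]
        have e2 : (-1 + (j : ℤ) = 0) ↔ j = 1 := by omega
        simp only [e2, true_and]
    rw [A.map_freeCurrent]
    simp only [e1]
    split_ifs
    · rw [Finset.sum_const, Finset.card_univ, Nat.cast_smul_eq_nsmul]
    · simp
  have hc := A.mode_commutator h.freeCurrent_mem h.freeCurrent_mem (N := 2)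
    (fun j hj => by rw [e, if_neg (by omega)]) m n
  rw [zero_mul, zpow_zero, one_smul, Finset.sum_range_succ, Finset.sum_range_one, e, e,
    if_neg (by norm_num), if_pos rfl, mode_zero, smul_zero, zero_add, mode_smul,
    vacuum_mode_eq] at hc
  have e3 : (m + n - ((1 : ℕ) : ℤ) = -1) ↔ m + n = 0 := by omega
  simp only [e3] at hc
  rw [hc]
  split_ifs
  · simp only [genChoose, smul_smul]
    congr 1
    push_cast
    ring
  · simp

/-- `∑ φ^i_(-1) c^i` times `∑ ψ^i_(-1) b^i`. -/
theorem mode_superCurrent_superCurrent (j : ℕ) :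
    A.mode (A.superCurrent φ c) j (A.superCurrent ψ b)
      = ∑ i, (A.mode (c i) (j - 1) (b i)
        - A.mode (ψ i) (-1) (A.mode (φ i) (j - 2) A.vacuum)) := by
  rw [A.map_superCurrent]
  refine Finset.sum_congr rfl fun i _ => ?_
  have h1 := h.swap.c_superCurrent i (-1) j A.vacuum
  have e1 : (-1 : ℤ) + j - 1 = j - 2 := by ring
  have e2 : (-1 : ℤ) + j = j - 1 := by ring
  rw [A.mode_neg_one_vacuum, A.mode_nonneg_vacuum _ (Int.natCast_nonneg j), map_zero, zero_sub,
    e1, Int.cast_neg, Int.cast_one, neg_one_smul, neg_inj] at h1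
  rw [eq_sub_of_add_eq' (h.swap.φ_superCurrent i (-1) j (b i)), h1, e2]

/-- The order 0 product is ∑(b_(-1)c + φ_(-2)ψ), with all its fermionic weight on one ordering.
Symmetrising it to λ = 1/2 costs half of Tj, since T(ψ_(-1)φ) = ψ_(-2)φ - φ_(-2)ψ. -/
theorem translationOperator_freeCurrent :
    A.mode (A.superCurrent φ c) 0 (A.superCurrent ψ b)
      = A.freeConformalVector φ ψ b c (1 / 2)
        - (1 / 2 : ℂ) • A.translationOperator (A.freeCurrent φ ψ) := by
  have h0 := h.mode_superCurrent_superCurrent 0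
  rw [Nat.cast_zero] at h0
  have e1 : ∀ i, A.translationOperator (A.mode (ψ i) (-1) (φ i))
      = A.mode (ψ i) (-2) (φ i) - A.mode (φ i) (-2) (ψ i) := fun i => by
    have h1 := A.translation_mode (ψ i) (-1) (φ i)
    have h2 := h.φψ i i (-2) (-1) A.vacuum
    rw [A.mode_neg_one_vacuum, if_neg (by omega)] at h2
    rw [sub_eq_iff_eq_add, translationOperator_apply _ (φ i)] at h1
    rw [h1, eq_neg_of_add_eq_zero_right h2]
    norm_num
    abel
  have e2 : ∀ i, A.mode (c i) (0 - 1) (b i) - A.mode (ψ i) (-1) (A.mode (φ i) (0 - 2) A.vacuum)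
      = A.mode (b i) (-1) (c i) + A.mode (φ i) (-2) (ψ i) := fun i => by
    have h2 := h.φψ i i (-2) (-1) A.vacuum
    rw [A.mode_neg_one_vacuum, if_neg (by omega)] at h2
    rw [zero_sub, zero_sub, h.mode_c_b_neg_one, eq_neg_of_add_eq_zero_left h2, sub_eq_add_neg]
  rw [h0, A.map_freeCurrent, freeConformalVector]
  simp only [e1, e2, Finset.sum_add_distrib, Finset.sum_sub_distrib]
  module

/-- The products of orders 0, 1, 2 are ν - ½Tj, -j and a multiple of the vacuum. The coefficient of
the current is ½(m+n) - m, because (Tj)_(m+n) = -(m+n) j_(m+n-1). -/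
theorem superCurrent_superCurrent' (m n : ℤ) :
    A.mode (A.superCurrent φ c) m * A.mode (A.superCurrent ψ b) n
      + A.mode (A.superCurrent ψ b) n * A.mode (A.superCurrent φ c) m
      = A.mode (A.freeConformalVector φ ψ b c (1 / 2)) (m + n)
        - (((m : ℂ) - n) / 2) • A.mode (A.freeCurrent φ ψ) (m + n - 1)
        + (if m + n = 1 then (Fintype.card ι : ℂ) * (m * (m - 1) / 2) else 0) •
          (1 : Module.End ℂ V) := by
  have e0 := h.translationOperator_freeCurrent
  have e1 : A.mode (A.superCurrent φ c) 1 (A.superCurrent ψ b) = -A.freeCurrent φ ψ := by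
    have h0 := h.mode_superCurrent_superCurrent 1
    rw [Nat.cast_one] at h0
    rw [h0, freeCurrent, ← Finset.sum_neg_distrib]
    refine Finset.sum_congr rfl fun i _ => ?_
    rw [h.swap.mode_b_c (by norm_num), if_neg (by norm_num)]
    norm_num [A.mode_neg_one_vacuum]
  have e2 : A.mode (A.superCurrent φ c) 2 (A.superCurrent ψ b)
      = (Fintype.card ι : ℂ) • A.vacuum := by
    have h0 := h.mode_superCurrent_superCurrent 2
    rw [Nat.cast_ofNat] at h0
    rw [h0, Nat.cast_smul_eq_nsmul, ← Finset.card_univ, ← Finset.sum_const]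
    refine Finset.sum_congr rfl fun i _ => ?_
    rw [h.swap.mode_b_c (by norm_num), if_pos (by norm_num), sub_self,
      A.mode_nonneg_vacuum _ le_rfl, map_zero, sub_zero]
  have hc := A.mode_commutator h.swap.superCurrent_mem h.superCurrent_mem (N := 3)
    (fun j hj => by
      rw [h.mode_superCurrent_superCurrent]
      refine Finset.sum_eq_zero fun i _ => ?_
      rw [h.swap.mode_b_c (by omega), if_neg (by omega),
        A.mode_nonneg_vacuum _ (by omega), map_zero, sub_zero]) m n
  rw [neg_neg, h.sign_odd, neg_one_smul, sub_neg_eq_add] at hc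
  rw [hc]
  simp only [Finset.sum_range_succ, Finset.sum_range_zero, zero_add]
  rw [Nat.cast_zero, Nat.cast_one, Nat.cast_ofNat, e0, e1, e2, sub_eq_add_neg, mode_add, mode_neg,
    mode_smul, mode_neg, mode_smul, A.mode_translationOperator h.freeCurrent_mem, vacuum_mode_eq]
  have e3 : (m + n - 2 = -1) ↔ m + n = 1 := by omega
  simp only [e3, sub_zero, genChoose]
  split_ifs
  · push_cast
    module
  · push_cast
    module

/-! ### Primarity of the currents -/

section Primary

variable (hT : ∀ a, A.mode (A.freeConformalVector φ ψ b c (1 / 2)) 0 a = A.translationOperator a)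

include hT

/-- The modes of ν act on ψ_(-1)b through two primary fields, of weights 1/2 and 1, so the weights
add; `hT` supplies the order 0 product. -/
theorem isPrimary_superCurrent :
    A.IsPrimary (A.freeConformalVector φ ψ b c (1 / 2)) (3 / 2) (A.superCurrent ψ b) := by
  have e : ∀ {m : ℤ}, 0 ≤ m → ∀ i,
      A.mode (A.freeConformalVector φ ψ b c (1 / 2)) m (A.mode (ψ i) (-1) (b i))
      = (1 - (m : ℂ) / 2) • A.mode (ψ i) (m - 2) (b i)
        + A.mode (ψ i) (-1) (A.mode (b i) (m - 2) A.vacuum) := by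
    intro m hm i
    have e1 : m + -1 - 1 = m - 2 := by ring
    rw [(h.isPrimary_ψ (1 / 2) i).mode_apply, (h.isPrimary_b (1 / 2) i).mode_self hm, sub_self,
      zero_mul, zero_add, one_smul, e1]
    congr 2
    push_cast
    ring
  refine isPrimary_of_mode (h.freeConformalVector_mem _) h.superCurrent_mem (hT _) ?_ ?_
  · rw [A.map_superCurrent, superCurrent, Finset.smul_sum]
    refine Finset.sum_congr rfl fun i _ => ?_
    rw [e zero_le_one]
    norm_num [A.mode_neg_one_vacuum]
    module
  · intro j hj
    rw [A.map_superCurrent]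
    refine Finset.sum_eq_zero fun i _ => ?_
    rw [e (Int.natCast_nonneg j), h.swap.mode_φ_c (by omega),
      A.mode_nonneg_vacuum _ (by omega), map_zero, smul_zero, add_zero]

theorem isPrimary_freeCurrent :
    A.IsPrimary (A.freeConformalVector φ ψ b c (1 / 2)) 1 (A.freeCurrent φ ψ) := by
  have e : ∀ {m : ℤ}, 0 ≤ m → ∀ i,
      A.mode (A.freeConformalVector φ ψ b c (1 / 2)) m (A.mode (ψ i) (-1) (φ i))
      = (1 - (m : ℂ) / 2) • (A.mode (ψ i) (m - 2) (φ i)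
        + A.mode (ψ i) (-1) (A.mode (φ i) (m - 2) A.vacuum)) := by
    intro m hm i
    have e1 : m + -1 - 1 = m - 2 := by ring
    rw [(h.isPrimary_ψ (1 / 2) i).mode_apply, (h.isPrimary_φ (1 / 2) i).mode_self hm, map_smul,
      e1, smul_add]
    congr 2
    · push_cast
      ring
    · ring
  refine isPrimary_of_mode (h.freeConformalVector_mem _) h.freeCurrent_mem (hT _) ?_ ?_
  · rw [A.map_freeCurrent, freeCurrent, Finset.smul_sum]
    refine Finset.sum_congr rfl fun i _ => ?_
    rw [e zero_le_one]
    norm_num [A.mode_neg_one_vacuum]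
    module
  · intro j hj
    rw [A.map_freeCurrent]
    refine Finset.sum_eq_zero fun i _ => ?_
    rw [e (Int.natCast_nonneg j)]
    -- In order 2 a multiple of the vacuum could appear. Its coefficient 1 - m/2 vanishes because λ
    -- = 1/2.
    rcases hj.eq_or_lt with rfl | hj
    · norm_num
    · rw [h.swap.mode_φ_ψ (by omega), if_neg (by omega), A.mode_nonneg_vacuum _ (by omega),
        map_zero, add_zero, smul_zero]

end Primary

theorem mem_oddPart {p : ℤ} (hp : Odd p) {v : V} (hv : v ∈ A.grading p) : v ∈ A.oddPart :=
  Submodule.mem_iSup_of_mem p (Submodule.mem_iSup_of_mem hp hv)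

/-- The free fields with as many fermions as bosons carry an `N = 2` superconformal structure. -/
theorem isN2Superconformal :
    A.IsN2Superconformal (1 / 2) (3 * Fintype.card ι) (A.freeConformalVector φ ψ b c (1 / 2))
      (A.superCurrent ψ b) (A.superCurrent φ c) (A.freeCurrent φ ψ) := by
  -- At λ = 1/2 the factor 6λ²-6λ+1 equals -1/2, so each index contributes 2 from bosons and 1 from
  -- fermions.
  have hconf : A.IsConformal (A.freeConformalVector φ ψ b c (1 / 2)) (3 * Fintype.card ι) := by
    have := h.isConformal (1 / 2)
    convert this using 1
    ring
  have hT := hconf.translation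
  -- λ = 1/2 is fixed by λ ↦ 1 - λ, so the swapped system has the same conformal vector and gives
  -- the relations for τ⁻.
  have hs : A.freeConformalVector ψ φ c b (1 / 2) = A.freeConformalVector φ ψ b c (1 / 2) := by
    have := h.freeConformalVector_swap (1 / 2)
    norm_num at this ⊢
    exact this
  have h3 : (3 * (Fintype.card ι : ℂ)) / 3 = Fintype.card ι := by
    field_simp
  refine ⟨hconf, mem_oddPart h h.odd.neg h.superCurrent_mem, mem_oddPart h h.odd ?_, ?_, ?_, ?_,
    ?_, ?_, ?_, ?_, ?_, ?_, ?_⟩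
  · simpa using h.swap.superCurrent_mem
  · exact Submodule.mem_iSup_of_mem 0 (Submodule.mem_iSup_of_mem Even.zero h.freeCurrent_mem)
  · intro m n
    rw [h.superCurrent_superCurrent', h3]
    have e1 : m + 1 + (n + 1) = m + n + 1 + 1 := by ring
    have e2 : m + 1 + (n + 1) - 1 = m + n + 1 := by ring
    have e3 : m + n + 1 + 1 = 1 ↔ m + n + 1 = 0 := by omega
    rw [e2, e1]
    simp only [e3]
    split_ifs
    · push_cast
      module
    · push_cast
      module
  · intro m n
    exact h.superCurrent_superCurrent _ _
  · intro m n
    exact h.swap.superCurrent_superCurrent _ _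
  · intro m n
    rw [h.isPrimary_superCurrent hT (m + 1) (n + 1)]
    have e : m + 1 + (n + 1) - 1 = m + n + 1 := by ring
    rw [e]
    congr 1
    push_cast
    ring
  · intro m n
    have h1 := h.swap.isPrimary_superCurrent (by rw [hs]; exact hT)
    rw [hs] at h1
    rw [h1 (m + 1) (n + 1)]
    have e : m + 1 + (n + 1) - 1 = m + n + 1 := by ring
    rw [e]
    congr 1
    push_cast
    ring
  · intro m n
    rw [h.isPrimary_freeCurrent hT (m + 1) n]
    have e : m + 1 + n - 1 = m + n := by ring
    rw [e]
    congr 1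
    push_cast
    ring
  · intro m n
    rw [h.freeCurrent_freeCurrent, h3]
  · intro m n
    rw [h.freeCurrent_superCurrent, add_assoc]
  · intro m n
    -- The swap exchanges the supercurrents and negates the current, hence the charge -1.
    have h1 := h.swap.freeCurrent_superCurrent m (n + 1)
    rw [h.freeCurrent_swap, mode_neg] at h1
    rw [add_assoc, ← h1, neg_mul, mul_neg]
    abel

end FreeFields

end VertexAlgebra

/-! ### Derivations of exterior and symmetric algebras -/

section Derivations

open TrivSqZeroExt

variable {M : Type*} [AddCommGroup M] [Module ℂ M]

/-- The derivation of the exterior algebra that extends `L`. -/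
def exteriorDerivation (L : Module.End ℂ M) : Module.End ℂ (ExteriorAlgebra ℂ M) :=
  (sndHom (ExteriorAlgebra ℂ M) (ExteriorAlgebra ℂ M)).restrictScalars ℂ ∘ₗ
    (ExteriorAlgebra.lift ℂ (A := TrivSqZeroExt (ExteriorAlgebra ℂ M) (ExteriorAlgebra ℂ M))
      ⟨(inlAlgHom ℂ (ExteriorAlgebra ℂ M) (ExteriorAlgebra ℂ M)).toLinearMap ∘ₗ ExteriorAlgebra.ι ℂ
        + (inrHom (ExteriorAlgebra ℂ M) (ExteriorAlgebra ℂ M)).restrictScalars ℂ ∘ₗ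
          ExteriorAlgebra.ι ℂ ∘ₗ L, fun m => by
        ext
        · simp
        · simp [ExteriorAlgebra.ι_add_mul_swap]⟩).toLinearMap

@[simp]
theorem exteriorDerivation_one (L : Module.End ℂ M) : exteriorDerivation L 1 = 0 := by
  simp [exteriorDerivation]

theorem exteriorDerivation_algebraMap (L : Module.End ℂ M) (r : ℂ) :
    exteriorDerivation L (algebraMap ℂ _ r) = 0 := by
  rw [Algebra.algebraMap_eq_smul_one, map_smul, exteriorDerivation_one, smul_zero]

/-- An algebra map into a square-zero extension whose first component is the identity has a second
component obeying the Leibniz rule. -/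
theorem exteriorDerivation_ι_mul (L : Module.End ℂ M) (m : M) (x : ExteriorAlgebra ℂ M) :
    exteriorDerivation L (ExteriorAlgebra.ι ℂ m * x)
      = ExteriorAlgebra.ι ℂ (L m) * x + ExteriorAlgebra.ι ℂ m * exteriorDerivation L x := by
  have hfst : ∀ x, (ExteriorAlgebra.lift ℂ
      (A := TrivSqZeroExt (ExteriorAlgebra ℂ M) (ExteriorAlgebra ℂ M))
      ⟨(inlAlgHom ℂ (ExteriorAlgebra ℂ M) (ExteriorAlgebra ℂ M)).toLinearMap ∘ₗ ExteriorAlgebra.ι ℂ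
        + (inrHom (ExteriorAlgebra ℂ M) (ExteriorAlgebra ℂ M)).restrictScalars ℂ ∘ₗ
          ExteriorAlgebra.ι ℂ ∘ₗ L, fun m => by
        ext
        · simp
        · simp [ExteriorAlgebra.ι_add_mul_swap]⟩ x).fst = x := by
    intro x
    refine DFunLike.congr_fun (f := (fstHom ℂ (ExteriorAlgebra ℂ M) (ExteriorAlgebra ℂ M)).comp
      (ExteriorAlgebra.lift ℂ _)) (g := AlgHom.id ℂ _) ?_ x
    ext m
    simp
  simp only [exteriorDerivation, LinearMap.comp_apply, AlgHom.toLinearMap_apply, map_mul,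
    LinearMap.coe_restrictScalars, sndHom_apply, snd_mul, hfst]
  simp [add_comm]

/-- A derivation acts on contractions by the contragredient action on linear forms. Applied to the
shift and to the charge, this handles all annihilation modes. -/
theorem exteriorDerivation_contractLeft (L : Module.End ℂ M) (d : Module.Dual ℂ M)
    (x : ExteriorAlgebra ℂ M) :
    exteriorDerivation L (CliffordAlgebra.contractLeft d x)
      - CliffordAlgebra.contractLeft d (exteriorDerivation L x)
      = -CliffordAlgebra.contractLeft (d ∘ₗ L) x := by
  induction x using CliffordAlgebra.left_induction with
  | algebraMap r =>
    have h : exteriorDerivation L (algebraMap ℂ (CliffordAlgebra 0) r) = 0 :=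
      exteriorDerivation_algebraMap L r
    rw [CliffordAlgebra.contractLeft_algebraMap, CliffordAlgebra.contractLeft_algebraMap, h]
    simp
  | add x y hx hy =>
    simp only [map_add]
    rw [add_sub_add_comm, hx, hy, neg_add]
  | ι_mul x m hx =>
    have h1 := exteriorDerivation_ι_mul L m x
    have h2 := exteriorDerivation_ι_mul L m (CliffordAlgebra.contractLeft d x)
    change exteriorDerivation L (CliffordAlgebra.ι _ m * x) = CliffordAlgebra.ι _ (L m) * x
      + CliffordAlgebra.ι _ m * exteriorDerivation L x at h1
    change exteriorDerivation L (CliffordAlgebra.ι _ m * CliffordAlgebra.contractLeft d x)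
      = CliffordAlgebra.ι _ (L m) * CliffordAlgebra.contractLeft d x
      + CliffordAlgebra.ι _ m * exteriorDerivation L (CliffordAlgebra.contractLeft d x) at h2
    rw [h1, map_add, CliffordAlgebra.contractLeft_ι_mul, CliffordAlgebra.contractLeft_ι_mul,
      CliffordAlgebra.contractLeft_ι_mul, CliffordAlgebra.contractLeft_ι_mul, map_sub, map_smul,
      h2, eq_add_of_sub_eq hx, LinearMap.comp_apply]
    simp only [mul_add, mul_neg]
    abel

/-- The derivation of the symmetric algebra that extends a linear map into it. -/
def symDerivation (L : M →ₗ[ℂ] SymmetricAlgebra ℂ M) : Module.End ℂ (SymmetricAlgebra ℂ M) :=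
  (sndHom (SymmetricAlgebra ℂ M) (SymmetricAlgebra ℂ M)).restrictScalars ℂ ∘ₗ
    (SymmetricAlgebra.lift (A := DualNumber (SymmetricAlgebra ℂ M))
      ((inlAlgHom ℂ (SymmetricAlgebra ℂ M) (SymmetricAlgebra ℂ M)).toLinearMap ∘ₗ
          SymmetricAlgebra.ι ℂ M
        + (inrHom (SymmetricAlgebra ℂ M) (SymmetricAlgebra ℂ M)).restrictScalars ℂ ∘ₗ
          L)).toLinearMap

theorem symContract_eq (d : Module.Dual ℂ M) :
    symContract d = symDerivation (Algebra.linearMap ℂ (SymmetricAlgebra ℂ M) ∘ₗ d) := rfl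

@[simp]
theorem symDerivation_one (L : M →ₗ[ℂ] SymmetricAlgebra ℂ M) : symDerivation L 1 = 0 := by
  simp [symDerivation]

@[simp]
theorem symDerivation_algebraMap (L : M →ₗ[ℂ] SymmetricAlgebra ℂ M) (r : ℂ) :
    symDerivation L (algebraMap ℂ _ r) = 0 := by
  rw [Algebra.algebraMap_eq_smul_one, map_smul, symDerivation_one, smul_zero]

@[simp]
theorem symDerivation_ι (L : M →ₗ[ℂ] SymmetricAlgebra ℂ M) (m : M) :
    symDerivation L (SymmetricAlgebra.ι ℂ M m) = L m := by
  simp [symDerivation]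

theorem symDerivation_mul (L : M →ₗ[ℂ] SymmetricAlgebra ℂ M) (x y : SymmetricAlgebra ℂ M) :
    symDerivation L (x * y) = x * symDerivation L y + y * symDerivation L x := by
  have hfst : ∀ x, (SymmetricAlgebra.lift (A := DualNumber (SymmetricAlgebra ℂ M))
      ((inlAlgHom ℂ (SymmetricAlgebra ℂ M) (SymmetricAlgebra ℂ M)).toLinearMap ∘ₗ
          SymmetricAlgebra.ι ℂ M
        + (inrHom (SymmetricAlgebra ℂ M) (SymmetricAlgebra ℂ M)).restrictScalars ℂ ∘ₗ
          L) x).fst = x := by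
    intro x
    refine DFunLike.congr_fun (f := (fstHom ℂ (SymmetricAlgebra ℂ M) (SymmetricAlgebra ℂ M)).comp
      (SymmetricAlgebra.lift _)) (g := AlgHom.id ℂ _) ?_ x
    ext m
    simp
  simp only [symDerivation, LinearMap.comp_apply, AlgHom.toLinearMap_apply, map_mul,
    LinearMap.coe_restrictScalars, sndHom_apply]
  erw [snd_mul]
  rw [hfst, hfst]
  simp only [MulOpposite.smul_eq_mul_unop, smul_eq_mul, MulOpposite.unop_op]
  rw [mul_comm y]

/-- A derivation of the symmetric algebra is determined by its values on generators; here for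
the commutator of two derivations. -/
theorem symDerivation_commutator (L L' L'' : M →ₗ[ℂ] SymmetricAlgebra ℂ M)
    (h : ∀ m, symDerivation L (L' m) - symDerivation L' (L m) = L'' m)
    (x : SymmetricAlgebra ℂ M) :
    symDerivation L (symDerivation L' x) - symDerivation L' (symDerivation L x)
      = symDerivation L'' x := by
  induction x using SymmetricAlgebra.induction with
  | algebraMap r => simp
  | ι m => simpa using h m
  | add x y hx hy =>
    simp only [map_add]
    rw [add_sub_add_comm, hx, hy]
  | mul x y hx hy =>
    simp only [symDerivation_mul, map_add, ← hx, ← hy]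
    ring

theorem symContract_ι_mul (d : Module.Dual ℂ M) (m : M) (x : SymmetricAlgebra ℂ M) :
    symContract d (SymmetricAlgebra.ι ℂ M m * x)
      = SymmetricAlgebra.ι ℂ M m * symContract d x + d m • x := by
  rw [symContract_eq, symDerivation_mul, symDerivation_ι, LinearMap.comp_apply,
    Algebra.linearMap_apply, Algebra.smul_def, mul_comm x]

theorem symDerivation_zero (x : SymmetricAlgebra ℂ M) :
    symDerivation (0 : M →ₗ[ℂ] SymmetricAlgebra ℂ M) x = 0 := by
  -- The commutator of this derivation with itself is zero and is also the derivation that extends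
  -- 0.
  have := symDerivation_commutator (0 : M →ₗ[ℂ] SymmetricAlgebra ℂ M) 0 0 (by simp) x
  rw [← this, sub_self]

theorem symContract_one (d : Module.Dual ℂ M) : symContract d 1 = 0 := by
  rw [symContract_eq, symDerivation_one]

theorem symContract_smul (c : ℂ) (d : Module.Dual ℂ M) :
    symContract (c • d) = c • symContract d := by
  ext x
  rw [LinearMap.smul_apply]
  induction x using SymmetricAlgebra.induction with
  | algebraMap r => simp [symContract_eq]
  | ι m => simp [symContract_eq, Algebra.smul_def]
  | add x y hx hy => rw [map_add, map_add, hx, hy, smul_add]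
  | mul x y hx hy =>
    rw [symContract_eq, symContract_eq] at *
    rw [symDerivation_mul, symDerivation_mul, hx, hy, mul_smul_comm, mul_smul_comm, smul_add]

theorem symContract_comm (d d' : Module.Dual ℂ M) (x : SymmetricAlgebra ℂ M) :
    symContract d (symContract d' x) = symContract d' (symContract d x) := by
  have h := symDerivation_commutator (Algebra.linearMap ℂ (SymmetricAlgebra ℂ M) ∘ₗ d)
    (Algebra.linearMap ℂ (SymmetricAlgebra ℂ M) ∘ₗ d') 0 (by simp) x
  rw [symDerivation_zero] at h
  exact sub_eq_zero.mp h

theorem symDerivation_symContract (L : Module.End ℂ M) (d : Module.Dual ℂ M)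
    (x : SymmetricAlgebra ℂ M) :
    symDerivation (SymmetricAlgebra.ι ℂ M ∘ₗ L) (symContract d x)
      - symContract d (symDerivation (SymmetricAlgebra.ι ℂ M ∘ₗ L) x)
      = -symContract (d ∘ₗ L) x := by
  have h := symDerivation_commutator (Algebra.linearMap ℂ (SymmetricAlgebra ℂ M) ∘ₗ d)
    (SymmetricAlgebra.ι ℂ M ∘ₗ L) (Algebra.linearMap ℂ (SymmetricAlgebra ℂ M) ∘ₗ d ∘ₗ L)
    (by simp) x
  rw [symContract_eq, symContract_eq, ← h, neg_sub]

end Derivations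

/-! ### Fock spaces -/

open FormalDistribution

/-- Creation operators `cr i k` and annihilation operators `an i k`, `k : ℕ`, of a family of free
fields, as vectors of `M` and linear forms on `M`; the creation operators are related by a
translation operator. -/
structure FockData (M I : Type*) [AddCommGroup M] [Module ℂ M] where
  /-- creation operators -/
  cr : I → ℕ → M
  /-- annihilation operators -/
  an : I → ℕ → Module.Dual ℂ M
  /-- the pairing of the fields -/
  pairing : I → I → ℂ
  /-- the translation operator on generators -/
  shift : Module.End ℂ M
  pairing_comm : ∀ i j, pairing i j = pairing j i
  an_cr : ∀ i j k l, an i k (cr j l) = if k = l then pairing i j else 0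
  shift_cr : ∀ i k, shift (cr i k) = ((k : ℂ) + 1) • cr i (k + 1)
  span_cr : Submodule.span ℂ (Set.range fun x : I × ℕ => cr x.1 x.2) = ⊤

namespace FockData

variable {M I : Type*} [AddCommGroup M] [Module ℂ M] (D : FockData M I)

theorem dual_ext {d d' : Module.Dual ℂ M} (h : ∀ i k, d (D.cr i k) = d' (D.cr i k)) : d = d' :=
  LinearMap.ext_on_range D.span_cr fun x => h x.1 x.2

/-- The transpose of the shift lowers the index with the same factor. With `an_zero_shift` this is
what translation covariance means for annihilation modes. -/
theorem an_succ_shift (i : I) (k : ℕ) :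
    D.an i (k + 1) ∘ₗ D.shift = ((k : ℂ) + 1) • D.an i k := by
  refine D.dual_ext fun j l => ?_
  rw [LinearMap.comp_apply, D.shift_cr, map_smul, LinearMap.smul_apply, D.an_cr, D.an_cr]
  by_cases h : k = l
  · subst h; simp
  · simp [h]

theorem an_zero_shift (i : I) : D.an i 0 ∘ₗ D.shift = 0 := by
  refine D.dual_ext fun j l => ?_
  rw [LinearMap.comp_apply, D.shift_cr, map_smul, D.an_cr]
  simp

/-! #### Fermions -/

/-- The modes of a fermionic field. -/
def fermionMode (i : I) : ℤ → Module.End ℂ (ExteriorAlgebra ℂ M)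
  | Int.negSucc k => LinearMap.mulLeft ℂ (ExteriorAlgebra.ι ℂ (D.cr i k))
  | Int.ofNat k => CliffordAlgebra.contractLeft (D.an i k)

/-- Contraction is an antiderivation, so creation l and annihilation k pair only for k = l. The
creation mode has index -1 - l, which gives m + n = -1. -/
theorem fermionMode_anticomm (i j : I) (m n : ℤ) (v : ExteriorAlgebra ℂ M) :
    D.fermionMode i m (D.fermionMode j n v) + D.fermionMode j n (D.fermionMode i m v)
      = if m + n = -1 then D.pairing i j • v else 0 := by
  have key : ∀ (i j : I) (k l : ℕ),
      CliffordAlgebra.contractLeft (D.an i k) (ExteriorAlgebra.ι ℂ (D.cr j l) * v)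
      + ExteriorAlgebra.ι ℂ (D.cr j l) * CliffordAlgebra.contractLeft (D.an i k) v
      = if k = l then D.pairing i j • v else 0 := by
    intro i j k l
    have := CliffordAlgebra.contractLeft_ι_mul (Q := (0 : QuadraticForm ℂ M)) (d := D.an i k)
      (D.cr j l) v
    change CliffordAlgebra.contractLeft (D.an i k) (ExteriorAlgebra.ι ℂ (D.cr j l) * v)
      = _ - ExteriorAlgebra.ι ℂ (D.cr j l) * _ at this
    rw [this, sub_add_cancel, D.an_cr, ite_smul, zero_smul]
  rcases m with k | k <;> rcases n with l | l
  · rw [if_neg (by simp only [Int.ofNat_eq_natCast]; omega)]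
    exact eq_neg_iff_add_eq_zero.mp (CliffordAlgebra.contractLeft_comm _ _ _)
  · have h := key i j k l
    have : (Int.ofNat k + Int.negSucc l = -1) ↔ k = l := by
      rw [Int.negSucc_eq, Int.ofNat_eq_natCast]; omega
    simp only [this]
    exact h
  · have h := key j i l k
    have : (Int.negSucc k + Int.ofNat l = -1) ↔ l = k := by
      rw [Int.negSucc_eq, Int.ofNat_eq_natCast]; omega
    simp only [this]
    rw [add_comm, D.pairing_comm i j]
    exact h
  · rw [if_neg (by simp only [Int.negSucc_eq]; omega)]
    change ExteriorAlgebra.ι ℂ _ * (ExteriorAlgebra.ι ℂ _ * v)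
      + ExteriorAlgebra.ι ℂ _ * (ExteriorAlgebra.ι ℂ _ * v) = 0
    rw [← mul_assoc, ← mul_assoc, ← add_mul, ExteriorAlgebra.ι_add_mul_swap, zero_mul]

theorem fermionMode_neg (i : I) (k : ℕ) :
    D.fermionMode i (-1 - k) = LinearMap.mulLeft ℂ (ExteriorAlgebra.ι ℂ (D.cr i k)) := by
  have : (-1 - k : ℤ) = Int.negSucc k := by rw [Int.negSucc_eq]; ring
  rw [this, fermionMode]

/-- Induction principle behind the `span` axiom; linearity reduces arbitrary vectors of M to
creation vectors. -/
theorem exterior_eq_top (U : Submodule ℂ (ExteriorAlgebra ℂ M)) (h1 : 1 ∈ U)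
    (h : ∀ i k, ∀ v ∈ U, ExteriorAlgebra.ι ℂ (D.cr i k) * v ∈ U) : U = ⊤ := by
  refine Submodule.eq_top_iff'.mpr fun x => ?_
  induction x using CliffordAlgebra.left_induction with
  | algebraMap r =>
    change algebraMap ℂ (ExteriorAlgebra ℂ M) r ∈ U
    rw [Algebra.algebraMap_eq_smul_one]
    exact U.smul_mem r h1
  | add x y hx hy => exact U.add_mem hx hy
  | ι_mul x m hx =>
    have hm : m ∈ Submodule.span ℂ (Set.range fun x : I × ℕ => D.cr x.1 x.2) := by
      rw [D.span_cr]; trivial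
    change ExteriorAlgebra.ι ℂ m * x ∈ U
    induction hm using Submodule.span_induction with
    | mem m hm => obtain ⟨y, rfl⟩ := hm; exact h _ _ _ hx
    | zero => rw [map_zero, zero_mul]; exact U.zero_mem
    | add a b _ _ ha hb => rw [map_add, add_mul]; exact U.add_mem ha hb
    | smul c a _ ha => rw [map_smul, smul_mul_assoc]; exact U.smul_mem c ha

/-- The vectors killed by almost all annihilation modes form a subspace that contains 1 and is
stable under creation operators, hence everything. -/
theorem exists_contractLeft_eq_zero (i : I) (v : ExteriorAlgebra ℂ M) :
    ∃ N, ∀ k, N ≤ k → CliffordAlgebra.contractLeft (D.an i k) v = 0 := by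
  let U : Submodule ℂ (ExteriorAlgebra ℂ M) :=
    { carrier := {v | ∃ N, ∀ k, N ≤ k → CliffordAlgebra.contractLeft (D.an i k) v = 0}
      add_mem' := by
        rintro v w ⟨N, hN⟩ ⟨N', hN'⟩
        refine ⟨max N N', fun k hk => ?_⟩
        rw [map_add, hN k (le_of_max_le_left hk), hN' k (le_of_max_le_right hk), add_zero]
      zero_mem' := ⟨0, fun k _ => map_zero _⟩
      smul_mem' := by
        rintro c v ⟨N, hN⟩
        exact ⟨N, fun k hk => by rw [map_smul, hN k hk, smul_zero]⟩ }
  have hU : U = ⊤ := by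
    refine D.exterior_eq_top U ⟨0, fun k _ => CliffordAlgebra.contractLeft_one (Q := 0) _⟩ ?_
    rintro j l v ⟨N, hN⟩
    refine ⟨max N (l + 1), fun k hk => ?_⟩
    have h := D.fermionMode_anticomm i j k (-1 - l) v
    rw [if_neg (by omega), fermionMode_neg] at h
    have h2 : CliffordAlgebra.contractLeft (D.an i k) (ExteriorAlgebra.ι ℂ (D.cr j l) * v)
      + ExteriorAlgebra.ι ℂ (D.cr j l) * CliffordAlgebra.contractLeft (D.an i k) v = 0 := h
    rw [hN k (le_of_max_le_left hk), mul_zero, add_zero] at h2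
    exact h2
  have : v ∈ U := hU ▸ Submodule.mem_top
  exact this

/-- A fermionic field. -/
def fermionField (i : I) : fieldSpace (ExteriorAlgebra ℂ M) :=
  ⟨D.fermionMode i, fun v => by
    obtain ⟨N, hN⟩ := D.exists_contractLeft_eq_zero i v
    filter_upwards [Filter.eventually_ge_atTop (N : ℤ)] with n hn
    lift n to ℕ using by omega
    exact hN n (by omega)⟩

/-- The anticommutator depends only on m + n, so one factor z - w annihilates it. -/
theorem fermionMode_isLocal (i j : I) :
    IsLocal (-1) (D.fermionMode i) (D.fermionMode j) := by
  refine (isLocal_iff _ _ _).mpr ⟨1, fun m n v => ?_⟩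
  have h1 := D.fermionMode_anticomm i j (m + 1) n v
  have h2 := D.fermionMode_anticomm i j m (n + 1) v
  have e : m + 1 + n = m + (n + 1) := by ring
  rw [e] at h1
  simp only [Finset.sum_range_succ, Finset.sum_range_zero]
  simp only [neg_smul, one_smul, sub_neg_eq_add, Nat.cast_one, Nat.cast_zero, sub_zero, add_zero,
    add_sub_cancel_right]
  rw [h1, h2]
  split_ifs <;> simp

theorem fermionMode_translation (i : I) (n : ℤ) (v : ExteriorAlgebra ℂ M) :
    exteriorDerivation D.shift (D.fermionMode i n v)
      - D.fermionMode i n (exteriorDerivation D.shift v)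
      = (-(n : ℂ)) • D.fermionMode i (n - 1) v := by
  rcases n with k | k
  · have h := exteriorDerivation_contractLeft D.shift (D.an i k) v
    change _ = _ • D.fermionMode i (k - 1) v
    refine h.trans ?_
    rcases k with _ | k
    · rw [an_zero_shift]; simp
    · rw [an_succ_shift, map_smul, LinearMap.smul_apply]
      have : ((k + 1 : ℕ) - 1 : ℤ) = Int.ofNat k := by simp
      rw [this, fermionMode, ← neg_smul]
      simp
  · have e1 : Int.negSucc k = -1 - (k : ℤ) := by rw [Int.negSucc_eq]; ring
    have e2 : Int.negSucc k - 1 = -1 - ((k + 1 : ℕ) : ℤ) := by rw [e1]; push_cast; ring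
    rw [e2, e1, fermionMode_neg, fermionMode_neg, LinearMap.mulLeft_apply, LinearMap.mulLeft_apply,
      exteriorDerivation_ι_mul, add_sub_cancel_right, D.shift_cr, map_smul, LinearMap.mulLeft_apply,
      smul_mul_assoc]
    congr 1
    push_cast
    ring

-- Creation modes carry the charge of their generator. For annihilation modes it is enough that only
-- fields of opposite charge pair nontrivially.
variable {D} in
theorem fermionMode_charge {Q : Module.End ℂ M} {deg : I → ℤ}
    (hQ : ∀ i k, Q (D.cr i k) = (deg i : ℂ) • D.cr i k)
    (hdeg : ∀ i j, D.pairing i j ≠ 0 → deg i + deg j = 0) (i : I) (n : ℤ)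
    (v : ExteriorAlgebra ℂ M) :
    exteriorDerivation Q (D.fermionMode i n v) - D.fermionMode i n (exteriorDerivation Q v)
      = (deg i : ℂ) • D.fermionMode i n v := by
  rcases n with k | k
  · have h := exteriorDerivation_contractLeft Q (D.an i k) v
    refine h.trans ?_
    have : D.an i k ∘ₗ Q = -(deg i : ℂ) • D.an i k := by
      refine D.dual_ext fun j l => ?_
      rw [LinearMap.comp_apply, hQ, map_smul, LinearMap.smul_apply, D.an_cr]
      by_cases h0 : k = l ∧ D.pairing i j ≠ 0
      · have := hdeg i j h0.2
        have e : deg j = -deg i := by omega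
        rw [e, Int.cast_neg]
      · by_cases hk : k = l
        · have : D.pairing i j = 0 := by
            by_contra h; exact h0 ⟨hk, h⟩
          simp [this]
        · simp [hk]
    rw [this, map_smul, LinearMap.smul_apply, ← neg_smul, neg_neg, fermionMode]
  · have e1 : Int.negSucc k = -1 - (k : ℤ) := by rw [Int.negSucc_eq]; ring
    rw [e1, fermionMode_neg, LinearMap.mulLeft_apply, LinearMap.mulLeft_apply,
      exteriorDerivation_ι_mul, add_sub_cancel_right, hQ, map_smul, smul_mul_assoc]

/-- The fermionic fields generate the exterior algebra. -/
def fermionGenerating (Q : Module.End ℂ M) (deg : I → ℤ) (hodd : ∀ i, Odd (deg i))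
    (hQ : ∀ i k, Q (D.cr i k) = (deg i : ℂ) • D.cr i k)
    (hdeg : ∀ i j, D.pairing i j ≠ 0 → deg i + deg j = 0) :
    GeneratingFields (ExteriorAlgebra ℂ M) I where
  vac := 1
  T := exteriorDerivation D.shift
  Q := exteriorDerivation Q
  field := D.fermionField
  deg := deg
  T_vac := exteriorDerivation_one _
  Q_vac := exteriorDerivation_one _
  covariant i :=
    { translation := D.fermionMode_translation i
      charge := fermionMode_charge hQ hdeg i
      vacuum := fun n hn => by
        lift n to ℕ using hn
        exact CliffordAlgebra.contractLeft_one (Q := 0) _ }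
  isLocal i j := by
    rw [Odd.neg_one_zpow ((hodd i).mul (hodd j))]
    exact D.fermionMode_isLocal i j
  span U h1 h := D.exterior_eq_top U h1 fun i k v hv => by
    have := h i k v hv
    change D.fermionMode i (-1 - k) v ∈ U at this
    rwa [fermionMode_neg] at this

/-! #### Bosons -/

/-- The modes of a bosonic field. -/
def bosonModes (i : I) : ℤ → Module.End ℂ (SymmetricAlgebra ℂ M)
  | Int.negSucc k => LinearMap.mulLeft ℂ (SymmetricAlgebra.ι ℂ M (D.cr i k))
  | Int.ofNat 0 => 0
  | Int.ofNat (k + 1) => ((k : ℂ) + 1) • symContract (D.an i k)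

theorem bosonModes_zero (i : I) : D.bosonModes i 0 = 0 := rfl

theorem bosonModes_neg (i : I) (k : ℕ) :
    D.bosonModes i (-1 - k) = LinearMap.mulLeft ℂ (SymmetricAlgebra.ι ℂ M (D.cr i k)) := by
  have : (-1 - k : ℤ) = Int.negSucc k := by rw [Int.negSucc_eq]; ring
  rw [this, bosonModes]

theorem bosonModes_pos (i : I) (k : ℕ) :
    D.bosonModes i (k + 1) = ((k : ℂ) + 1) • symContract (D.an i k) := rfl

theorem int_trichotomy (n : ℤ) : n = 0 ∨ (∃ k : ℕ, n = k + 1) ∨ ∃ k : ℕ, n = -1 - k := by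
  rcases lt_trichotomy n 0 with h | h | h
  · exact Or.inr (Or.inr ⟨(-1 - n).toNat, by omega⟩)
  · exact Or.inl h
  · exact Or.inr (Or.inl ⟨(n - 1).toNat, by omega⟩)

theorem bosonModes_one (i : I) (n : ℤ) (hn : 0 ≤ n) : D.bosonModes i n 1 = 0 := by
  rcases int_trichotomy n with rfl | ⟨k, rfl⟩ | ⟨k, rfl⟩
  · rfl
  · rw [bosonModes_pos, LinearMap.smul_apply, symContract_one, smul_zero]
  · omega

/-- The nonzero commutators come from contraction being a derivation; the factor k + 1 in the
positive modes is the index m of the Heisenberg relation. -/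
theorem bosonModes_comm (i j : I) (m n : ℤ) (v : SymmetricAlgebra ℂ M) :
    D.bosonModes i m (D.bosonModes j n v) - D.bosonModes j n (D.bosonModes i m v)
      = if m + n = 0 then ((m : ℂ) * D.pairing i j) • v else 0 := by
  have key : ∀ (i j : I) (k l : ℕ),
      D.bosonModes i (k + 1) (D.bosonModes j (-1 - l) v)
      - D.bosonModes j (-1 - l) (D.bosonModes i (k + 1) v)
      = if k = l then (((k : ℂ) + 1) * D.pairing i j) • v else 0 := by
    intro i j k l
    rw [bosonModes_pos, bosonModes_neg]
    simp only [LinearMap.smul_apply, LinearMap.mulLeft_apply]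
    rw [symContract_ι_mul, mul_smul_comm, ← smul_sub, add_sub_cancel_left, D.an_cr, smul_smul,
      mul_ite, mul_zero, ite_smul, zero_smul]
  rcases int_trichotomy m with rfl | ⟨k, rfl⟩ | ⟨k, rfl⟩
  · simp [bosonModes_zero]
  · rcases int_trichotomy n with rfl | ⟨l, rfl⟩ | ⟨l, rfl⟩
    · rw [bosonModes_zero, if_neg (by omega)]; simp
    · rw [if_neg (by omega), bosonModes_pos, bosonModes_pos]
      simp only [LinearMap.smul_apply, map_smul]
      rw [symContract_comm, smul_comm, sub_self]
    · rw [key]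
      refine if_congr (by omega) ?_ rfl
      push_cast
      rfl
  · rcases int_trichotomy n with rfl | ⟨l, rfl⟩ | ⟨l, rfl⟩
    · rw [bosonModes_zero, if_neg (by omega)]; simp
    · rw [← neg_sub, key]
      by_cases h : l = k
      · rw [if_pos h, if_pos (by omega), D.pairing_comm i j, ← neg_smul, h]
        congr 1
        push_cast
        ring
      · rw [if_neg h, if_neg (by omega), neg_zero]
    · rw [if_neg (by omega), bosonModes_neg, bosonModes_neg]
      simp only [LinearMap.mulLeft_apply]
      ring

theorem symmetric_eq_top (U : Submodule ℂ (SymmetricAlgebra ℂ M)) (h1 : 1 ∈ U)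
    (h : ∀ i k, ∀ v ∈ U, SymmetricAlgebra.ι ℂ M (D.cr i k) * v ∈ U) : U = ⊤ := by
  have H : ∀ x, ∀ v ∈ U, x * v ∈ U := by
    intro x
    induction x using SymmetricAlgebra.induction with
    | algebraMap r =>
      intro v hv
      rw [← Algebra.smul_def]
      exact U.smul_mem r hv
    | add x y hx hy => intro v hv; rw [add_mul]; exact U.add_mem (hx v hv) (hy v hv)
    | mul x y hx hy => intro v hv; rw [mul_assoc]; exact hx _ (hy v hv)
    | ι m =>
      intro v hv
      have hm : m ∈ Submodule.span ℂ (Set.range fun x : I × ℕ => D.cr x.1 x.2) := by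
        rw [D.span_cr]; trivial
      induction hm using Submodule.span_induction with
      | mem m hm => obtain ⟨y, rfl⟩ := hm; exact h _ _ _ hv
      | zero => rw [map_zero, zero_mul]; exact U.zero_mem
      | add a b _ _ ha hb => rw [map_add, add_mul]; exact U.add_mem ha hb
      | smul c a _ ha => rw [map_smul, smul_mul_assoc]; exact U.smul_mem c ha
  refine Submodule.eq_top_iff'.mpr fun x => ?_
  have := H x 1 h1
  rwa [mul_one] at this

theorem exists_bosonModes_eq_zero (i : I) (v : SymmetricAlgebra ℂ M) :
    ∃ N : ℤ, ∀ n, N ≤ n → D.bosonModes i n v = 0 := by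
  let U : Submodule ℂ (SymmetricAlgebra ℂ M) :=
    { carrier := {v | ∃ N : ℤ, ∀ n, N ≤ n → D.bosonModes i n v = 0}
      add_mem' := by
        rintro v w ⟨N, hN⟩ ⟨N', hN'⟩
        refine ⟨max N N', fun k hk => ?_⟩
        rw [map_add, hN k (le_of_max_le_left hk), hN' k (le_of_max_le_right hk), add_zero]
      zero_mem' := ⟨0, fun k _ => map_zero _⟩
      smul_mem' := by
        rintro c v ⟨N, hN⟩
        exact ⟨N, fun k hk => by rw [map_smul, hN k hk, smul_zero]⟩ }
  have hU : U = ⊤ := by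
    refine D.symmetric_eq_top U ⟨0, fun n hn => D.bosonModes_one i n hn⟩ ?_
    rintro j l v ⟨N, hN⟩
    refine ⟨max N (l + 2), fun k hk => ?_⟩
    have h := D.bosonModes_comm i j k (-1 - l) v
    rw [if_neg (by omega), bosonModes_neg, hN k (le_of_max_le_left hk), map_zero, sub_zero] at h
    exact h
  have : v ∈ U := hU ▸ Submodule.mem_top
  exact this

/-- A bosonic field. -/
def bosonField (i : I) : fieldSpace (SymmetricAlgebra ℂ M) :=
  ⟨D.bosonModes i, fun v => by
    obtain ⟨N, hN⟩ := D.exists_bosonModes_eq_zero i v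
    filter_upwards [Filter.eventually_ge_atTop N] with n hn
    exact hN n hn⟩

/-- On a line m + n = const the commutator is linear in m, so its second difference vanishes. -/
theorem bosonModes_isLocal (i j : I) : IsLocal 1 (D.bosonModes i) (D.bosonModes j) := by
  refine (isLocal_iff _ _ _).mpr ⟨2, fun m n v => ?_⟩
  have h : ∀ k : ℤ, D.bosonModes i (m + 2 - k) (D.bosonModes j (n + k) v)
      - D.bosonModes j (n + k) (D.bosonModes i (m + 2 - k) v)
      = if m + n + 2 = 0 then (((m : ℂ) + 2 - k) * D.pairing i j) • v else 0 := fun k => by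
    rw [D.bosonModes_comm]
    refine if_congr (by omega) ?_ rfl
    push_cast
    rfl
  simp only [one_smul, Nat.cast_ofNat, h]
  simp only [Finset.sum_range_succ, Finset.sum_range_zero]
  split_ifs
  · rw [← zero_smul ℂ v]
    simp only [smul_smul, ← add_smul, zero_add]
    congr 1
    simp [Nat.choose]
    ring
  · simp

theorem bosonModes_translation (i : I) (n : ℤ) (v : SymmetricAlgebra ℂ M) :
    symDerivation (SymmetricAlgebra.ι ℂ M ∘ₗ D.shift) (D.bosonModes i n v)
      - D.bosonModes i n (symDerivation (SymmetricAlgebra.ι ℂ M ∘ₗ D.shift) v)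
      = (-(n : ℂ)) • D.bosonModes i (n - 1) v := by
  rcases int_trichotomy n with rfl | ⟨k, rfl⟩ | ⟨k, rfl⟩
  · simp [bosonModes_zero]
  · have h := symDerivation_symContract D.shift (D.an i k) v
    rw [bosonModes_pos, LinearMap.smul_apply, LinearMap.smul_apply, map_smul, ← smul_sub, h,
      add_sub_cancel_right]
    rcases k with _ | k
    · rw [an_zero_shift]
      have h0 : symContract (0 : Module.Dual ℂ M) v = 0 := by
        rw [symContract_eq, LinearMap.comp_zero, symDerivation_zero]
      rw [h0]
      simp [bosonModes_zero]
    · rw [an_succ_shift, symContract_smul]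
      push_cast
      rw [bosonModes_pos]
      simp only [smul_neg, neg_smul, LinearMap.smul_apply]
  · have e2 : -1 - (k : ℤ) - 1 = -1 - ((k + 1 : ℕ) : ℤ) := by push_cast; ring
    rw [e2, bosonModes_neg, bosonModes_neg, LinearMap.mulLeft_apply, LinearMap.mulLeft_apply,
      symDerivation_mul, symDerivation_ι, add_sub_cancel_left, LinearMap.comp_apply, D.shift_cr,
      map_smul, LinearMap.mulLeft_apply, mul_smul_comm, mul_comm]
    congr 1
    push_cast
    ring

/-- The bosonic fields generate the symmetric algebra. -/
def bosonGenerating : GeneratingFields (SymmetricAlgebra ℂ M) I where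
  vac := 1
  T := symDerivation (SymmetricAlgebra.ι ℂ M ∘ₗ D.shift)
  Q := 0
  field := D.bosonField
  deg := 0
  T_vac := symDerivation_one _
  Q_vac := rfl
  covariant i :=
    { translation := D.bosonModes_translation i
      charge := fun n v => by simp
      vacuum := fun n hn => D.bosonModes_one i n hn }
  isLocal i j := by
    have : (-1 : ℂ) ^ ((0 : I → ℤ) i * (0 : I → ℤ) j) = 1 := by simp
    rw [this]
    exact D.bosonModes_isLocal i j
  span U h1 h := D.symmetric_eq_top U h1 fun i k v hv => by
    have := h i k v hv
    change D.bosonModes i (-1 - k) v ∈ U at this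
    rwa [bosonModes_neg] at this

end FockData

/-! ### State fields of products of creation operators -/

namespace FormalDistribution

section

variable {V : Type*} [AddCommGroup V] [Module ℂ V]

theorem normalOrder_smul_left (ε c : ℂ) (a b : fieldSpace V) :
    normalOrder ε (c • a) b = c • normalOrder ε a b := by
  have h : ∀ (a b : fieldSpace V) (v : V) (m n : ℤ),
      halfProduct (c • a).1 b.1 v m n = c • halfProduct a.1 b.1 v m n := fun a b v m n => by
    rw [halfProduct, halfProduct, smul_finsum]
    rfl
  have h' : ∀ (a b : fieldSpace V) (v : V) (m n : ℤ),
      halfProduct b.1 (c • a).1 v m n = c • halfProduct b.1 a.1 v m n := fun a b v m n => by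
    rw [halfProduct, halfProduct, smul_finsum]
    exact finsum_congr fun i => (b.1 _).map_smul c _
  ext n v
  change halfProduct (c • a).1 b.1 v 0 n + ε • halfProduct b.1 (c • a).1 v n 0
    = c • (halfProduct a.1 b.1 v 0 n + ε • halfProduct b.1 a.1 v n 0)
  rw [h, h', smul_add, smul_comm ε]

theorem fieldDividedDeriv_smul (k : ℕ) (c : ℂ) (a : fieldSpace V) :
    fieldDividedDeriv k (c • a) = c • fieldDividedDeriv k a := by
  have : ∀ a : fieldSpace V, (fieldDeriv V)^[k] (c • a) = c • (fieldDeriv V)^[k] a := by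
    induction k with
    | zero => intro a; rfl
    | succ k ih => intro a; rw [Function.iterate_succ_apply, map_smul, ih]; rfl
  rw [fieldDividedDeriv, this, smul_comm]
  rfl

end

namespace GeneratingFields

variable {V : Type*} [Ring V] [Algebra ℂ V] {I : Type*} (G : GeneratingFields V I) (ε : ℂ)

/-- The vectors that behave like products of `l` generators under interchange with the generating
fields. -/
def signPart (l : ℕ) : Submodule ℂ V :=
  ⨆ q : {q : ℤ // ∀ i, (-1 : ℂ) ^ (G.deg i * q) = ε ^ l}, G.grading q

/-- `w` acts by multiplication as the creation operator in the divided derivative `∂^(k) a`. -/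
def IsCreation (w : V) (a : fieldSpace V) (k : ℕ) : Prop :=
  ∀ l, ∀ v ∈ G.signPart ε l, w * v ∈ G.signPart ε (l + 1) ∧
    G.stateField (w * v) = normalOrder (ε ^ l) (fieldDividedDeriv k a) (G.stateField v)

variable {G ε}

theorem IsCreation.add {w w' : V} {a a' : fieldSpace V} {k : ℕ} (h : G.IsCreation ε w a k)
    (h' : G.IsCreation ε w' a' k) : G.IsCreation ε (w + w') (a + a') k := fun l v hv => by
  rw [add_mul, map_add, fieldDividedDeriv_add, normalOrder_add_left]
  exact ⟨Submodule.add_mem _ (h l v hv).1 (h' l v hv).1, by rw [(h l v hv).2, (h' l v hv).2]⟩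

theorem IsCreation.smul (c : ℂ) {w : V} {a : fieldSpace V} {k : ℕ} (h : G.IsCreation ε w a k) :
    G.IsCreation ε (c • w) (c • a) k := fun l v hv => by
  rw [smul_mul_assoc, map_smul, fieldDividedDeriv_smul, normalOrder_smul_left]
  exact ⟨Submodule.smul_mem _ _ (h l v hv).1, by rw [(h l v hv).2]⟩

/-- The sign in a normally ordered product depends on the charge only through its parity data, which
`hε` makes a function of the length. A vector of the sign part may mix charges, so the claim is
checked on each charge and added up. -/
theorem isCreation_field (hε : ∀ i j, (-1 : ℂ) ^ (G.deg i * G.deg j) = ε) {i : I} {k : ℕ} {w : V}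
    (hw : ∀ v, w * v = (G.field i).1 (-1 - k) v) : G.IsCreation ε w (G.field i) k := by
  intro l v hv
  rw [hw]
  refine Submodule.iSup_induction
    (fun q : {q : ℤ // ∀ i, (-1 : ℂ) ^ (G.deg i * q) = ε ^ l} => G.grading q)
    (motive := fun v => (G.field i).1 (-1 - k) v ∈ G.signPart ε (l + 1) ∧
      G.stateField ((G.field i).1 (-1 - k) v)
        = normalOrder (ε ^ l) (fieldDividedDeriv k (G.field i)) (G.stateField v)) hv ?_ ?_ ?_
  · rintro ⟨q, hq⟩ v hv
    constructor
    · refine Submodule.mem_iSup_of_mem ⟨G.deg i + q, fun j => ?_⟩ ?_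
      · rw [mul_add, zpow_add₀ (by norm_num), hε, hq, pow_succ']
      · have h := (G.covariant i).charge (-1 - k) v
        have hv' := G.mem_grading.mp hv
        rw [hv', map_smul] at h
        refine G.mem_grading.mpr ?_
        rw [eq_add_of_sub_eq h, ← add_smul, Int.cast_add]
    · rw [G.stateField_normalOrder i k hv, hq]
  · rw [map_zero, map_zero]
    refine ⟨Submodule.zero_mem _, ?_⟩
    have h := normalOrder_add_right (ε ^ l) (fieldDividedDeriv k (G.field i)) 0 0
    rw [add_zero] at h
    exact (left_eq_add.mp h).symm
  · rintro v w ⟨hv, hv'⟩ ⟨hw, hw'⟩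
    rw [map_add, map_add, map_add, normalOrder_add_right, hv', hw']
    exact ⟨Submodule.add_mem _ hv hw, rfl⟩

/-- The generating fields are attached to a spanning set only; bilinearity of normal ordering
extends the creation property to fields of arbitrary vectors. -/
theorem exists_isCreation (hε : ∀ i j, (-1 : ℂ) ^ (G.deg i * G.deg j) = ε)
    {X : Type*} [AddCommGroup X] [Module ℂ X] (gen : ℕ → X →ₗ[ℂ] V)
    (fld : X →ₗ[ℂ] (ℤ → Module.End ℂ V)) {S : Set X} (hS : Submodule.span ℂ S = ⊤)
    (h : ∀ s ∈ S, ∃ i, fld s = (G.field i).1 ∧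
      ∀ (k : ℕ) (v : V), gen k s * v = (G.field i).1 (-1 - k) v) (x : X) :
    ∃ a : fieldSpace V, a.1 = fld x ∧ ∀ k, G.IsCreation ε (gen k x) a k := by
  have hx : x ∈ Submodule.span ℂ S := by rw [hS]; trivial
  induction hx using Submodule.span_induction with
  | mem s hs =>
    obtain ⟨i, hi, hi'⟩ := h s hs
    exact ⟨G.field i, hi.symm, fun k => isCreation_field hε (hi' k)⟩
  | zero =>
    refine ⟨0, by rw [map_zero]; rfl, fun k l v _ => ?_⟩
    have h := normalOrder_smul_left (ε ^ l) 0 0 (G.stateField v)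
    have h' := fieldDividedDeriv_smul k 0 (0 : fieldSpace V)
    rw [zero_smul, zero_smul] at h h'
    rw [map_zero, zero_mul, map_zero, h', h]
    exact ⟨Submodule.zero_mem _, rfl⟩
  | add x y _ _ hx hy =>
    obtain ⟨a, ha, ha'⟩ := hx
    obtain ⟨b, hb, hb'⟩ := hy
    refine ⟨a + b, by rw [map_add, ← ha, ← hb]; rfl, fun k => ?_⟩
    rw [map_add]
    exact (ha' k).add (hb' k)
  | smul c x _ hx =>
    obtain ⟨a, ha, ha'⟩ := hx
    refine ⟨c • a, by rw [map_smul, ← ha]; rfl, fun k => ?_⟩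
    rw [map_smul]
    exact (ha' k).smul c

/-- Induction on the list. The membership in `signPart` carries the sign ε^length that
`normalProductList` uses at each step. -/
theorem stateField_list_prod (hvac : G.vac = 1) {X : Type*} (gen : X → V) (der : X → ℤ → V → V)
    (h : ∀ x, ∃ a k, der x = distDividedDeriv k (fun n v => a.1 n v) ∧
      G.IsCreation ε (gen x) a k) (l : List X) :
    (l.map gen).prod ∈ G.signPart ε l.length ∧
      ∀ n v, (G.stateField (l.map gen).prod).1 n v = normalProductList ε (l.map der) n v := by
  induction l with
  | nil =>
    constructor
    · refine Submodule.mem_iSup_of_mem ⟨0, fun i => by simp⟩ ?_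
      rw [List.map_nil, List.prod_nil, ← hvac]
      exact G.vac_mem
    · intro n v
      rw [List.map_nil, List.prod_nil, ← hvac, G.stateField_vac, idField_apply, List.map_nil,
        normalProductList]
      by_cases hn : n = -1 <;> simp [hn]
  | cons x l ih =>
    obtain ⟨a, k, hder, hx⟩ := h x
    have hl := hx _ _ ih.1
    rw [List.map_cons, List.prod_cons]
    refine ⟨hl.1, fun n v => ?_⟩
    rw [hl.2, normalOrder_apply_eq_normalProduct, List.map_cons, normalProductList, hder,
      List.length_map]
    have e1 : (fun n v => (fieldDividedDeriv k a).1 n v)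
        = distDividedDeriv k (fun n v => a.1 n v) :=
      funext fun n => funext fun v => fieldDividedDeriv_apply k a n v
    have e2 : (fun n v => (G.stateField (l.map gen).prod).1 n v)
        = normalProductList ε (l.map der) := funext fun n => funext fun v => ih.2 n v
    rw [e1, e2]

end GeneratingFields

end FormalDistribution

open FormalDistribution

/-! ### Polarized free fields -/

namespace FockData

variable {M ι : Type*} [AddCommGroup M] [Module ℂ M] [DecidableEq ι]

/-- The fields come in dual pairs. -/
structure IsPolarized (D : FockData M (ι ⊕ ι)) : Prop where
  inl_inl : ∀ i j, D.pairing (Sum.inl i) (Sum.inl j) = 0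
  inr_inr : ∀ i j, D.pairing (Sum.inr i) (Sum.inr j) = 0
  inl_inr : ∀ i j, D.pairing (Sum.inl i) (Sum.inr j) = if i = j then 1 else 0

/-- The charges of polarized fermions. -/
def polarDeg : ι ⊕ ι → ℤ := Sum.elim (fun _ => -1) fun _ => 1

theorem odd_polarDeg (i : ι ⊕ ι) : Odd (polarDeg i) := by
  rcases i with i | i
  · exact odd_neg_one
  · exact odd_one

variable {D : FockData M (ι ⊕ ι)} (hD : D.IsPolarized)

include hD

theorem IsPolarized.polarDeg_add (i j : ι ⊕ ι) (h : D.pairing i j ≠ 0) :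
    polarDeg i + polarDeg j = 0 := by
  rcases i with i | i <;> rcases j with j | j
  · exact absurd (hD.inl_inl i j) h
  · rfl
  · rfl
  · exact absurd (hD.inr_inr i j) h

section Fermion

variable {Q : Module.End ℂ M} (hQ : ∀ i k, Q (D.cr i k) = (polarDeg i : ℂ) • D.cr i k)

/-- The generating fields of polarized fermions. -/
def IsPolarized.fermions : GeneratingFields (ExteriorAlgebra ℂ M) (ι ⊕ ι) :=
  D.fermionGenerating Q polarDeg odd_polarDeg hQ hD.polarDeg_add

theorem IsPolarized.fermions_mode (i : ι ⊕ ι) (n : ℤ) :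
    (hD.fermions hQ).vertexAlgebra.mode (ExteriorAlgebra.ι ℂ (D.cr i 0)) n
      = D.fermionMode i n := by
  have h := (hD.fermions hQ).stateField_generator i
  have h1 : ((hD.fermions hQ).field i).1 (-1) (hD.fermions hQ).vac
      = ExteriorAlgebra.ι ℂ (D.cr i 0) := by
    change D.fermionMode i (-1) 1 = _
    have := D.fermionMode_neg i 0
    rw [Nat.cast_zero, sub_zero] at this
    rw [this, LinearMap.mulLeft_apply, mul_one]
  rw [h1] at h
  rw [GeneratingFields.vertexAlgebra_mode, h]
  rfl

theorem IsPolarized.ι_mem_grading {m : M} {p : ℤ} (hm : Q m = (p : ℂ) • m) :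
    ExteriorAlgebra.ι ℂ m ∈ (hD.fermions hQ).vertexAlgebra.grading p := by
  refine (hD.fermions hQ).mem_grading.mpr ?_
  change exteriorDerivation Q _ = _
  have := exteriorDerivation_ι_mul Q m 1
  rw [mul_one, exteriorDerivation_one, mul_zero, add_zero, mul_one, hm, map_smul] at this
  exact this

/-- The empty index type for bosons makes the general free field computation specialise to part (a).
-/
theorem IsPolarized.freeFields_fermions :
    VertexAlgebra.FreeFields (hD.fermions hQ).vertexAlgebra (-1)
      (fun i => ExteriorAlgebra.ι ℂ (D.cr (Sum.inl i) 0))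
      (fun i => ExteriorAlgebra.ι ℂ (D.cr (Sum.inr i) 0))
      (Empty.elim : Empty → ExteriorAlgebra ℂ M) Empty.elim where
  odd := odd_neg_one
  φ_mem i := hD.ι_mem_grading hQ (hQ (Sum.inl i) 0)
  ψ_mem i := hD.ι_mem_grading hQ (hQ (Sum.inr i) 0)
  b_mem i := i.elim
  c_mem i := i.elim
  φψ i j m n v := by
    rw [hD.fermions_mode, hD.fermions_mode, D.fermionMode_anticomm, hD.inl_inr]
    by_cases h : i = j <;> by_cases h' : m + n = -1 <;> simp [h, h']
  φφ i j m n v := by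
    rw [hD.fermions_mode, hD.fermions_mode, D.fermionMode_anticomm, hD.inl_inl]
    simp
  ψψ i j m n v := by
    rw [hD.fermions_mode, hD.fermions_mode, D.fermionMode_anticomm, hD.inr_inr]
    simp
  bc i := i.elim
  bb i := i.elim
  cc i := i.elim
  φb _ j := j.elim
  φc _ j := j.elim
  ψb _ j := j.elim
  ψc _ j := j.elim
  generates U h1 h := (hD.fermions hQ).span U h1 fun i k v hv => by
    rcases i with i | i
    · have := h (Sum.inl (Sum.inl i)) k v hv
      rw [Sum.elim_inl, Sum.elim_inl, hD.fermions_mode] at this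
      exact this
    · have := h (Sum.inl (Sum.inr i)) k v hv
      rw [Sum.elim_inl, Sum.elim_inr, hD.fermions_mode] at this
      exact this

theorem IsPolarized.fermions_sign (i j : ι ⊕ ι) :
    (-1 : ℂ) ^ ((hD.fermions hQ).deg i * (hD.fermions hQ).deg j) = -1 :=
  Odd.neg_one_zpow ((odd_polarDeg i).mul (odd_polarDeg j))

variable [Fintype ι]

theorem IsPolarized.isConformal_fermions (lam : ℂ) :
    (hD.fermions hQ).vertexAlgebra.IsConformal
      (fermionConformalVector (fun k i => ExteriorAlgebra.ι ℂ (D.cr (Sum.inl i) k))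
        (fun k i => ExteriorAlgebra.ι ℂ (D.cr (Sum.inr i) k)) lam)
      (-(6 * lam ^ 2 - 6 * lam + 1) * (2 * Fintype.card ι)) := by
  have h := (hD.freeFields_fermions hQ).isConformal lam
  have e1 : ∀ i, D.fermionMode i (-2) = LinearMap.mulLeft ℂ (ExteriorAlgebra.ι ℂ (D.cr i 1)) :=
    fun i => D.fermionMode_neg i 1
  rw [VertexAlgebra.freeConformalVector, Finset.univ_eq_empty, Finset.sum_empty, zero_add] at h
  simp only [hD.fermions_mode, e1, LinearMap.mulLeft_apply] at h
  rw [fermionConformalVector]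
  convert h using 1
  rw [Fintype.card_empty, Nat.cast_zero]
  ring

end Fermion

omit hD in
theorem bosons_mode (i : ι ⊕ ι) (n : ℤ) :
    D.bosonGenerating.vertexAlgebra.mode (SymmetricAlgebra.ι ℂ M (D.cr i 0)) n
      = D.bosonModes i n := by
  have h := D.bosonGenerating.stateField_generator i
  have h1 : (D.bosonGenerating.field i).1 (-1) D.bosonGenerating.vac
      = SymmetricAlgebra.ι ℂ M (D.cr i 0) := by
    change D.bosonModes i (-1) 1 = _
    have := D.bosonModes_neg i 0
    rw [Nat.cast_zero, sub_zero] at this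
    rw [this, LinearMap.mulLeft_apply, mul_one]
  rw [h1] at h
  rw [GeneratingFields.vertexAlgebra_mode, h]
  rfl

-- The bosonic charge operator is zero, so everything has degree 0; the tensor product construction
-- relies on this.
omit hD in
theorem bosons_grading : D.bosonGenerating.vertexAlgebra.grading 0 = ⊤ := by
  refine Submodule.eq_top_iff'.mpr fun v => D.bosonGenerating.mem_grading.mpr ?_
  rw [Int.cast_zero, zero_smul]
  rfl

/-- There are no fermions here, so the degree -1 only has to be odd. -/
theorem IsPolarized.freeFields_bosons :
    VertexAlgebra.FreeFields D.bosonGenerating.vertexAlgebra (-1)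
      (Empty.elim : Empty → SymmetricAlgebra ℂ M) Empty.elim
      (fun i => SymmetricAlgebra.ι ℂ M (D.cr (Sum.inl i) 0))
      (fun i => SymmetricAlgebra.ι ℂ M (D.cr (Sum.inr i) 0)) where
  odd := odd_neg_one
  φ_mem i := i.elim
  ψ_mem i := i.elim
  b_mem i := by rw [bosons_grading]; trivial
  c_mem i := by rw [bosons_grading]; trivial
  bc i j m n v := by
    rw [bosons_mode, bosons_mode, D.bosonModes_comm, hD.inl_inr]
    by_cases h : i = j <;> by_cases h' : m + n = 0 <;> simp [h, h']
  bb i j m n v := by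
    have := D.bosonModes_comm (Sum.inl i) (Sum.inl j) m n v
    rw [hD.inl_inl, mul_zero, zero_smul, ite_self] at this
    rw [bosons_mode, bosons_mode, sub_eq_zero.mp this]
  cc i j m n v := by
    have := D.bosonModes_comm (Sum.inr i) (Sum.inr j) m n v
    rw [hD.inr_inr, mul_zero, zero_smul, ite_self] at this
    rw [bosons_mode, bosons_mode, sub_eq_zero.mp this]
  φψ i := i.elim
  φφ i := i.elim
  ψψ i := i.elim
  φb i := i.elim
  φc i := i.elim
  ψb i := i.elim
  ψc i := i.elim
  generates U h1 h := D.bosonGenerating.span U h1 fun i k v hv => by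
    rcases i with i | i
    · have := h (Sum.inr (Sum.inl i)) k v hv
      rw [Sum.elim_inr, Sum.elim_inl, bosons_mode] at this
      exact this
    · have := h (Sum.inr (Sum.inr i)) k v hv
      rw [Sum.elim_inr, Sum.elim_inr, bosons_mode] at this
      exact this

end FockData

/-! ### The free fields attached to a polarized quadratic space -/

/-- Multiplication by `t⁻¹` times the degree, on `⨁ t^(-k-1) X`. -/
def fockShift (X : Type*) [AddCommGroup X] [Module ℂ X] : Module.End ℂ (ℕ →₀ X) :=
  Finsupp.lsum ℂ fun k => ((k : ℂ) + 1) • Finsupp.lsingle (k + 1)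

theorem fockShift_single {X : Type*} [AddCommGroup X] [Module ℂ X] (k : ℕ) (x : X) :
    fockShift X (Finsupp.single k x) = ((k : ℂ) + 1) • Finsupp.single (k + 1) x := by
  simp [fockShift]

theorem span_single_eq_top {X J : Type*} [AddCommGroup X] [Module ℂ X] {u : J → X}
    (hu : Submodule.span ℂ (Set.range u) = ⊤) (U : Submodule ℂ (ℕ →₀ X))
    (hU : ∀ j k, Finsupp.single k (u j) ∈ U) : U = ⊤ := by
  refine Submodule.eq_top_iff'.mpr fun m => ?_
  induction m using Finsupp.induction_linear with
  | zero => exact U.zero_mem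
  | add a b ha hb => exact U.add_mem ha hb
  | single k x =>
    have hx : x ∈ Submodule.span ℂ (Set.range u) := by rw [hu]; trivial
    change Finsupp.lsingle (R := ℂ) k x ∈ U
    rw [← Submodule.mem_comap]
    refine Submodule.span_le.mpr ?_ hx
    rintro _ ⟨j, rfl⟩
    exact hU j k

section Instances

variable {T : Type*} [AddCommGroup T] [Module ℂ T] (g : LinearMap.BilinForm ℂ T)
  (hsymm : g.IsSymm)

/-- The free fields attached to a spanning family of `T`. -/
def fockData {J : Type*} (u : J → T) (hu : Submodule.span ℂ (Set.range u) = ⊤) :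
    FockData (ℕ →₀ T) J where
  cr i k := Finsupp.single k (u i)
  an i k := g (u i) ∘ₗ Finsupp.lapply k
  pairing i j := g (u i) (u j)
  shift := fockShift T
  pairing_comm i j := hsymm.eq (u i) (u j)
  an_cr i j k l := by
    rw [LinearMap.comp_apply, Finsupp.lapply_apply, Finsupp.single_apply, apply_ite (g (u i)),
      map_zero]
    exact if_congr eq_comm rfl rfl
  shift_cr i k := fockShift_single k (u i)
  span_cr := span_single_eq_top hu _ fun j k => Submodule.subset_span ⟨(j, k), rfl⟩

theorem fermionMode_fockData {J : Type*} (u : J → T) (hu : Submodule.span ℂ (Set.range u) = ⊤)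
    (i : J) : (fockData g hsymm u hu).fermionMode i = fermionModeNS g (u i) := by
  funext n
  rcases n with k | k <;> rfl

theorem bosonModes_fockData {J : Type*} (u : J → T) (hu : Submodule.span ℂ (Set.range u) = ⊤)
    (i : J) : (fockData g hsymm u hu).bosonModes i = bosonMode g (u i) := by
  funext n
  rcases n with (_ | k) | k <;> rfl

/-- `fermionModeNS` as a linear map. -/
def fermionModeNSLinear : T →ₗ[ℂ] (ℤ → Module.End ℂ (FermionFockNS T)) where
  toFun := fermionModeNS g
  map_add' s t := by
    funext n
    refine LinearMap.ext fun v => ?_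
    rcases n with k | k
    · change CliffordAlgebra.contractLeft _ v
        = CliffordAlgebra.contractLeft _ v + CliffordAlgebra.contractLeft _ v
      rw [map_add, LinearMap.add_comp, map_add, LinearMap.add_apply]
    · change fermionGenNS k (s + t) * v = fermionGenNS k s * v + fermionGenNS k t * v
      rw [fermionGenNS, Finsupp.single_add, map_add, add_mul]
      rfl
  map_smul' c t := by
    funext n
    refine LinearMap.ext fun v => ?_
    rcases n with k | k
    · change CliffordAlgebra.contractLeft _ v = c • CliffordAlgebra.contractLeft _ v
      rw [map_smul, LinearMap.smul_comp, map_smul, LinearMap.smul_apply]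
    · change fermionGenNS k (c • t) * v = c • (fermionGenNS k t * v)
      rw [fermionGenNS, ← Finsupp.smul_single, map_smul, smul_mul_assoc]
      rfl

theorem symContract_add {M : Type*} [AddCommGroup M] [Module ℂ M] (d d' : Module.Dual ℂ M) :
    symContract (d + d') = symContract d + symContract d' := by
  ext x
  rw [LinearMap.add_apply]
  induction x using SymmetricAlgebra.induction with
  | algebraMap r => simp [symContract_eq]
  | ι m => simp [symContract_eq]
  | add x y hx hy => simp only [map_add, hx, hy]; abel
  | mul x y hx hy =>
    rw [symContract_eq, symContract_eq, symContract_eq] at *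
    rw [symDerivation_mul, symDerivation_mul, symDerivation_mul, hx, hy]
    ring

/-- `bosonMode` as a linear map. -/
def bosonModeLinear : T →ₗ[ℂ] (ℤ → Module.End ℂ (BosonFock T)) where
  toFun := bosonMode g
  map_add' s t := by
    funext n
    refine LinearMap.ext fun v => ?_
    rcases n with (_ | k) | k
    · exact (add_zero _).symm
    · change (((k : ℂ) + 1) • symContract _) v
        = (((k : ℂ) + 1) • symContract _) v + (((k : ℂ) + 1) • symContract _) v
      rw [map_add, LinearMap.add_comp, symContract_add, smul_add, LinearMap.add_apply]
    · change bosonGen k (s + t) * v = bosonGen k s * v + bosonGen k t * v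
      rw [bosonGen, Finsupp.single_add, map_add, add_mul]
      rfl
  map_smul' c t := by
    funext n
    refine LinearMap.ext fun v => ?_
    rcases n with (_ | k) | k
    · exact (smul_zero c).symm
    · change (((k : ℂ) + 1) • symContract _) v = c • ((((k : ℂ) + 1) • symContract _) v)
      rw [map_smul, LinearMap.smul_comp, symContract_smul, smul_comm, LinearMap.smul_apply]
    · change bosonGen k (c • t) * v = c • (bosonGen k t * v)
      rw [bosonGen, ← Finsupp.smul_single, map_smul, smul_mul_assoc]
      rfl

/-- The modes depend linearly on the vector of T, so the formula for arbitrary generators follows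
from the one for the family u. -/
theorem isBosonVertexAlgebra {J : Type*} (u : J → T)
    (hu : Submodule.span ℂ (Set.range u) = ⊤) :
    IsBosonVertexAlgebra g (fockData g hsymm u hu).bosonGenerating.vertexAlgebra where
  vacuum_eq := rfl
  gen_mem k a := by
    refine (fockData g hsymm u hu).bosonGenerating.mem_grading.mpr ?_
    rw [Int.cast_zero, zero_smul]
    rfl
  mode_eq l n v := by
    rw [GeneratingFields.vertexAlgebra_mode]
    refine (GeneratingFields.stateField_list_prod (ε := 1) rfl _ _ ?_ l).2 n v
    rintro ⟨k, a⟩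
    obtain ⟨x, hx, hx'⟩ := GeneratingFields.exists_isCreation (ε := 1)
      (G := (fockData g hsymm u hu).bosonGenerating)
      (fun i j => by change (-1 : ℂ) ^ ((0 : ℤ) * 0) = 1; simp)
      (fun k => SymmetricAlgebra.ι ℂ (ℕ →₀ T) ∘ₗ Finsupp.lsingle k) (bosonModeLinear g) hu
      (by
        rintro _ ⟨i, rfl⟩
        refine ⟨i, (bosonModes_fockData g hsymm u hu i).symm, fun k v => ?_⟩
        change _ = (fockData g hsymm u hu).bosonModes i (-1 - k) v
        rw [FockData.bosonModes_neg]
        rfl) a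
    exact ⟨x, k, by rw [hx]; rfl, hx' k⟩

variable {T' T'' : Submodule ℂ T} (hcompl : IsCompl T' T'')
    (hiso' : ∀ x ∈ T', ∀ y ∈ T', g x y = 0) (hiso'' : ∀ x ∈ T'', ∀ y ∈ T'', g x y = 0)
    {ι : Type*} [DecidableEq ι] (e : Module.Basis ι ℂ T') (f : Module.Basis ι ℂ T'')
    (hdual : ∀ i j, g (e i : T) (f j : T) = if i = j then 1 else 0)

/-- The union of the bases of `T'` and `T''`. -/
def polarFamily : ι ⊕ ι → T := Sum.elim (fun i => (e i : T)) fun i => (f i : T)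

include hcompl in
theorem span_polarFamily : Submodule.span ℂ (Set.range (polarFamily e f)) = ⊤ := by
  rw [polarFamily, Set.Sum.elim_range, Submodule.span_union]
  have h1 : Submodule.span ℂ (Set.range fun i => (e i : T)) = T' := by
    have : (Set.range fun i => (e i : T)) = T'.subtype '' Set.range e := by
      rw [← Set.range_comp]; rfl
    rw [this, Submodule.span_image, e.span_eq, Submodule.map_top, Submodule.range_subtype]
  have h2 : Submodule.span ℂ (Set.range fun i => (f i : T)) = T'' := by
    have : (Set.range fun i => (f i : T)) = T''.subtype '' Set.range f := by
      rw [← Set.range_comp]; rfl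
    rw [this, Submodule.span_image, f.span_eq, Submodule.map_top, Submodule.range_subtype]
  rw [h1, h2]
  exact hcompl.sup_eq_top

/-- The free fields attached to a polarized quadratic space (Neveu–Schwarz sector). -/
abbrev fockDataNS : FockData (ℕ →₀ T) (ι ⊕ ι) :=
  fockData g hsymm (polarFamily e f) (span_polarFamily hcompl e f)

include hiso' hiso'' hdual in
theorem isPolarized_fockDataNS : (fockDataNS g hsymm hcompl e f).IsPolarized where
  inl_inl i j := hiso' _ (e i).2 _ (e j).2
  inr_inr i j := hiso'' _ (f i).2 _ (f j).2
  inl_inr := hdual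

/-- The charge operator on generators (Neveu–Schwarz sector). -/
def chargeNS : Module.End ℂ (ℕ →₀ T) :=
  Finsupp.mapRange.linearMap
    ((T''.subtype ∘ₗ LinearMap.snd ℂ T' T'' - T'.subtype ∘ₗ LinearMap.fst ℂ T' T'') ∘ₗ
      (T'.prodEquivOfIsCompl T'' hcompl).symm.toLinearMap)

theorem chargeNS_left (k : ℕ) (t : T') : chargeNS hcompl (Finsupp.single k (t : T))
    = ((-1 : ℤ) : ℂ) • Finsupp.single k (t : T) := by
  simp [chargeNS]

theorem chargeNS_right (k : ℕ) (t : T'') : chargeNS hcompl (Finsupp.single k (t : T))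
    = ((1 : ℤ) : ℂ) • Finsupp.single k (t : T) := by
  simp [chargeNS]

theorem chargeNS_cr (i : ι ⊕ ι) (k : ℕ) :
    chargeNS hcompl ((fockDataNS g hsymm hcompl e f).cr i k)
      = (FockData.polarDeg i : ℂ) • (fockDataNS g hsymm hcompl e f).cr i k := by
  rcases i with i | i
  · exact chargeNS_left hcompl k (e i)
  · exact chargeNS_right hcompl k (f i)

theorem isFermionVertexAlgebraNS (hD : (fockDataNS g hsymm hcompl e f).IsPolarized) :
    IsFermionVertexAlgebraNS g T' T''
      (hD.fermions (chargeNS_cr g hsymm hcompl e f)).vertexAlgebra where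
  vacuum_eq := rfl
  gen_mem' k t ht := hD.ι_mem_grading _ (chargeNS_left hcompl k ⟨t, ht⟩)
  gen_mem'' k t ht := hD.ι_mem_grading _ (chargeNS_right hcompl k ⟨t, ht⟩)
  mode_eq l n v := by
    rw [GeneratingFields.vertexAlgebra_mode]
    refine (GeneratingFields.stateField_list_prod (ε := -1) rfl _ _ ?_ l).2 n v
    rintro ⟨k, a⟩
    obtain ⟨x, hx, hx'⟩ := GeneratingFields.exists_isCreation
      (hD.fermions_sign (chargeNS_cr g hsymm hcompl e f))
      (fun k => ExteriorAlgebra.ι ℂ ∘ₗ Finsupp.lsingle k) (fermionModeNSLinear g)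
      (span_polarFamily hcompl e f)
      (by
        rintro _ ⟨i, rfl⟩
        refine ⟨i, (fermionMode_fockData g hsymm _ _ i).symm, fun k v => ?_⟩
        change _ = (fockDataNS g hsymm hcompl e f).fermionMode i (-1 - k) v
        rw [FockData.fermionMode_neg]
        rfl) a
    exact ⟨x, k, by rw [hx]; rfl, hx' k⟩

end Instances

open FormalDistribution

/-! ### The Ramond sector -/

section Ramond

variable {T : Type*} [AddCommGroup T] [Module ℂ T] (g : LinearMap.BilinForm ℂ T)
  (hsymm : g.IsSymm) {T' T'' : Submodule ℂ T}
  (hiso' : ∀ x ∈ T', ∀ y ∈ T', g x y = 0) (hiso'' : ∀ x ∈ T'', ∀ y ∈ T'', g x y = 0)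
  {ι : Type*} [DecidableEq ι] (e : Module.Basis ι ℂ T') (f : Module.Basis ι ℂ T'')
  (hdual : ∀ i j, g (e i : T) (f j : T) = if i = j then 1 else 0)

/-- The free fields attached to a polarized quadratic space (Ramond sector). -/
def fockDataR : FockData ((ℕ →₀ T') × (ℕ →₀ T'')) (ι ⊕ ι) where
  cr
    | Sum.inl i, k => (Finsupp.single k (e i), 0)
    | Sum.inr i, k => (0, Finsupp.single k (f i))
  an
    | Sum.inl i, k => (g (e i : T) ∘ₗ T''.subtype) ∘ₗ Finsupp.lapply k ∘ₗ
        LinearMap.snd ℂ (ℕ →₀ T') (ℕ →₀ T'')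
    | Sum.inr i, k => (g (f i : T) ∘ₗ T'.subtype) ∘ₗ Finsupp.lapply k ∘ₗ
        LinearMap.fst ℂ (ℕ →₀ T') (ℕ →₀ T'')
  -- The contraction by a vector of T' sees only the T''-summand and conversely, so fields of the
  -- same type pair to zero.
  pairing
    | Sum.inl _, Sum.inl _ => 0
    | Sum.inr _, Sum.inr _ => 0
    | Sum.inl i, Sum.inr j => g (e i : T) (f j : T)
    | Sum.inr i, Sum.inl j => g (f i : T) (e j : T)
  -- Index k on T' stands for φ_(-k), which is the mode of index -k-1 in powers z^(-n-1); hence both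
  -- summands have the same factor k + 1.
  shift := (fockShift T').prodMap (fockShift T'')
  pairing_comm := by
    rintro (i | i) (j | j)
    · rfl
    · exact hsymm.eq _ _
    · exact hsymm.eq _ _
    · rfl
  an_cr := by
    rintro (i | i) (j | j) k l
    · simp
    · simp only [LinearMap.comp_apply, LinearMap.snd_apply, Finsupp.lapply_apply,
        Finsupp.single_apply, eq_comm (a := l)]
      split_ifs <;> simp
    · simp only [LinearMap.comp_apply, LinearMap.fst_apply, Finsupp.lapply_apply,
        Finsupp.single_apply, eq_comm (a := l)]
      split_ifs <;> simp
    · simp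
  shift_cr := by
    rintro (i | i) k
    · simp [fockShift_single]
    · simp [fockShift_single]
  span_cr := by
    refine Submodule.eq_top_iff'.mpr fun m => ?_
    set U := Submodule.span ℂ (Set.range fun x : (ι ⊕ ι) × ℕ =>
      (match x.1, x.2 with
        | Sum.inl i, k => (Finsupp.single k (e i), 0)
        | Sum.inr i, k => (0, Finsupp.single k (f i)) : (ℕ →₀ T') × (ℕ →₀ T''))) with hU
    have h1 := span_single_eq_top e.span_eq (U.comap (LinearMap.inl ℂ (ℕ →₀ T') (ℕ →₀ T'')))
      fun j k => Submodule.subset_span ⟨(Sum.inl j, k), rfl⟩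
    have h2 := span_single_eq_top f.span_eq (U.comap (LinearMap.inr ℂ (ℕ →₀ T') (ℕ →₀ T'')))
      fun j k => Submodule.subset_span ⟨(Sum.inr j, k), rfl⟩
    have h1' : m.1 ∈ U.comap (LinearMap.inl ℂ (ℕ →₀ T') (ℕ →₀ T'')) := h1 ▸ Submodule.mem_top
    have h2' : m.2 ∈ U.comap (LinearMap.inr ℂ (ℕ →₀ T') (ℕ →₀ T'')) := h2 ▸ Submodule.mem_top
    have : m = LinearMap.inl ℂ (ℕ →₀ T') (ℕ →₀ T'') m.1
        + LinearMap.inr ℂ (ℕ →₀ T') (ℕ →₀ T'') m.2 := by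
      ext <;> simp
    rw [this]
    exact U.add_mem h1' h2'

include hdual in
theorem isPolarized_fockDataR : (fockDataR g hsymm e f).IsPolarized where
  inl_inl _ _ := rfl
  inr_inr _ _ := rfl
  inl_inr := hdual

/-- The charge operator on generators (Ramond sector). -/
def chargeR (T' T'' : Submodule ℂ T) : Module.End ℂ ((ℕ →₀ T') × (ℕ →₀ T'')) :=
  (-LinearMap.id).prodMap LinearMap.id

theorem chargeR_left (m : ℕ →₀ T') : chargeR T' T'' (m, 0) = ((-1 : ℤ) : ℂ) • (m, 0) := by
  simp [chargeR]

theorem chargeR_right (m : ℕ →₀ T'') : chargeR T' T'' (0, m) = ((1 : ℤ) : ℂ) • (0, m) := by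
  simp [chargeR]

theorem chargeR_cr (i : ι ⊕ ι) (k : ℕ) :
    chargeR T' T'' ((fockDataR g hsymm e f).cr i k)
      = (FockData.polarDeg i : ℂ) • (fockDataR g hsymm e f).cr i k := by
  rcases i with i | i
  · exact chargeR_left _
  · exact chargeR_right _

/-- `fermionModeR` as a linear map on `T'`. -/
def fermionModeRLeft : T' →ₗ[ℂ] (ℤ → Module.End ℂ (FermionFockR T' T'')) where
  toFun t := fermionModeR g (Sum.inl t)
  map_add' s t := by
    funext n
    refine LinearMap.ext fun v => ?_
    rcases n with k | k
    · change CliffordAlgebra.contractLeft _ v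
        = CliffordAlgebra.contractLeft _ v + CliffordAlgebra.contractLeft _ v
      rw [Submodule.coe_add, map_add, LinearMap.add_comp, LinearMap.add_comp, map_add,
        LinearMap.add_apply]
    · change ExteriorAlgebra.ι ℂ (Finsupp.single k (s + t), 0) * v
        = ExteriorAlgebra.ι ℂ (Finsupp.single k s, 0) * v
          + ExteriorAlgebra.ι ℂ (Finsupp.single k t, 0) * v
      rw [← add_mul, ← map_add, Finsupp.single_add, Prod.mk_add_mk, add_zero]
  map_smul' c t := by
    funext n
    refine LinearMap.ext fun v => ?_
    rcases n with k | k
    · change CliffordAlgebra.contractLeft _ v = c • CliffordAlgebra.contractLeft _ v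
      rw [Submodule.coe_smul, map_smul, LinearMap.smul_comp, LinearMap.smul_comp, map_smul,
        LinearMap.smul_apply]
    · change ExteriorAlgebra.ι ℂ (Finsupp.single k (c • t), 0) * v
        = c • (ExteriorAlgebra.ι ℂ (Finsupp.single k t, 0) * v)
      rw [← smul_mul_assoc, ← map_smul, Prod.smul_mk, smul_zero, Finsupp.smul_single]

/-- `fermionModeR` as a linear map on `T''`. -/
def fermionModeRRight : T'' →ₗ[ℂ] (ℤ → Module.End ℂ (FermionFockR T' T'')) where
  toFun t := fermionModeR g (Sum.inr t)
  map_add' s t := by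
    funext n
    refine LinearMap.ext fun v => ?_
    rcases n with k | k
    · change CliffordAlgebra.contractLeft _ v
        = CliffordAlgebra.contractLeft _ v + CliffordAlgebra.contractLeft _ v
      rw [Submodule.coe_add, map_add, LinearMap.add_comp, LinearMap.add_comp, map_add,
        LinearMap.add_apply]
    · change ExteriorAlgebra.ι ℂ (0, Finsupp.single k (s + t)) * v
        = ExteriorAlgebra.ι ℂ (0, Finsupp.single k s) * v
          + ExteriorAlgebra.ι ℂ (0, Finsupp.single k t) * v
      rw [← add_mul, ← map_add, Finsupp.single_add, Prod.mk_add_mk, add_zero]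
  map_smul' c t := by
    funext n
    refine LinearMap.ext fun v => ?_
    rcases n with k | k
    · change CliffordAlgebra.contractLeft _ v = c • CliffordAlgebra.contractLeft _ v
      rw [Submodule.coe_smul, map_smul, LinearMap.smul_comp, LinearMap.smul_comp, map_smul,
        LinearMap.smul_apply]
    · change ExteriorAlgebra.ι ℂ (0, Finsupp.single k (c • t)) * v
        = c • (ExteriorAlgebra.ι ℂ (0, Finsupp.single k t) * v)
      rw [← smul_mul_assoc, ← map_smul, Prod.smul_mk, smul_zero, Finsupp.smul_single]

theorem isFermionVertexAlgebraR (hD : (fockDataR g hsymm e f).IsPolarized) :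
    IsFermionVertexAlgebraR g T' T''
      (hD.fermions (chargeR_cr g hsymm e f)).vertexAlgebra where
  vacuum_eq := rfl
  gen_mem' x := hD.ι_mem_grading _ (chargeR_left _)
  gen_mem'' x := hD.ι_mem_grading _ (chargeR_right _)
  mode_eq l n v := by
    rw [GeneratingFields.vertexAlgebra_mode]
    refine (GeneratingFields.stateField_list_prod (ε := -1) rfl _ _ ?_ l).2 n v
    rintro (⟨k, a⟩ | ⟨k, a⟩)
    · obtain ⟨x, hx, hx'⟩ := GeneratingFields.exists_isCreation
        (hD.fermions_sign (chargeR_cr g hsymm e f))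
        (fun k => ExteriorAlgebra.ι ℂ ∘ₗ LinearMap.inl ℂ (ℕ →₀ T') (ℕ →₀ T'') ∘ₗ
          Finsupp.lsingle k) (fermionModeRLeft g) e.span_eq
        (by
          rintro _ ⟨i, rfl⟩
          refine ⟨Sum.inl i, ?_, fun k v => ?_⟩
          · funext n
            rcases n with k | k <;> rfl
          · change _ = (fockDataR g hsymm e f).fermionMode (Sum.inl i) (-1 - k) v
            rw [FockData.fermionMode_neg]
            rfl) a
      exact ⟨x, k, by rw [hx]; rfl, hx' k⟩
    · obtain ⟨x, hx, hx'⟩ := GeneratingFields.exists_isCreation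
        (hD.fermions_sign (chargeR_cr g hsymm e f))
        (fun k => ExteriorAlgebra.ι ℂ ∘ₗ LinearMap.inr ℂ (ℕ →₀ T') (ℕ →₀ T'') ∘ₗ
          Finsupp.lsingle k) (fermionModeRRight g) f.span_eq
        (by
          rintro _ ⟨i, rfl⟩
          refine ⟨Sum.inr i, ?_, fun k v => ?_⟩
          · funext n
            rcases n with k | k <;> rfl
          · change _ = (fockDataR g hsymm e f).fermionMode (Sum.inr i) (-1 - k) v
            rw [FockData.fermionMode_neg]
            rfl) a
      exact ⟨x, k, by rw [hx]; rfl, hx' k⟩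

end Ramond

open FormalDistribution

/-! ### Tensor products -/

namespace FormalDistribution

variable {U W : Type*} [AddCommGroup U] [Module ℂ U] [AddCommGroup W] [Module ℂ W]

/-- The field `a(z) ⊗ 1`. -/
def fieldRTensor (W : Type*) [AddCommGroup W] [Module ℂ W] (a : fieldSpace U) :
    fieldSpace (U ⊗[ℂ] W) :=
  ⟨fun n => (a.1 n).rTensor W, fun v => by
    induction v using TensorProduct.induction_on with
    | zero => exact Filter.Eventually.of_forall fun n => map_zero _
    | tmul x y =>
      filter_upwards [a.2 x] with n hn
      rw [LinearMap.rTensor_tmul, hn, TensorProduct.zero_tmul]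
    | add v w hv hw =>
      filter_upwards [hv, hw] with n hn hn'
      rw [map_add, hn, hn', add_zero]⟩

/-- The field `1 ⊗ b(z)`. -/
def fieldLTensor (U : Type*) [AddCommGroup U] [Module ℂ U] (b : fieldSpace W) :
    fieldSpace (U ⊗[ℂ] W) :=
  ⟨fun n => (b.1 n).lTensor U, fun v => by
    induction v using TensorProduct.induction_on with
    | zero => exact Filter.Eventually.of_forall fun n => map_zero _
    | tmul x y =>
      filter_upwards [b.2 y] with n hn
      rw [LinearMap.lTensor_tmul, hn, TensorProduct.tmul_zero]
    | add v w hv hw =>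
      filter_upwards [hv, hw] with n hn hn'
      rw [map_add, hn, hn', add_zero]⟩

theorem fieldRTensor_tmul (a : fieldSpace U) (n : ℤ) (x : U) (y : W) :
    (fieldRTensor W a).1 n (x ⊗ₜ y) = a.1 n x ⊗ₜ y := rfl

theorem fieldLTensor_tmul (b : fieldSpace W) (n : ℤ) (x : U) (y : W) :
    (fieldLTensor U b).1 n (x ⊗ₜ y) = x ⊗ₜ b.1 n y := rfl

theorem isLocal_fieldRTensor {ε : ℂ} {a b : fieldSpace U} (h : IsLocal ε a.1 b.1) :
    IsLocal ε (fieldRTensor W a).1 (fieldRTensor W b).1 := by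
  obtain ⟨N, h⟩ := (isLocal_iff _ _ _).mp h
  refine (isLocal_iff _ _ _).mpr ⟨N, fun m n v => ?_⟩
  induction v using TensorProduct.induction_on with
  | zero => simp
  | tmul x y =>
    simp only [fieldRTensor_tmul, TensorProduct.smul_tmul', ← TensorProduct.sub_tmul]
    rw [← TensorProduct.sum_tmul, h, TensorProduct.zero_tmul]
  | add v w hv hw =>
    simp only [map_add, smul_add, add_sub_add_comm, Finset.sum_add_distrib]
    rw [hv, hw, add_zero]

theorem isLocal_fieldLTensor {ε : ℂ} {a b : fieldSpace W} (h : IsLocal ε a.1 b.1) :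
    IsLocal ε (fieldLTensor U a).1 (fieldLTensor U b).1 := by
  obtain ⟨N, h⟩ := (isLocal_iff _ _ _).mp h
  refine (isLocal_iff _ _ _).mpr ⟨N, fun m n v => ?_⟩
  induction v using TensorProduct.induction_on with
  | zero => simp
  | tmul x y =>
    simp only [fieldLTensor_tmul, ← TensorProduct.tmul_smul, ← TensorProduct.tmul_sub]
    rw [← TensorProduct.tmul_sum, h, TensorProduct.tmul_zero]
  | add v w hv hw =>
    simp only [map_add, smul_add, add_sub_add_comm, Finset.sum_add_distrib]
    rw [hv, hw, add_zero]

theorem fieldRTensor_fieldLTensor (a : fieldSpace U) (b : fieldSpace W) (m n : ℤ)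
    (v : U ⊗[ℂ] W) : (fieldRTensor W a).1 m ((fieldLTensor U b).1 n v)
      = (fieldLTensor U b).1 n ((fieldRTensor W a).1 m v) := by
  induction v using TensorProduct.induction_on with
  | zero => simp
  | tmul x y => rfl
  | add v w hv hw => simp only [map_add, hv, hw]

theorem isLocal_fieldRTensor_fieldLTensor (a : fieldSpace U) (b : fieldSpace W) :
    IsLocal 1 (fieldRTensor W a).1 (fieldLTensor U b).1 :=
  (isLocal_iff _ _ _).mpr ⟨0, fun m n v => by
    simp [fieldRTensor_fieldLTensor]⟩

theorem isLocal_fieldLTensor_fieldRTensor (a : fieldSpace U) (b : fieldSpace W) :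
    IsLocal 1 (fieldLTensor U b).1 (fieldRTensor W a).1 :=
  (isLocal_fieldRTensor_fieldLTensor a b).symm (one_mul 1)

theorem finite_support_tmul (a : fieldSpace U) (b : fieldSpace W) (k : ℤ) (x : U) (y : W) :
    (Function.support fun m : ℤ => a.1 m x ⊗ₜ[ℂ] b.1 (k - 1 - m) y).Finite := by
  obtain ⟨N, hN⟩ := exists_bound a x
  obtain ⟨N', hN'⟩ := exists_bound b y
  refine (Set.finite_Icc (k - 1 - N') N).subset fun m hm => ?_
  rw [Function.mem_support] at hm
  by_contra hc
  rw [Set.mem_Icc, not_and_or] at hc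
  rcases hc with hc | hc
  · exact hm (by rw [hN' _ (by omega), TensorProduct.tmul_zero])
  · exact hm (by rw [hN _ (by omega), TensorProduct.zero_tmul])

/-- Splitting the integers at 0 matches the two halves of the normally ordered product. -/
theorem finsum_int {X : Type*} [AddCommMonoid X] {F : ℤ → X} (hF : (Function.support F).Finite) :
    ∑ᶠ m, F m = (∑ᶠ i : ℕ, F (0 - 1 - i)) + ∑ᶠ i : ℕ, F i := by
  have h1 : Function.Injective fun i : ℕ => (0 - 1 - (i : ℤ)) := fun i j h => by
    simpa using h
  have h2 : Function.Injective fun i : ℕ => (i : ℤ) := fun i j h => by simpa using h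
  rw [← finsum_mem_range (f := F) h1, ← finsum_mem_range (f := F) h2, ← finsum_mem_union']
  · have hU : (Set.range fun i : ℕ => (0 - 1 - (i : ℤ))) ∪ (Set.range fun i : ℕ => (i : ℤ))
        = Set.univ := Set.eq_univ_of_forall fun m => by
      rcases lt_or_ge m 0 with h | h
      · exact Or.inl ⟨(-1 - m).toNat, by simp only; omega⟩
      · exact Or.inr ⟨m.toNat, by simp only; omega⟩
    rw [hU, finsum_mem_univ]
  · refine Set.disjoint_left.mpr ?_
    rintro _ ⟨i, rfl⟩ ⟨j, hj⟩
    simp only at hj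
    omega
  · exact hF.subset Set.inter_subset_right
  · exact hF.subset Set.inter_subset_right

/-- The normally ordered product of `a(z) ⊗ 1` and `1 ⊗ b(z)`. -/
theorem normalOrder_tmul (a : fieldSpace U) (b : fieldSpace W) (k : ℤ) (x : U) (y : W) :
    (normalOrder 1 (fieldRTensor W a) (fieldLTensor U b)).1 k (x ⊗ₜ y)
      = ∑ᶠ m : ℤ, a.1 m x ⊗ₜ[ℂ] b.1 (k - 1 - m) y := by
  rw [finsum_int (finite_support_tmul a b k x y), normalOrder_apply, one_smul, halfProduct,
    halfProduct]
  congr 1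
  · refine finsum_congr fun i => ?_
    have e : k - 1 - (0 - 1 - i) = k + i := by ring
    rw [e]
    rfl
  · refine finsum_congr fun i => ?_
    rw [zero_add]
    rfl

end FormalDistribution

namespace VertexAlgebra

variable {U W : Type*} [AddCommGroup U] [Module ℂ U] [AddCommGroup W] [Module ℂ W]
  (A : VertexAlgebra U) (B : VertexAlgebra W)

/-- `Q` is the charge operator of the grading of `A`. -/
def IsChargeOperator (Q : Module.End ℂ U) : Prop :=
  ∀ p v, v ∈ A.grading p ↔ Q v = (p : ℂ) • v

variable {A}

theorem grading_induction {motive : U → Prop} (v : U)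
    (mem : ∀ (p : ℤ), ∀ v ∈ A.grading p, motive v) (zero : motive 0)
    (add : ∀ v w, motive v → motive w → motive (v + w)) : motive v := by
  have hv : v ∈ ⨆ p, A.grading p := by
    rw [A.isInternal.submodule_iSup_eq_top]; trivial
  exact Submodule.iSup_induction A.grading (motive := motive) hv mem zero add

theorem IsChargeOperator.mode {Q : Module.End ℂ U} (hQ : A.IsChargeOperator Q) {p : ℤ} {u : U}
    (hu : u ∈ A.grading p) (n : ℤ) (x : U) :
    Q (A.mode u n x) - A.mode u n (Q x) = (p : ℂ) • A.mode u n x := by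
  refine A.grading_induction (motive := fun x => Q (A.mode u n x) - A.mode u n (Q x)
    = (p : ℂ) • A.mode u n x) x (fun q x hx => ?_) (by simp) ?_
  · rw [(hQ q x).mp hx, (hQ _ _).mp (A.mode_mem_grading hu hx n), map_smul, ← sub_smul]
    congr 1
    push_cast
    ring
  · intro v w hv hw
    simp only [map_add, smul_add, ← hv, ← hw]
    abel

variable {Q : Module.End ℂ U} (hQ : A.IsChargeOperator Q) (hB : B.grading 0 = ⊤)

include hB in
theorem isLocal_mode_of_grading_zero (v w : W) : IsLocal 1 (B.mode v) (B.mode w) := by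
  have h := B.isLocal_mode (p := 0) (q := 0) (a := v) (b := w) (hB ▸ Submodule.mem_top)
    (hB ▸ Submodule.mem_top)
  simpa using h

/-- The generating fields of the tensor product of `A` and a purely even `B` in degree zero. -/
def tensorGenerating : GeneratingFields (U ⊗[ℂ] W) ((Σ p : ℤ, A.grading p) ⊕ W) where
  vac := A.vacuum ⊗ₜ B.vacuum
  T := A.translationOperator.rTensor W + B.translationOperator.lTensor U
  Q := Q.rTensor W
  field := Sum.elim (fun u => fieldRTensor W (A.modeField u.2)) fun v =>
    fieldLTensor U (B.modeField v)
  deg := Sum.elim (fun u => u.1) fun _ => 0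
  T_vac := by
    rw [LinearMap.add_apply, LinearMap.rTensor_tmul, LinearMap.lTensor_tmul,
      translationOperator_vacuum, translationOperator_vacuum, TensorProduct.zero_tmul,
      TensorProduct.tmul_zero, add_zero]
  Q_vac := by
    rw [LinearMap.rTensor_tmul, (hQ 0 _).mp A.vacuum_mem, Int.cast_zero, zero_smul,
      TensorProduct.zero_tmul]
  covariant := by
    rintro (⟨p, u⟩ | v)
    · refine ⟨fun n w => ?_, fun n w => ?_, fun n hn => ?_⟩
      · change (A.translationOperator.rTensor W + B.translationOperator.lTensor U)
            ((A.mode u n).rTensor W w) - (A.mode u n).rTensor W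
              ((A.translationOperator.rTensor W + B.translationOperator.lTensor U) w)
          = _ • (A.mode u (n - 1)).rTensor W w
        induction w using TensorProduct.induction_on with
        | zero => simp
        | tmul x y =>
          simp only [LinearMap.add_apply, LinearMap.rTensor_tmul, LinearMap.lTensor_tmul, map_add]
          rw [add_sub_add_right_eq_sub, ← TensorProduct.sub_tmul, A.translation_mode,
            TensorProduct.smul_tmul']
        | add v w hv hw =>
          rw [map_add, map_add, map_add, map_add, add_sub_add_comm, hv, hw, map_add, smul_add]
      · change Q.rTensor W ((A.mode u n).rTensor W w) - (A.mode u n).rTensor W (Q.rTensor W w)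
          = _ • (A.mode u n).rTensor W w
        induction w using TensorProduct.induction_on with
        | zero => simp
        | tmul x y =>
          simp only [LinearMap.rTensor_tmul]
          rw [← TensorProduct.sub_tmul, hQ.mode u.2, TensorProduct.smul_tmul']
          rfl
        | add v w hv hw =>
          rw [map_add, map_add, map_add, map_add, add_sub_add_comm, hv, hw, smul_add]
      · change A.mode u n A.vacuum ⊗ₜ B.vacuum = 0
        rw [A.mode_nonneg_vacuum _ hn, TensorProduct.zero_tmul]
    · refine ⟨fun n w => ?_, fun n w => ?_, fun n hn => ?_⟩
      · change (A.translationOperator.rTensor W + B.translationOperator.lTensor U)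
            ((B.mode v n).lTensor U w) - (B.mode v n).lTensor U
              ((A.translationOperator.rTensor W + B.translationOperator.lTensor U) w)
          = _ • (B.mode v (n - 1)).lTensor U w
        induction w using TensorProduct.induction_on with
        | zero => simp
        | tmul x y =>
          simp only [LinearMap.add_apply, LinearMap.rTensor_tmul, LinearMap.lTensor_tmul, map_add]
          rw [add_sub_add_left_eq_sub, ← TensorProduct.tmul_sub, B.translation_mode,
            TensorProduct.tmul_smul]
        | add v w hv hw =>
          rw [map_add, map_add, map_add, map_add, add_sub_add_comm, hv, hw, map_add, smul_add]
      · change Q.rTensor W ((B.mode v n).lTensor U w) - (B.mode v n).lTensor U (Q.rTensor W w)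
          = _ • (B.mode v n).lTensor U w
        rw [Sum.elim_inr, Int.cast_zero, zero_smul]
        induction w using TensorProduct.induction_on with
        | zero => simp
        | tmul x y => simp
        | add v w hv hw =>
          rw [map_add, map_add, map_add, map_add, add_sub_add_comm, hv, hw, add_zero]
      · change A.vacuum ⊗ₜ B.mode v n B.vacuum = 0
        rw [B.mode_nonneg_vacuum _ hn, TensorProduct.tmul_zero]
  isLocal := by
    rintro (⟨p, u⟩ | v) (⟨q, u'⟩ | v')
    · exact isLocal_fieldRTensor (A.isLocal_mode u.2 u'.2)
    · rw [Sum.elim_inr, mul_zero, zpow_zero]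
      exact isLocal_fieldRTensor_fieldLTensor _ _
    · rw [Sum.elim_inr, zero_mul, zpow_zero]
      exact isLocal_fieldLTensor_fieldRTensor _ _
    · rw [Sum.elim_inr, zero_mul, zpow_zero]
      exact isLocal_fieldLTensor (B.isLocal_mode_of_grading_zero hB v v')
  span S h1 h := by
    -- Since every homogeneous u and every v supplies a field, the (-1)-modes suffice: first u ⊗ |0⟩
    -- is reached, then u ⊗ v.
    have hx : ∀ x, x ⊗ₜ B.vacuum ∈ S := fun x => by
      refine A.grading_induction (motive := fun x => x ⊗ₜ B.vacuum ∈ S) x (fun p x hx => ?_)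
        (by rw [TensorProduct.zero_tmul]; exact S.zero_mem) ?_
      · have := h (Sum.inl ⟨p, x, hx⟩) 0 _ h1
        change A.mode x (-1 - (0 : ℕ)) A.vacuum ⊗ₜ B.vacuum ∈ S at this
        rwa [Nat.cast_zero, sub_zero, A.mode_neg_one_vacuum] at this
      · intro v w hv hw
        rw [TensorProduct.add_tmul]
        exact S.add_mem hv hw
    refine Submodule.eq_top_iff'.mpr fun v => ?_
    induction v using TensorProduct.induction_on with
    | zero => exact S.zero_mem
    | tmul x y =>
      have := h (Sum.inr y) 0 _ (hx x)
      change x ⊗ₜ B.mode y (-1 - (0 : ℕ)) B.vacuum ∈ S at this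
      rwa [Nat.cast_zero, sub_zero, B.mode_neg_one_vacuum] at this
    | add v w hv hw => exact S.add_mem hv hw

/-- The tensor product of `A` and a purely even `B` in degree zero. -/
def tensor : VertexAlgebra (U ⊗[ℂ] W) := (tensorGenerating B hQ hB).vertexAlgebra

theorem tmul_mem_tensor_grading {p : ℤ} {u : U} (hu : u ∈ A.grading p) (v : W) :
    u ⊗ₜ v ∈ (tensor B hQ hB).grading p := by
  refine (tensorGenerating B hQ hB).mem_grading.mpr ?_
  change Q u ⊗ₜ v = _
  rw [(hQ p u).mp hu, TensorProduct.smul_tmul']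

theorem stateField_vacuum_tmul (v : W) :
    (tensorGenerating B hQ hB).stateField (A.vacuum ⊗ₜ v) = fieldLTensor U (B.modeField v) := by
  have h := (tensorGenerating B hQ hB).stateField_generator (Sum.inr v)
  have h1 : ((tensorGenerating B hQ hB).field (Sum.inr v)).1 (-1) (tensorGenerating B hQ hB).vac
      = A.vacuum ⊗ₜ v := by
    change A.vacuum ⊗ₜ B.mode v (-1) B.vacuum = _
    rw [B.mode_neg_one_vacuum]
  rw [h1] at h
  exact h

theorem stateField_tmul_vacuum {p : ℤ} {u : U} (hu : u ∈ A.grading p) :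
    (tensorGenerating B hQ hB).stateField (u ⊗ₜ B.vacuum) = fieldRTensor W (A.modeField u) := by
  have h := (tensorGenerating B hQ hB).stateField_generator (Sum.inl ⟨p, u, hu⟩)
  have h1 : ((tensorGenerating B hQ hB).field (Sum.inl ⟨p, u, hu⟩)).1 (-1)
      (tensorGenerating B hQ hB).vac = u ⊗ₜ B.vacuum := by
    change A.mode u (-1) A.vacuum ⊗ₜ B.vacuum = _
    rw [A.mode_neg_one_vacuum]
  rw [h1] at h
  exact h

theorem tensor_mode_left {p : ℤ} {u : U} (hu : u ∈ A.grading p) (n : ℤ) :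
    (tensor B hQ hB).mode (u ⊗ₜ B.vacuum) n = (A.mode u n).rTensor W := by
  rw [tensor, GeneratingFields.vertexAlgebra_mode, stateField_tmul_vacuum B hQ hB hu]
  rfl

theorem tensor_mode_right (v : W) (n : ℤ) :
    (tensor B hQ hB).mode (A.vacuum ⊗ₜ v) n = (B.mode v n).lTensor U := by
  rw [tensor, GeneratingFields.vertexAlgebra_mode, stateField_vacuum_tmul]
  rfl

/-- u ⊗ v is the (-1)-product of u ⊗ |0⟩ with |0⟩ ⊗ v, so its field is a normally ordered product.
Homogeneity of u is needed only to have a generating field, and linearity removes it. -/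
theorem tensor_mode_tmul (u x : U) (v y : W) (k : ℤ) :
    (tensor B hQ hB).mode (u ⊗ₜ v) k (x ⊗ₜ y)
      = ∑ᶠ m : ℤ, A.mode u m x ⊗ₜ[ℂ] B.mode v (k - 1 - m) y := by
  have hfin : ∀ u, (Function.support fun m : ℤ =>
      A.mode u m x ⊗ₜ[ℂ] B.mode v (k - 1 - m) y).Finite := fun u =>
    finite_support_tmul (A.modeField u) (B.modeField v) k x y
  refine A.grading_induction (motive := fun u => (tensor B hQ hB).mode (u ⊗ₜ v) k (x ⊗ₜ y)
      = ∑ᶠ m : ℤ, A.mode u m x ⊗ₜ[ℂ] B.mode v (k - 1 - m) y) u (fun p u hu => ?_) ?_ ?_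
  · have h := (tensorGenerating B hQ hB).stateField_normalOrder (Sum.inl ⟨p, u, hu⟩) 0
      (tmul_mem_tensor_grading B hQ hB A.vacuum_mem v)
    have h1 : ((tensorGenerating B hQ hB).field (Sum.inl ⟨p, u, hu⟩)).1 (-1 - (0 : ℕ))
        (A.vacuum ⊗ₜ v) = u ⊗ₜ v := by
      change A.mode u (-1 - (0 : ℕ)) A.vacuum ⊗ₜ v = _
      rw [Nat.cast_zero, sub_zero, A.mode_neg_one_vacuum]
    have h2 : fieldDividedDeriv 0 ((tensorGenerating B hQ hB).field (Sum.inl ⟨p, u, hu⟩))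
        = fieldRTensor W (A.modeField u) := by
      rw [fieldDividedDeriv, Nat.factorial_zero, Nat.cast_one, inv_one, one_smul]
      rfl
    rw [h1, h2, mul_zero, zpow_zero, stateField_vacuum_tmul] at h
    rw [tensor, GeneratingFields.vertexAlgebra_mode, h, normalOrder_tmul]
    rfl
  · simp only [mode_zero, TensorProduct.zero_tmul, LinearMap.zero_apply, finsum_zero]
  · intro u u' h h'
    rw [TensorProduct.add_tmul, mode_add, LinearMap.add_apply, h, h',
      ← finsum_add_distrib (hfin u) (hfin u')]
    refine finsum_congr fun m => ?_
    rw [mode_add, LinearMap.add_apply, TensorProduct.add_tmul]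

include hB in
theorem eq_zero_of_mem_grading {q : ℤ} (hq : q ≠ 0) {v : W} (hv : v ∈ B.grading q) :
    v = 0 := by
  have h := B.isInternal.submodule_iSupIndep.pairwiseDisjoint hq
  change Disjoint (B.grading q) (B.grading 0) at h
  rw [hB, disjoint_top] at h
  rw [h] at hv
  exact hv

/-- B is concentrated in degree 0, so the Koszul sign is 1 in the only nontrivial case. -/
theorem isTensorProduct_tensor : IsTensorProduct A B (tensor B hQ hB) where
  vacuum_eq := rfl
  grading_mem {p q u v} hu hv := by
    rcases eq_or_ne q 0 with rfl | hq
    · rw [add_zero]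
      exact tmul_mem_tensor_grading B hQ hB hu v
    · rw [B.eq_zero_of_mem_grading hB hq hv, TensorProduct.tmul_zero]
      exact Submodule.zero_mem _
  mode_tmul {p q x v} _ hv u y k := by
    rcases eq_or_ne q 0 with rfl | hq
    · rw [mul_zero, zpow_zero, one_smul, tensor_mode_tmul]
    · rw [B.eq_zero_of_mem_grading hB hq hv, TensorProduct.tmul_zero]
      simp only [mode_zero, TensorProduct.tmul_zero, LinearMap.zero_apply, finsum_zero, smul_zero]

/-- Free fields in a tensor product. -/
theorem FreeFields.tensorProduct {ι κ : Type*} [DecidableEq ι] [DecidableEq κ] {d d' : ℤ}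
    {φ ψ : ι → U} {b c : κ → W}
    (hA : FreeFields A d φ ψ (Empty.elim : Empty → U) Empty.elim)
    (hB' : FreeFields B d' (Empty.elim : Empty → W) Empty.elim b c) :
    FreeFields (tensor B hQ hB) d (fun i => φ i ⊗ₜ B.vacuum) (fun i => ψ i ⊗ₜ B.vacuum)
      (fun i => A.vacuum ⊗ₜ b i) (fun i => A.vacuum ⊗ₜ c i) := by
  have hφ : ∀ i n, (tensor B hQ hB).mode (φ i ⊗ₜ B.vacuum) n = (A.mode (φ i) n).rTensor W :=
    fun i => tensor_mode_left B hQ hB (hA.φ_mem i)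
  have hψ : ∀ i n, (tensor B hQ hB).mode (ψ i ⊗ₜ B.vacuum) n = (A.mode (ψ i) n).rTensor W :=
    fun i => tensor_mode_left B hQ hB (hA.ψ_mem i)
  have hcomm : ∀ u v m n (w : U ⊗[ℂ] W), (A.mode u m).rTensor W ((B.mode v n).lTensor U w)
      = (B.mode v n).lTensor U ((A.mode u m).rTensor W w) := fun u v =>
    fieldRTensor_fieldLTensor (A.modeField u) (B.modeField v)
  have hanti : ∀ (u u' : U) (m n : ℤ) (r : ℂ),
      (∀ x, A.mode u m (A.mode u' n x) + A.mode u' n (A.mode u m x) = r • x) →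
      ∀ w, (A.mode u m).rTensor W ((A.mode u' n).rTensor W w)
        + (A.mode u' n).rTensor W ((A.mode u m).rTensor W w) = r • w := by
    intro u u' m n r h w
    induction w using TensorProduct.induction_on with
    | zero => simp
    | tmul x y =>
      simp only [LinearMap.rTensor_tmul]
      rw [← TensorProduct.add_tmul, h, TensorProduct.smul_tmul']
    | add v w hv hw =>
      simp only [map_add, smul_add, ← hv, ← hw]
      abel
  have hbos : ∀ (v v' : W) (m n : ℤ) (r : ℂ),
      (∀ x, B.mode v m (B.mode v' n x) - B.mode v' n (B.mode v m x) = r • x) →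
      ∀ w, (B.mode v m).lTensor U ((B.mode v' n).lTensor U w)
        - (B.mode v' n).lTensor U ((B.mode v m).lTensor U w) = r • w := by
    intro u u' m n r h w
    induction w using TensorProduct.induction_on with
    | zero => simp
    | tmul x y =>
      simp only [LinearMap.lTensor_tmul]
      rw [← TensorProduct.tmul_sub, h, TensorProduct.tmul_smul]
    | add v w hv hw =>
      simp only [map_add, smul_add, ← hv, ← hw]
      abel
  exact
  { odd := hA.odd
    φ_mem := fun i => tmul_mem_tensor_grading B hQ hB (hA.φ_mem i) _
    ψ_mem := fun i => tmul_mem_tensor_grading B hQ hB (hA.ψ_mem i) _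
    b_mem := fun i => tmul_mem_tensor_grading B hQ hB A.vacuum_mem _
    c_mem := fun i => tmul_mem_tensor_grading B hQ hB A.vacuum_mem _
    φψ := fun i j m n v => by
      rw [hφ, hψ, hanti _ _ m n (if i = j ∧ m + n = -1 then 1 else 0) fun x => by
        rw [hA.φψ, ite_smul, one_smul, zero_smul], ite_smul, one_smul, zero_smul]
    φφ := fun i j m n v => by
      rw [hφ, hφ, hanti _ _ m n 0 fun x => by rw [hA.φφ, zero_smul], zero_smul]
    ψψ := fun i j m n v => by
      rw [hψ, hψ, hanti _ _ m n 0 fun x => by rw [hA.ψψ, zero_smul], zero_smul]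
    bc := fun i j m n v => by
      rw [tensor_mode_right, tensor_mode_right,
        hbos _ _ m n (if i = j ∧ m + n = 0 then (m : ℂ) else 0) fun x => by
          rw [hB'.bc, ite_smul, zero_smul], ite_smul, zero_smul]
    bb := fun i j m n v => by
      rw [tensor_mode_right, tensor_mode_right]
      refine sub_eq_zero.mp ?_
      rw [hbos _ _ m n 0 fun x => by rw [hB'.bb, sub_self, zero_smul], zero_smul]
    cc := fun i j m n v => by
      rw [tensor_mode_right, tensor_mode_right]
      refine sub_eq_zero.mp ?_
      rw [hbos _ _ m n 0 fun x => by rw [hB'.cc, sub_self, zero_smul], zero_smul]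
    φb := fun i j m n v => by rw [hφ, tensor_mode_right, hcomm]
    φc := fun i j m n v => by rw [hφ, tensor_mode_right, hcomm]
    ψb := fun i j m n v => by rw [hψ, tensor_mode_right, hcomm]
    ψc := fun i j m n v => by rw [hψ, tensor_mode_right, hcomm]
    generates := fun S h1 h => by
      -- The fermions first generate U ⊗ |0⟩; for fixed x the bosons then generate x ⊗ W.
      have hx : S.comap ((TensorProduct.mk ℂ U W).flip B.vacuum) = ⊤ := by
        refine hA.generates _ h1 ?_
        rintro ((i | i) | i) k x hx
        · have := h (Sum.inl (Sum.inl i)) k _ hx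
          rw [Sum.elim_inl, Sum.elim_inl, hφ] at this
          exact this
        · have := h (Sum.inl (Sum.inr i)) k _ hx
          rw [Sum.elim_inl, Sum.elim_inr, hψ] at this
          exact this
        · rcases i with i | i <;> exact i.elim
      have hy : ∀ x, S.comap (TensorProduct.mk ℂ U W x) = ⊤ := by
        intro x
        refine hB'.generates _ ?_ ?_
        · have : x ∈ S.comap ((TensorProduct.mk ℂ U W).flip B.vacuum) := hx ▸ Submodule.mem_top
          exact this
        · rintro (i | (i | i)) k y hy
          · rcases i with i | i <;> exact i.elim
          · have := h (Sum.inr (Sum.inl i)) k _ hy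
            rw [Sum.elim_inr, Sum.elim_inl, tensor_mode_right] at this
            exact this
          · have := h (Sum.inr (Sum.inr i)) k _ hy
            rw [Sum.elim_inr, Sum.elim_inr, tensor_mode_right] at this
            exact this
      refine Submodule.eq_top_iff'.mpr fun v => ?_
      induction v using TensorProduct.induction_on with
      | zero => exact S.zero_mem
      | tmul x y =>
        have : y ∈ S.comap (TensorProduct.mk ℂ U W x) := hy x ▸ Submodule.mem_top
        exact this
      | add v w hv hw => exact S.add_mem hv hw }

end VertexAlgebra

open FormalDistribution

/-! ### The `N = 2` structure -/

namespace FockData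

variable {M M' ι : Type*} [AddCommGroup M] [Module ℂ M] [AddCommGroup M'] [Module ℂ M']
  [DecidableEq ι] [Fintype ι] {D : FockData M (ι ⊕ ι)} {D' : FockData M' (ι ⊕ ι)}
  (hD : D.IsPolarized) (hD' : D'.IsPolarized)
  {Q : Module.End ℂ M} (hQ : ∀ i k, Q (D.cr i k) = (polarDeg i : ℂ) • D.cr i k)

theorem IsPolarized.isChargeOperator_fermions :
    (hD.fermions hQ).vertexAlgebra.IsChargeOperator (hD.fermions hQ).Q := fun _ _ =>
  (hD.fermions hQ).mem_grading

/-- The vertex algebra of polarized fermions and bosons. -/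
def IsPolarized.total (D' : FockData M' (ι ⊕ ι)) :
    VertexAlgebra (ExteriorAlgebra ℂ M ⊗[ℂ] SymmetricAlgebra ℂ M') :=
  VertexAlgebra.tensor D'.bosonGenerating.vertexAlgebra (hD.isChargeOperator_fermions hQ)
    bosons_grading

theorem IsPolarized.isTensorProduct_total : VertexAlgebra.IsTensorProduct
    (hD.fermions hQ).vertexAlgebra D'.bosonGenerating.vertexAlgebra (hD.total hQ D') :=
  VertexAlgebra.isTensorProduct_tensor _ _ _

-- The modes -1 and -2 act as multiplication by creation vectors, which turns the abstract vectors
-- of the free field system into the explicit products.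
include hD' in
theorem IsPolarized.isN2Superconformal_total :
    (hD.total hQ D').IsN2Superconformal (1 / 2) (3 * Fintype.card ι)
      (conformalVector (fun k i => ExteriorAlgebra.ι ℂ (D.cr (Sum.inl i) k))
        (fun k i => ExteriorAlgebra.ι ℂ (D.cr (Sum.inr i) k))
        (fun i => SymmetricAlgebra.ι ℂ M' (D'.cr (Sum.inl i) 0))
        (fun i => SymmetricAlgebra.ι ℂ M' (D'.cr (Sum.inr i) 0)))
      (tauPlus (fun k i => ExteriorAlgebra.ι ℂ (D.cr (Sum.inr i) k))
        (fun i => SymmetricAlgebra.ι ℂ M' (D'.cr (Sum.inl i) 0)))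
      (tauMinus (fun k i => ExteriorAlgebra.ι ℂ (D.cr (Sum.inl i) k))
        (fun i => SymmetricAlgebra.ι ℂ M' (D'.cr (Sum.inr i) 0)))
      (currentVector (SymmetricAlgebra ℂ M') (fun k i => ExteriorAlgebra.ι ℂ (D.cr (Sum.inl i) k))
        (fun k i => ExteriorAlgebra.ι ℂ (D.cr (Sum.inr i) k))) := by
  have hf := hD.freeFields_fermions hQ
  have h := (hf.tensorProduct _ (hD.isChargeOperator_fermions hQ) bosons_grading
    hD'.freeFields_bosons).isN2Superconformal
  have hφ : ∀ i n (w : ExteriorAlgebra ℂ M ⊗[ℂ] SymmetricAlgebra ℂ M'),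
      (hD.total hQ D').mode (ExteriorAlgebra.ι ℂ (D.cr i 0) ⊗ₜ 1) n w
        = (D.fermionMode i n).rTensor _ w := fun i n w => by
    rw [← hD.fermions_mode hQ]
    exact DFunLike.congr_fun (VertexAlgebra.tensor_mode_left _ (hD.isChargeOperator_fermions hQ)
      bosons_grading (hD.ι_mem_grading hQ (hQ i 0)) n) w
  have hb : ∀ i n (w : ExteriorAlgebra ℂ M ⊗[ℂ] SymmetricAlgebra ℂ M'),
      (hD.total hQ D').mode (1 ⊗ₜ SymmetricAlgebra.ι ℂ M' (D'.cr i 0)) n w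
        = (D'.bosonModes i n).lTensor _ w := fun i n w => by
    rw [← bosons_mode]
    exact DFunLike.congr_fun (VertexAlgebra.tensor_mode_right _ (hD.isChargeOperator_fermions hQ)
      bosons_grading _ n) w
  have e1 : ∀ i, D.fermionMode i (-1) = LinearMap.mulLeft ℂ (ExteriorAlgebra.ι ℂ (D.cr i 0)) :=
    fun i => D.fermionMode_neg i 0
  have e2 : ∀ i, D.fermionMode i (-2) = LinearMap.mulLeft ℂ (ExteriorAlgebra.ι ℂ (D.cr i 1)) :=
    fun i => D.fermionMode_neg i 1
  have e3 : ∀ i, D'.bosonModes i (-1)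
      = LinearMap.mulLeft ℂ (SymmetricAlgebra.ι ℂ M' (D'.cr i 0)) :=
    fun i => D'.bosonModes_neg i 0
  convert h using 1
  · rfl
  · simp only [conformalVector, VertexAlgebra.freeConformalVector, Finset.sum_add_distrib]
    rw [add_assoc]
    congr 1
    · refine Finset.sum_congr rfl fun i _ => ?_
      refine Eq.trans ?_ (hb _ _ _).symm
      rw [e3]
      rfl
    · congr 1
      · rw [← Finset.smul_sum]
        congr 1
        · norm_num
        · refine Finset.sum_congr rfl fun i _ => ?_
          refine Eq.trans ?_ (hφ _ _ _).symm
          rw [e2]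
          rfl
      · rw [← Finset.smul_sum]
        congr 1
        refine Finset.sum_congr rfl fun i _ => ?_
        refine Eq.trans ?_ (hφ _ _ _).symm
        rw [e2]
        rfl
  · refine Finset.sum_congr rfl fun i _ => ?_
    refine Eq.trans ?_ (hφ _ _ _).symm
    rw [e1, LinearMap.rTensor_tmul, LinearMap.mulLeft_apply]
    exact congrArg (· ⊗ₜ _) (mul_one _).symm
  · refine Finset.sum_congr rfl fun i _ => ?_
    refine Eq.trans ?_ (hφ _ _ _).symm
    rw [e1, LinearMap.rTensor_tmul, LinearMap.mulLeft_apply]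
    exact congrArg (· ⊗ₜ _) (mul_one _).symm
  · refine Finset.sum_congr rfl fun i _ => ?_
    refine Eq.trans ?_ (hφ _ _ _).symm
    rw [e1]
    rfl

end FockData

/-! ### The change of normalization and the assembly of both sectors -/

theorem VertexAlgebra.IsN2Superconformal.rescale_sqrt_two {V : Type*} [AddCommGroup V]
    [Module ℂ V] {A : VertexAlgebra V} {c : ℂ} {ν τp τm j : V}
    (h : A.IsN2Superconformal (1 / 2) c ν τp τm j) :
    A.IsN2Superconformal 1 c ν ((Real.sqrt 2 : ℂ) • τp) ((Real.sqrt 2 : ℂ) • τm) j := by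
  have h' := h.rescale (Real.sqrt 2 : ℂ)
  have e : (Real.sqrt 2 : ℂ) ^ 2 = 2 := by
    rw [← Complex.ofReal_pow, Real.sq_sqrt (by norm_num)]
    norm_num
  rw [e] at h'
  norm_num at h' ⊢
  exact h'

end

theorem proposition5p1 {T : Type*} [AddCommGroup T] [Module ℂ T] [FiniteDimensional ℂ T]
    (g : LinearMap.BilinForm ℂ T) (hsymm : g.IsSymm) (hnondeg : g.Nondegenerate)
    (T' T'' : Submodule ℂ T) (hcompl : IsCompl T' T'')
    (hiso' : ∀ x ∈ T', ∀ y ∈ T', g x y = 0) (hiso'' : ∀ x ∈ T'', ∀ y ∈ T'', g x y = 0)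
    {ι : Type*} [Fintype ι] [DecidableEq ι]
    (e : Module.Basis ι ℂ T') (f : Module.Basis ι ℂ T'')
    (hdual : ∀ i j, g (e i : T) (f j : T) = if i = j then 1 else 0) :
    ∃ B : VertexAlgebra (BosonFock T), IsBosonVertexAlgebra g B ∧
      -- the NS sector
      (∃ F : VertexAlgebra (FermionFockNS T), IsFermionVertexAlgebraNS g T' T'' F ∧
        (∀ lam : ℂ, F.IsConformal
          (fermionConformalVector (fun k i => fermionGenNS k (e i : T))
            (fun k i => fermionGenNS k (f i : T)) lam)
          (-(6 * lam ^ 2 - 6 * lam + 1) * (Module.finrank ℂ T : ℂ))) ∧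
        ∃ V : VertexAlgebra (FermionFockNS T ⊗[ℂ] BosonFock T),
          VertexAlgebra.IsTensorProduct F B V ∧
          (let φ : ℕ → ι → FermionFockNS T := fun k i => fermionGenNS k (e i : T)
           let ψ : ℕ → ι → FermionFockNS T := fun k i => fermionGenNS k (f i : T)
           let b : ι → BosonFock T := fun i => bosonGen 0 (e i : T)
           let c : ι → BosonFock T := fun i => bosonGen 0 (f i : T)
           let τp := tauPlus ψ b
           let τm := tauMinus φ c
           let j := currentVector (BosonFock T) φ ψ
           let ν := conformalVector φ ψ b c
           V.IsN2Superconformal (1 / 2) (3 / 2 * (Module.finrank ℂ T : ℂ)) ν τp τm j ∧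
           V.IsN2Superconformal 1 (3 / 2 * (Module.finrank ℂ T : ℂ)) ν
             ((Real.sqrt 2 : ℂ) • τp) ((Real.sqrt 2 : ℂ) • τm) j)) ∧
      -- the R sector
      (∃ F : VertexAlgebra (FermionFockR T' T''), IsFermionVertexAlgebraR g T' T'' F ∧
        (∀ lam : ℂ, F.IsConformal
          (fermionConformalVector (fun k i => fermionGenR (Sum.inl (k, e i)))
            (fun k i => fermionGenR (Sum.inr (k, f i))) lam)
          (-(6 * lam ^ 2 - 6 * lam + 1) * (Module.finrank ℂ T : ℂ))) ∧
        ∃ V : VertexAlgebra (FermionFockR T' T'' ⊗[ℂ] BosonFock T),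
          VertexAlgebra.IsTensorProduct F B V ∧
          (let φ : ℕ → ι → FermionFockR T' T'' := fun k i => fermionGenR (Sum.inl (k, e i))
           let ψ : ℕ → ι → FermionFockR T' T'' := fun k i => fermionGenR (Sum.inr (k, f i))
           let b : ι → BosonFock T := fun i => bosonGen 0 (e i : T)
           let c : ι → BosonFock T := fun i => bosonGen 0 (f i : T)
           let τp := tauPlus ψ b
           let τm := tauMinus φ c
           let j := currentVector (BosonFock T) φ ψ
           let ν := conformalVector φ ψ b c
           V.IsN2Superconformal (1 / 2) (3 / 2 * (Module.finrank ℂ T : ℂ)) ν τp τm j ∧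
           V.IsN2Superconformal 1 (3 / 2 * (Module.finrank ℂ T : ℂ)) ν
             ((Real.sqrt 2 : ℂ) • τp) ((Real.sqrt 2 : ℂ) • τm) j)) := by
  -- The bases of T' and T'' share an index set, which turns 3|ι| into (3/2) dim T.
  have hdim : (Module.finrank ℂ T : ℂ) = 2 * Fintype.card ι := by
    rw [← Submodule.finrank_add_eq_of_isCompl hcompl, Module.finrank_eq_card_basis e,
      Module.finrank_eq_card_basis f]
    push_cast
    ring
  have hc : (3 / 2 * (Module.finrank ℂ T : ℂ)) = 3 * Fintype.card ι := by
    rw [hdim]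
    ring
  have hNS := isPolarized_fockDataNS g hsymm hcompl hiso' hiso'' e f hdual
  have hR := isPolarized_fockDataR g hsymm e f hdual
  rw [hc, hdim]
  refine ⟨(fockDataNS g hsymm hcompl e f).bosonGenerating.vertexAlgebra,
    isBosonVertexAlgebra g hsymm _ _, ?_, ?_⟩
  · have hN2 := hNS.isN2Superconformal_total hNS (chargeNS_cr g hsymm hcompl e f)
    exact ⟨_, isFermionVertexAlgebraNS g hsymm hcompl e f hNS,
      hNS.isConformal_fermions (chargeNS_cr g hsymm hcompl e f), _,
      hNS.isTensorProduct_total (chargeNS_cr g hsymm hcompl e f), hN2, hN2.rescale_sqrt_two⟩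
  -- The bosonic factor is the same in both sectors, so its polarization comes from `hNS`.
  · have hN2 := hR.isN2Superconformal_total hNS (chargeR_cr g hsymm e f)
    exact ⟨_, isFermionVertexAlgebraR g hsymm e f hR,
      hR.isConformal_fermions (chargeR_cr g hsymm e f), _,
      hR.isTensorProduct_total (chargeR_cr g hsymm e f), hN2, hN2.rescale_sqrt_two⟩
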